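/- For a binary form $F(x,y)$ with real coefficients of degree $n$, let $D_F$ denote its discriminant (so that $D_F=\prod_{i<j}(a_ib_j-a_jb_i)^2$ if $F=\prod_{i=1}^n(a_ix-b_iy)$ over $\mathbb C$), let $A_F\in[0,\infty]$ be the area of the region $\{(x,y)\in\mathbb R^2 : |F(x,y)|\le 1\}$, and put $$Q(F)=|D_F|^{1/(n(n-1))}A_F .$$ The homogenization of a polynomial $p$ is $y^{\deg p}p(x/y)$. Let $\Psi_n(x,y)$ and $\Pi_n(x,y)$ be the homogenizations of the minimal polynomials over $\mathbb Q$ of $2\cos(2\pi/n)$ and $2\sin(2\pi/n)$, respectively (in $Q(\Psi_n)$ and $Q(\Pi_n)$ the exponent is formed with the degree of the form, not with the index $n$), let $T_n(x,y)$ and $U_n(x,y)$ be the homogenizations of the $n$-th Chebyshev polynomials of the first and second kind, respectively, and let $$S_n(x,y)=2^{\,n-1-\nu_2(n)}\prod_{k=1}^n\left(\sin\left(\tfrac{k\pi}{n}\right)x-\cos\left(\tfrac{k\pi}{n}\right)y\right),$$ where $\nu_2(n)$ is the $2$-adic order of $n$. For every integer $n\ge 3$ the forms $S_n$, $T_n$,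 $U_n$ have non-zero discriminant, $Q(S_n)$ is finite, and $$Q(T_n)\le Q(S_n),\qquad Q(U_n)\le Q(S_n).$$ Furthermore, $$\lim_{n\to\infty}Q(\Psi_n)=\lim_{n\to\infty}Q(\Pi_n)=\lim_{n\to\infty}Q(T_n)=\lim_{n\to\infty}Q(U_n)=\frac{16}{3}.$$ -/

import Mathlib

noncomputable section

namespace BinaryForm

/-- A binary form is a homogeneous polynomial in the two variables `x = X 0` and `y = X 1`.
`dehom F` is the one-variable polynomial `F(X, 1)`. -/
def dehom (F : MvPolynomial (Fin 2) ℝ) : Polynomial ℝ :=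
  MvPolynomial.aeval ![Polynomial.X, 1] F

/-- The resultant of two binary forms of degree `m` and `k`: the determinant of their
Sylvester matrix of formal sizes `m` and `k` (so that common zeros at infinity count). -/
def res (G H : MvPolynomial (Fin 2) ℝ) (m k : ℕ) : ℝ :=
  Polynomial.resultant (dehom G) (dehom H) m k

/-- The discriminant of a binary form `F` of degree `n ≥ 2`:
`(-1) ^ (n (n - 1) / 2) / n ^ (n - 2)` times the resultant of the two partial derivatives of `F`,
which are forms of degree `n - 1`.
For `F = ∏ (aᵢ x - bᵢ y)` this is `∏_{i < j} (aᵢ bⱼ - aⱼ bᵢ) ^ 2`. -/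
def disc (F : MvPolynomial (Fin 2) ℝ) : ℝ :=
  (-1) ^ (F.totalDegree * (F.totalDegree - 1) / 2) / (F.totalDegree : ℝ) ^ (F.totalDegree - 2) *
    res (MvPolynomial.pderiv 0 F) (MvPolynomial.pderiv 1 F)
      (F.totalDegree - 1) (F.totalDegree - 1)

/-- The area `A_F` (possibly infinite) of the fundamental region `{(x, y) : |F(x, y)| ≤ 1}`. -/
def area (F : MvPolynomial (Fin 2) ℝ) : ENNReal :=
  MeasureTheory.volume {p : ℝ × ℝ | |MvPolynomial.eval ![p.1, p.2] F| ≤ 1}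

/-- `Q(F) = |D_F| ^ (1 / (n (n - 1))) * A_F`, where `n` is the degree of `F`. -/
def Q (F : MvPolynomial (Fin 2) ℝ) : ENNReal :=
  ENNReal.ofReal
    (|disc F| ^ (1 / ((F.totalDegree : ℝ) * ((F.totalDegree : ℝ) - 1)))) * area F

/-- The homogenization `y ^ (deg p) * p(x / y)` of a one-variable polynomial `p`. -/
def homog (p : Polynomial ℝ) : MvPolynomial (Fin 2) ℝ :=
  p.homogenize p.natDegree

/-- The homogenization of the minimal polynomial of `2 cos (2 π / n)`. -/
def Psi (n : ℕ) : MvPolynomial (Fin 2) ℝ :=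
  homog ((minpoly ℚ (2 * Real.cos (2 * Real.pi / n))).map (algebraMap ℚ ℝ))

/-- The homogenization of the minimal polynomial of `2 sin (2 π / n)`. -/
def Pi (n : ℕ) : MvPolynomial (Fin 2) ℝ :=
  homog ((minpoly ℚ (2 * Real.sin (2 * Real.pi / n))).map (algebraMap ℚ ℝ))

/-- The homogenization of the Chebyshev polynomial of the first kind. -/
def T (n : ℕ) : MvPolynomial (Fin 2) ℝ :=
  homog (Polynomial.Chebyshev.T ℝ n)

/-- The homogenization of the Chebyshev polynomial of the second kind. -/
def U (n : ℕ) : MvPolynomial (Fin 2) ℝ :=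
  homog (Polynomial.Chebyshev.U ℝ n)

/-- The form `∏_{k = 1}^n (sin (k π / n) x - cos (k π / n) y)`. -/
def Fstar (n : ℕ) : MvPolynomial (Fin 2) ℝ :=
  ∏ k ∈ Finset.Icc 1 n,
    (MvPolynomial.C (Real.sin (k * Real.pi / n)) * MvPolynomial.X 0 -
      MvPolynomial.C (Real.cos (k * Real.pi / n)) * MvPolynomial.X 1)

/-- The form `2 ^ (n - 1 - ν₂(n)) * Fstar n`, where `ν₂` is the 2-adic valuation; the exponent
is a nonnegative integer for every `n ≥ 1`. -/
def S (n : ℕ) : MvPolynomial (Fin 2) ℝ :=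
  MvPolynomial.C (2 ^ (n - 1 - padicValNat 2 n)) * Fstar n

end BinaryForm

end

/-! ### Discriminant of a form F in terms of the polynomial F(x, 1) -/

noncomputable section

namespace BinaryForm

open Polynomial

/-! For a form F of degree n with f(t) = F(t, 1), the substitution x = ty turns the area into A_F =
∫ |f(t)|^(-2/n) dt (`area_eq`). Everything is read off from this integral and from formulas or
bounds for the discriminant.

Limits. Rescaling x by 2 turns T_n and U_n into the polynomials C_n and S_n of Mathlib. These and
the two kinds of minimal polynomials p, of degree d, are cyclotomic quotients: |p(z + 1/z)| |z|^d is
a product of factors |z^e - 1|^(±1). For the minimal polynomials this is the Möbius factorization of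
a cyclotomic polynomial Φ_m. If the number of factors is o(d), then |p(x)|^(-2/d) tends to 1 on [-2,
2], where |z| = 1, and to q^2 at x = ±(q + 1/q), 0 < q < 1. The first region contributes its length
4, the others ∫ (1 - q^2) dq = 2/3 each, and 4 + 2/3 + 2/3 = 16/3. Uniformity near the zeros comes
from Bernoulli's inequality and the integrability of |sin|^(-1/2) and (1 - q)^(-1/2)
(`areaInt_bounds`). The discriminant factor tends to 1: it is explicit for T_n and U_n, and for the
minimal polynomials 1 ≤ |D| ≤ m^d with m ≤ 384 d^3.

Inequalities. Since |S_n(cos t, sin t)| = κ |sin nt|, the area of S_n is κ^(-2/n) J with J = ∫ |sin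
t|^(-2/n) dt over a half period, and κ cancels in Q. For T_n and U_n the part of the integral over
[-2, 2] is J weighted by a power of sin θ; averaging the weight over translates by π/N (N = n, resp.
n + 1) bounds it by a constant times J (`areaInt_C_le`, `areaInt_S_le`). The outer part is at most
4/3. With J ≥ π + 4/(n - 2) a numerical inequality remains. It is uniform for large n and checked
case by case for small n. For n = 3 all three values of Q agree, as cubic forms with three real
zeros are linearly equivalent. -/

lemma dehom_homog (p : ℝ[X]) : dehom (homog p) = p := by
  simp [dehom, homog]

lemma homog_ne_zero {p : ℝ[X]} (hp : p ≠ 0) : homog p ≠ 0 := fun h ↦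
  hp (Polynomial.eq_zero_of_homogenize_eq_zero le_rfl h)

lemma isHomogeneous_homog (p : ℝ[X]) : (homog p).IsHomogeneous p.natDegree :=
  Polynomial.isHomogeneous_homogenize p

lemma totalDegree_homog {p : ℝ[X]} (hp : p ≠ 0) : (homog p).totalDegree = p.natDegree :=
  (isHomogeneous_homog p).totalDegree (homog_ne_zero hp)

lemma dehom_pderiv_zero (F : MvPolynomial (Fin 2) ℝ) :
    dehom (MvPolynomial.pderiv 0 F) = derivative (dehom F) := by
  unfold dehom
  induction F using MvPolynomial.induction_on with
  | C a => simp
  | add p q hp hq => simp [hp, hq]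
  | mul_X p i hp =>
    fin_cases i <;> simp [hp, MvPolynomial.pderiv_X, Derivation.leibniz]; ring

/-- This is Euler's identity at y = 1. -/
lemma dehom_pderiv_one {F : MvPolynomial (Fin 2) ℝ} {n : ℕ} (hF : F.IsHomogeneous n) :
    dehom (MvPolynomial.pderiv 1 F) = C (n : ℝ) * dehom F - X * derivative (dehom F) := by
  have h := congrArg dehom hF.sum_X_mul_pderiv
  rw [← dehom_pderiv_zero]
  simp only [dehom, Fin.sum_univ_two, map_add, map_mul, map_natCast, MvPolynomial.aeval_X,
    Matrix.cons_val_zero, Matrix.cons_val_one, one_mul, nsmul_eq_mul] at h ⊢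
  rw [← h]
  ring

lemma natDegree_dehom_le {F : MvPolynomial (Fin 2) ℝ} {n : ℕ} (hF : F.IsHomogeneous n) :
    (dehom F).natDegree ≤ n := by
  unfold dehom
  rw [F.as_sum, map_sum]
  refine natDegree_sum_le_of_forall_le _ _ fun m hm ↦ ?_
  have hmn : m 0 + m 1 = n := by
    have := hF (by simpa using hm)
    simpa [Finsupp.weight_apply, Finsupp.sum_fintype] using this
  rw [MvPolynomial.aeval_monomial]
  simp only [Finsupp.prod_fintype, pow_zero, implies_true, Fin.prod_univ_two, Matrix.cons_val_zero,
    Matrix.cons_val_one, one_pow, mul_one]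
  refine (natDegree_C_mul_X_pow_le _ _).trans ?_
  omega

lemma eval_form {F : MvPolynomial (Fin 2) ℝ} {n : ℕ} (hF : F.IsHomogeneous n) (x y : ℝ)
    (hy : y ≠ 0) : MvPolynomial.eval ![x, y] F = (dehom F).eval (x / y) * y ^ n := by
  have h := Polynomial.homogenize_eq_of_isHomogeneous hF (p := dehom F) rfl
  conv_lhs => rw [← h]
  rw [Polynomial.eval_homogenize (natDegree_dehom_le hF) _ (by simpa using hy)]
  simp

lemma abs_disc_eq {F : MvPolynomial (Fin 2) ℝ} {n : ℕ} (hF : F.IsHomogeneous n) (hF0 : F ≠ 0) :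
    |disc F| * (n : ℝ) ^ (n - 2) =
      |resultant (derivative (dehom F)) (C (n : ℝ) * dehom F + derivative (dehom F) * -X)
        (n - 1) (n - 1)| := by
  have hn := hF.totalDegree hF0
  have h1 : dehom (MvPolynomial.pderiv 1 F) =
      C (n : ℝ) * dehom F + derivative (dehom F) * -X := by
    rw [dehom_pderiv_one hF]; ring
  have hpos : (0 : ℝ) < (n : ℝ) ^ (n - 2) := by
    rcases n.eq_zero_or_pos with rfl | h
    · simp
    · positivity
  rw [disc, res, hn, dehom_pderiv_zero, h1, abs_mul, abs_div, abs_pow, abs_neg, abs_one, one_pow,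
    abs_of_pos hpos]
  field_simp

lemma natDegree_euler_le {F : MvPolynomial (Fin 2) ℝ} {n : ℕ} (hF : F.IsHomogeneous n) :
    (C (n : ℝ) * dehom F + derivative (dehom F) * -X).natDegree ≤ n - 1 := by
  have h1 : dehom (MvPolynomial.pderiv 1 F) =
      C (n : ℝ) * dehom F + derivative (dehom F) * -X := by
    rw [dehom_pderiv_one hF]; ring
  rw [← h1]
  exact natDegree_dehom_le hF.pderiv

/-- The discriminant of a form without a zero at infinity. -/
lemma abs_disc_mul_leadingCoeff {F : MvPolynomial (Fin 2) ℝ} {n : ℕ} (hF : F.IsHomogeneous n)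
    (hn : 2 ≤ n) (hd : (dehom F).natDegree = n) :
    |disc F| * |(dehom F).leadingCoeff| =
      |resultant (dehom F) (derivative (dehom F)) n (n - 1)| := by
  have hF0 : F ≠ 0 := by
    rintro rfl
    simp [dehom] at hd
    omega
  have h := abs_disc_eq hF hF0
  obtain ⟨m, rfl⟩ : ∃ m, n = m + 2 := ⟨n - 2, by omega⟩
  have e1 : m + 2 - 1 = m + 1 := rfl
  have e2 : m + 2 - 2 = m := rfl
  rw [e1, e2] at h
  have hdeg := natDegree_euler_le hF
  rw [e1] at hdeg ⊢
  have hf' : (derivative (dehom F)).natDegree ≤ m + 1 :=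
    (natDegree_derivative_le _).trans (by omega)
  have hc : (derivative (dehom F)).coeff (m + 1) = (dehom F).leadingCoeff * (m + 2 : ℕ) := by
    rw [coeff_derivative, leadingCoeff, hd]; push_cast; ring
  -- Raising the formal degree of nf - Xf' from n - 1 to n costs, up to sign, the top coefficient n
  -- · lc(f) of f'. With formal degree n the multiple -Xf' of f' can be dropped.
  have key := resultant_add_right_deg (derivative (dehom F)) _ (m + 1) _ 1 hdeg
  rw [resultant_add_mul_right _ _ _ _ _ (by simp; omega) hf', resultant_C_mul_right, hc,
    resultant_comm] at key
  have key2 := congrArg abs key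
  simp only [abs_mul, abs_pow, abs_neg, abs_one, one_pow, one_mul, pow_one, ← h] at key2
  rw [Nat.abs_cast] at key2
  have hpos : (0 : ℝ) < ((m + 2 : ℕ) : ℝ) := by positivity
  have : ((m + 2 : ℕ) : ℝ) ^ (m + 1) ≠ 0 := by positivity
  apply mul_left_cancel₀ this
  rw [key2]
  ring

/-- The discriminant of a form with a simple zero at infinity. -/
lemma abs_disc_of_natDegree_succ {F : MvPolynomial (Fin 2) ℝ} {n : ℕ}
    (hF : F.IsHomogeneous (n + 2)) (hd : (dehom F).natDegree = n + 1) :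
    |disc F| = |(dehom F).leadingCoeff| *
      |resultant (dehom F) (derivative (dehom F)) (n + 1) n| := by
  have hF0 : F ≠ 0 := by
    rintro rfl
    simp [dehom] at hd
  have h := abs_disc_eq hF hF0
  have e1 : n + 2 - 1 = n + 1 := rfl
  have e2 : n + 2 - 2 = n := rfl
  rw [e1, e2] at h
  have hf' : (derivative (dehom F)).natDegree ≤ n :=
    (natDegree_derivative_le _).trans (by omega)
  -- Here f' has degree at most n but formal degree n + 1. Lowering it costs the top coefficient of
  -- the other argument, which is (n + 2) lc - (n + 1) lc = lc.
  have hc : (C ((n + 2 : ℕ) : ℝ) * dehom F + derivative (dehom F) * -X).coeff (n + 1) =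
      (dehom F).leadingCoeff := by
    rw [coeff_add, coeff_C_mul, mul_neg, coeff_neg, coeff_mul_X, coeff_derivative, leadingCoeff,
      hd]
    push_cast
    ring
  rw [resultant_succ_left_deg _ _ _ _ hf', hc,
    resultant_add_mul_right _ _ _ _ _ (by simp; omega) hf', resultant_C_mul_right,
    resultant_comm] at h
  simp only [abs_mul, abs_pow, abs_neg, abs_one, one_pow, one_mul] at h
  rw [Nat.abs_cast] at h
  have : ((n + 2 : ℕ) : ℝ) ^ n ≠ 0 := by positivity
  apply mul_right_cancel₀ this
  rw [h]
  ring

lemma abs_multiset_prod_map (s : Multiset ℝ) (g : ℝ → ℝ) :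
    |(s.map g).prod| = (s.map fun x ↦ |g x|).prod := by
  induction s using Multiset.induction_on with
  | empty => simp
  | cons a s ih => simp [abs_mul, ih]

lemma abs_disc_of_splits {F : MvPolynomial (Fin 2) ℝ} {n : ℕ} (hF : F.IsHomogeneous n)
    (hn : 2 ≤ n) (hd : (dehom F).natDegree = n) (hs : (dehom F).Splits) :
    |disc F| = |(dehom F).leadingCoeff| ^ (n - 2) *
      ((dehom F).roots.map fun x ↦ |(derivative (dehom F)).eval x|).prod := by
  have h := abs_disc_mul_leadingCoeff hF hn hd
  have h2 := resultant_eq_prod_eval (dehom F) (derivative (dehom F)) (n - 1)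
    ((natDegree_derivative_le _).trans (by omega)) hs
  rw [hd] at h2
  rw [h2, abs_mul, abs_pow, abs_multiset_prod_map] at h
  have hlc : |(dehom F).leadingCoeff| ≠ 0 := by
    rw [abs_ne_zero, leadingCoeff_ne_zero]
    rintro h0
    rw [h0] at hd
    simp at hd
    omega
  apply mul_right_cancel₀ hlc
  rw [h]
  obtain ⟨m, rfl⟩ : ∃ m, n = m + 2 := ⟨n - 2, by omega⟩
  simp only [Nat.add_sub_cancel, show m + 2 - 1 = m + 1 from rfl, pow_succ]
  ring

lemma abs_disc_of_splits_succ {F : MvPolynomial (Fin 2) ℝ} {n : ℕ}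
    (hF : F.IsHomogeneous (n + 2)) (hd : (dehom F).natDegree = n + 1) (hs : (dehom F).Splits) :
    |disc F| = |(dehom F).leadingCoeff| ^ (n + 1) *
      ((dehom F).roots.map fun x ↦ |(derivative (dehom F)).eval x|).prod := by
  have h := abs_disc_of_natDegree_succ hF hd
  have h2 := resultant_eq_prod_eval (dehom F) (derivative (dehom F)) n
    ((natDegree_derivative_le _).trans (by omega)) hs
  rw [hd] at h2
  rw [h, h2, abs_mul, abs_pow, abs_multiset_prod_map]
  ring

end BinaryForm

end

/-! ### Discriminants of the Chebyshev forms -/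

noncomputable section

namespace BinaryForm

open Polynomial

lemma multiset_prod_map_eq_pow {s : Multiset ℝ} {g : ℝ → ℝ} {M : ℝ} (h : ∀ x ∈ s, g x = M) :
    (s.map g).prod = M ^ s.card := by
  rw [Multiset.map_congr rfl h]
  simp

lemma prod_roots_one_sub_sq {f : ℝ[X]} (hs : f.Splits) :
    f.leadingCoeff ^ 2 * (f.roots.map fun x ↦ |1 - x ^ 2|).prod = |f.eval 1 * f.eval (-1)| := by
  rw [hs.eval_eq_prod_roots, hs.eval_eq_prod_roots, mul_mul_mul_comm, ← Multiset.prod_map_mul,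
    abs_mul, abs_multiset_prod_map, ← pow_two, abs_pow, sq_abs]
  congr 2
  refine Multiset.map_congr rfl fun x _ ↦ ?_
  rw [← abs_neg]
  congr 1
  ring

/-- Both Chebyshev families have |f'| (1 - x^2)^(k/2) constant on their roots, and the product of 1
- x^2 over the roots is known from f(1) f(-1). So the product of f' over the roots needs no
individual root. -/
lemma abs_prod_derivative_roots {f : ℝ[X]} (hs : f.Splits) {k : ℕ} {M v : ℝ}
    (h : ∀ x ∈ f.roots, |(derivative f).eval x| ^ 2 * |1 - x ^ 2| ^ k = M ^ 2) (hM : 0 ≤ M)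
    (hv0 : 0 < v) (hv : |f.eval 1 * f.eval (-1)| = v ^ 2) :
    (f.roots.map fun x ↦ |(derivative f).eval x|).prod * v ^ k =
      M ^ f.natDegree * |f.leadingCoeff| ^ k := by
  have hf0 : f ≠ 0 := by
    rintro rfl
    simp at hv
    exact absurd hv.symm (by positivity)
  have hlc : f.leadingCoeff ≠ 0 := leadingCoeff_ne_zero.2 hf0
  have h1 := multiset_prod_map_eq_pow h
  rw [Multiset.prod_map_mul, Multiset.prod_map_pow, Multiset.prod_map_pow] at h1
  have h2 := prod_roots_one_sub_sq hs
  rw [hv] at h2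
  rw [← hs.natDegree_eq_card_roots] at h1
  set P := (f.roots.map fun x ↦ |(derivative f).eval x|).prod with hP
  have hP0 : 0 ≤ P := by
    rw [hP]
    exact Multiset.prod_map_nonneg fun x _ ↦ abs_nonneg _
  set R := (f.roots.map fun x ↦ |1 - x ^ 2|).prod
  have hL : (P * v ^ k) ^ 2 = (M ^ f.natDegree * |f.leadingCoeff| ^ k) ^ 2 := by
    calc (P * v ^ k) ^ 2 = P ^ 2 * (v ^ 2) ^ k := by ring
      _ = (P ^ 2 * R ^ k) * (f.leadingCoeff ^ 2) ^ k := by rw [← h2]; ring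
      _ = _ := by rw [h1, ← sq_abs f.leadingCoeff]; ring
  exact (pow_left_inj₀ (by positivity) (by positivity) two_ne_zero).1 hL

section chebyshev

open Real

lemma splits_T (n : ℕ) : (Chebyshev.T ℝ n).Splits := by
  rw [splits_iff_card_roots, Chebyshev.natDegree_T, Chebyshev.roots_T_real, Finset.card_val,
    Finset.card_image_of_injOn, Finset.card_range]
  · simp
  · have := Chebyshev.roots_T_real_nodup n
    rwa [← Finset.range_val, Finset.nodup_map_iff_injOn] at this

lemma splits_U (n : ℕ) : (Chebyshev.U ℝ n).Splits := by
  rw [splits_iff_card_roots, Chebyshev.natDegree_U_natCast, Chebyshev.roots_U_real,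
    Finset.card_val, Finset.card_image_of_injOn, Finset.card_range]
  have := Chebyshev.roots_U_real_nodup n
  rwa [← Finset.range_val, Finset.nodup_map_iff_injOn] at this

lemma totalDegree_T (n : ℕ) : (T n).totalDegree = n := by
  rw [T, totalDegree_homog (Chebyshev.T_ne_zero _ _), Chebyshev.natDegree_T]
  simp

lemma totalDegree_U (n : ℕ) : (U n).totalDegree = n := by
  rw [U, totalDegree_homog (Chebyshev.U_ne_zero _ _ (by omega)), Chebyshev.natDegree_U_natCast]

lemma isHomogeneous_T (n : ℕ) : (T n).IsHomogeneous n := by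
  have := isHomogeneous_homog (Chebyshev.T ℝ n)
  rwa [Chebyshev.natDegree_T] at this

lemma isHomogeneous_U (n : ℕ) : (U n).IsHomogeneous n := by
  have := isHomogeneous_homog (Chebyshev.U ℝ n)
  rwa [Chebyshev.natDegree_U_natCast] at this

lemma abs_disc_T {n : ℕ} (hn : 2 ≤ n) : |disc (T n)| = 2 ^ ((n - 1) * (n - 1)) * (n : ℝ) ^ n := by
  have hdeh : dehom (T n) = Chebyshev.T ℝ n := dehom_homog _
  rw [abs_disc_of_splits (isHomogeneous_T n) hn (by rw [hdeh, Chebyshev.natDegree_T]; simp)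
    (by rw [hdeh]; exact splits_T n), hdeh]
  -- T_n' = n U_{n-1}, and sin θ · U_{n-1}(cos θ) = sin nθ = ±1 at a root cos θ.
  have key := abs_prod_derivative_roots (splits_T n) (k := 1) (M := n) (v := 1) ?_ (by positivity)
    one_pos ?_
  · rw [one_pow, mul_one, Chebyshev.natDegree_T] at key
    rw [key, Chebyshev.leadingCoeff_T, abs_of_pos (by positivity)]
    obtain ⟨m, rfl⟩ : ∃ m, n = m + 2 := ⟨n - 2, by omega⟩
    simp only [Int.natAbs_natCast, Nat.add_sub_cancel, show m + 2 - 1 = m + 1 from rfl, ← pow_mul]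
    ring
  · intro x hx
    rw [Chebyshev.roots_T_real, Finset.mem_val, Finset.mem_image] at hx
    obtain ⟨k, -, rfl⟩ := hx
    set θ := (2 * (k : ℝ) + 1) * π / (2 * n) with hθ
    rw [Chebyshev.T_derivative_eq_U]
    have h1 := Chebyshev.U_real_cos θ (n - 1)
    have h2 : ((((n : ℤ) - 1 : ℤ) : ℝ) + 1) * θ = k * π + π / 2 := by
      rw [hθ]
      push_cast
      field_simp
      ring
    rw [h2, sin_add_pi_div_two, cos_nat_mul_pi] at h1
    have h3 : |1 - cos θ ^ 2| ^ 1 = |sin θ| ^ 2 := by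
      rw [← sin_sq, abs_pow, pow_one]
    rw [h3, ← mul_pow, ← abs_mul, eval_mul, mul_assoc, h1]
    simp
  · rw [Chebyshev.T_eval_one, Chebyshev.T_eval_neg_one]
    simp

lemma abs_disc_U {n : ℕ} (hn : 2 ≤ n) :
    |disc (U n)| = 2 ^ (n * n) * ((n : ℝ) + 1) ^ (n - 2) := by
  have hdeh : dehom (U n) = Chebyshev.U ℝ n := dehom_homog _
  rw [abs_disc_of_splits (isHomogeneous_U n) hn (by rw [hdeh, Chebyshev.natDegree_U_natCast])
    (by rw [hdeh]; exact splits_U n), hdeh]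
  have hn1 : (0 : ℝ) < (n : ℝ) + 1 := by positivity
  -- At a root the relation (n + 1) T_{n+1} = x U_n - (1 - x^2) U_n' reduces to |(1 - x^2) U_n'| = n
  -- + 1, because T_{n+1} = ±1 there.
  have key := abs_prod_derivative_roots (splits_U n) (k := 2) (M := n + 1) (v := n + 1) ?_
    (by positivity) hn1 ?_
  · rw [Chebyshev.natDegree_U_natCast] at key
    apply mul_right_cancel₀ (b := ((n : ℝ) + 1) ^ 2) (by positivity)
    rw [mul_assoc, key, Chebyshev.leadingCoeff_U_natCast, abs_of_pos (by positivity)]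
    obtain ⟨m, rfl⟩ : ∃ m, n = m + 2 := ⟨n - 2, by omega⟩
    simp only [Nat.add_sub_cancel, ← pow_mul]
    ring
  · intro x hx
    rw [Chebyshev.roots_U_real, Finset.mem_val, Finset.mem_image] at hx
    obtain ⟨k, hk, rfl⟩ := hx
    rw [Finset.mem_range] at hk
    set θ := ((k : ℝ) + 1) * π / (n + 1) with hθ
    have hsin : sin θ ≠ 0 := by
      apply ne_of_gt
      apply sin_pos_of_pos_of_lt_pi
      · positivity
      · rw [hθ, div_lt_iff₀ hn1, mul_comm]
        have : (k : ℝ) < n := by exact_mod_cast hk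
        nlinarith [pi_pos]
    have h1 := congrArg (eval (cos θ)) (Chebyshev.add_one_mul_T_eq_poly_in_U (R := ℝ) n)
    have h2 := Chebyshev.U_real_cos θ n
    have h3 : (((n : ℤ) : ℝ) + 1) * θ = ((k + 1 : ℕ) : ℝ) * π := by
      rw [hθ]
      push_cast
      field_simp
    rw [h3, sin_nat_mul_pi] at h2
    have h4 : (Chebyshev.U ℝ n).eval (cos θ) = 0 := (mul_eq_zero.1 h2).resolve_right hsin
    have h5 := Chebyshev.T_real_cos θ (n + 1)
    have h6 : (((n : ℤ) + 1 : ℤ) : ℝ) * θ = ((k + 1 : ℕ) : ℝ) * π := by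
      rw [← h3]; push_cast; ring
    rw [h6, cos_nat_mul_pi] at h5
    simp only [eval_mul, eval_add, eval_sub, eval_one, eval_X, eval_pow, h4, h5, mul_zero,
      zero_sub] at h1
    rw [← mul_pow, ← abs_mul, mul_comm, ← abs_neg, ← h1]
    simp
  · rw [Chebyshev.U_eval_one, Chebyshev.U_eval_neg_one]
    simp [abs_mul, pow_two]

end chebyshev

end BinaryForm

end

/-! ### Products of sines and the discriminant of `S n` -/

noncomputable section

namespace BinaryForm

open Polynomial Real

lemma eval_derivative_prod_of_root {ι R : Type*} [DecidableEq ι] [CommRing R] {s : Finset ι}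
    (g : ι → R[X]) {k : ι} (hk : k ∈ s) {x : R} (hx : (g k).eval x = 0) :
    (derivative (∏ j ∈ s, g j)).eval x =
      (derivative (g k)).eval x * ∏ j ∈ s.erase k, (g j).eval x := by
  rw [← Finset.mul_prod_erase s g hk, derivative_mul, eval_add, eval_mul, eval_mul, hx, zero_mul,
    add_zero, eval_prod]

lemma norm_exp_mul_I_sub (a b : ℝ) :
    ‖Complex.exp (2 * a * Complex.I) - Complex.exp (2 * b * Complex.I)‖ = 2 * |sin (a - b)| := by
  have h1 : Complex.exp (2 * a * Complex.I) - Complex.exp (2 * b * Complex.I) =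
      Complex.exp ((2 * b : ℝ) * Complex.I) *
        (Complex.exp (Complex.I * ((2 * (a - b) : ℝ))) - 1) := by
    rw [mul_sub, ← Complex.exp_add]
    push_cast
    ring_nf
  rw [h1, norm_mul, Complex.norm_exp_ofReal_mul_I, Complex.norm_exp_I_mul_ofReal_sub_one]
  simp

lemma X_pow_sub_one_eq_prod_exp {n : ℕ} (hn : 0 < n) :
    (X ^ n - 1 : ℂ[X]) =
      ∏ k ∈ Finset.Icc 1 n, (X - C (Complex.exp (2 * ((k * π / n : ℝ) : ℂ) * Complex.I))) := by
  have hζ := Complex.isPrimitiveRoot_exp n hn.ne'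
  have h := X_pow_sub_C_eq_prod hζ hn (α := Complex.exp (2 * π * Complex.I / n)) (a := 1)
    hζ.pow_eq_one
  rw [C_1] at h
  have e : Finset.Icc 1 n = Finset.Ico (0 + 1) (n + 1) := by ext; simp
  rw [h, Finset.range_eq_Ico, e, ← Finset.prod_Ico_add']
  refine Finset.prod_congr rfl fun k _ ↦ ?_
  rw [← pow_succ, ← Complex.exp_nat_mul]
  congr 3
  push_cast
  ring

/-- Absolute values in X^n - 1 = ∏ (X - ζ_k) at the point exp(2it), where each factor is a chord of
length 2|sin|. -/
lemma prod_two_mul_abs_sin {n : ℕ} (hn : 0 < n) (t : ℝ) :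
    ∏ k ∈ Finset.Icc 1 n, (2 * |sin (k * π / n - t)|) = 2 * |sin (n * t)| := by
  have h := congrArg (fun p ↦ ‖eval (Complex.exp (2 * t * Complex.I)) p‖)
    (X_pow_sub_one_eq_prod_exp hn)
  simp only [eval_sub, eval_pow, eval_X, eval_one, eval_prod, eval_C, norm_prod] at h
  rw [← Complex.exp_nat_mul] at h
  have h2 := norm_exp_mul_I_sub (n * t) 0
  rw [sub_zero] at h2
  rw [← h2]
  have e1 : Complex.exp (2 * ((n * t : ℝ) : ℂ) * Complex.I) =
      Complex.exp (n * (2 * t * Complex.I)) := by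
    congr 1; push_cast; ring
  have e2 : Complex.exp (2 * ((0 : ℝ) : ℂ) * Complex.I) = 1 := by simp
  rw [e1, e2, h]
  refine Finset.prod_congr rfl fun k _ ↦ ?_
  rw [norm_exp_mul_I_sub, ← abs_neg, ← sin_neg]
  ring_nf

/-- The same factorization after differentiation, evaluated at its own root ζ_k. -/
lemma prod_erase_two_mul_abs_sin {n k : ℕ} (hk : k ∈ Finset.Icc 1 n) :
    ∏ j ∈ (Finset.Icc 1 n).erase k, (2 * |sin (j * π / n - k * π / n)|) = n := by
  have hn : 0 < n := by simp at hk; omega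
  set z := Complex.exp (2 * ((k * π / n : ℝ) : ℂ) * Complex.I) with hz
  have h := congrArg (fun p ↦ ‖eval z (derivative p)‖) (X_pow_sub_one_eq_prod_exp hn)
  rw [eval_derivative_prod_of_root _ hk (by simp [hz])] at h
  have hz1 : ‖z‖ = 1 := by
    rw [hz, show (2 * ((k * π / n : ℝ) : ℂ)) = ((2 * (k * π / n) : ℝ) : ℂ) by push_cast; ring]
    exact Complex.norm_exp_ofReal_mul_I _
  simp only [derivative_sub, derivative_X_pow, derivative_one, sub_zero, eval_mul, eval_C,
    eval_pow, eval_X, norm_mul, norm_pow, hz1, one_pow, mul_one, derivative_X, derivative_C,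
    eval_one, one_mul, norm_prod, eval_sub] at h
  rw [Complex.norm_natCast] at h
  refine Eq.trans (Finset.prod_congr rfl fun j _ ↦ ?_) h.symm
  rw [hz, norm_exp_mul_I_sub, ← abs_neg, ← sin_neg]
  ring_nf

lemma dehom_S (n : ℕ) :
    dehom (S n) = C (2 ^ (n - 1 - padicValNat 2 n)) * ∏ k ∈ Finset.Icc 1 n,
      (C (sin (k * π / n)) * X - C (cos (k * π / n))) := by
  unfold dehom S Fstar
  rw [map_mul, map_prod, MvPolynomial.aeval_C]
  congr 1
  refine Finset.prod_congr rfl fun k _ ↦ ?_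
  simp

lemma isHomogeneous_S (n : ℕ) : (S n).IsHomogeneous n := by
  unfold S Fstar
  have h : (∏ k ∈ Finset.Icc 1 n,
      (MvPolynomial.C (sin (k * π / n)) * MvPolynomial.X 0 -
        MvPolynomial.C (cos (k * π / n)) * MvPolynomial.X 1 :
          MvPolynomial (Fin 2) ℝ)).IsHomogeneous (∑ k ∈ Finset.Icc 1 n, 1) :=
    MvPolynomial.IsHomogeneous.prod _ _ _ fun k _ ↦
      (MvPolynomial.isHomogeneous_C_mul_X _ _).sub (MvPolynomial.isHomogeneous_C_mul_X _ _)
  have h2 := (MvPolynomial.isHomogeneous_C (Fin 2) (2 ^ (n - 1 - padicValNat 2 n) : ℝ)).mul h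
  have e : 0 + ∑ k ∈ Finset.Icc 1 n, 1 = n := by simp
  rw [e] at h2
  exact h2

/-- The constant `κ` with `|S n (cos t, sin t)| = κ |sin (n t)|`. -/
def sConst (n : ℕ) : ℝ := 2 ^ (n - 1 - padicValNat 2 n) * 2 / 2 ^ n

lemma sConst_pos (n : ℕ) : 0 < sConst n := by unfold sConst; positivity

lemma abs_eval_dehom_S {n : ℕ} (hn : 0 < n) {t : ℝ} (ht : sin t ≠ 0) :
    |(dehom (S n)).eval (cos t / sin t)| * |sin t| ^ n = sConst n * |sin (n * t)| := by
  rw [dehom_S, eval_mul, eval_C, eval_prod, abs_mul, Finset.abs_prod, mul_assoc]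
  have h := prod_two_mul_abs_sin hn t
  rw [Finset.prod_mul_distrib] at h
  simp only [Finset.prod_const, Nat.card_Icc, Nat.add_sub_cancel] at h
  have h2 : (∏ k ∈ Finset.Icc 1 n,
      |eval (cos t / sin t) (C (sin (k * π / n)) * X - C (cos (k * π / n)))|) * |sin t| ^ n =
      ∏ k ∈ Finset.Icc 1 n, |sin (k * π / n - t)| := by
    have e : |sin t| ^ n = ∏ k ∈ Finset.Icc 1 n, |sin t| := by simp
    rw [e, ← Finset.prod_mul_distrib]
    refine Finset.prod_congr rfl fun k _ ↦ ?_
    rw [← abs_mul, sin_sub]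
    congr 1
    simp only [eval_sub, eval_mul, eval_C, eval_X]
    field_simp
  rw [h2, abs_of_pos (by positivity), sConst, div_mul_eq_mul_div, eq_div_iff (by positivity),
    mul_assoc (2 ^ (n - 1 - padicValNat 2 n) : ℝ) 2, ← h]
  ring

lemma sin_pos_of_mem {m k : ℕ} (hk : k ∈ Finset.Icc 1 (m + 1)) :
    0 < sin (k * π / ((m + 2 : ℕ) : ℝ)) := by
  simp only [Finset.mem_Icc] at hk
  have h1 : (1 : ℝ) ≤ k := by exact_mod_cast hk.1
  have h2 : (k : ℝ) < ((m + 2 : ℕ) : ℝ) := by exact_mod_cast (by omega : k < m + 2)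
  have h3 : (0 : ℝ) < ((m + 2 : ℕ) : ℝ) := by positivity
  apply sin_pos_of_pos_of_lt_pi
  · positivity
  · rw [div_lt_iff₀ h3, mul_comm]
    exact mul_lt_mul_of_pos_left h2 pi_pos

lemma prod_sin_eq (m : ℕ) :
    ∏ k ∈ Finset.Icc 1 (m + 1), sin (k * π / ((m + 2 : ℕ) : ℝ)) =
      ((m + 2 : ℕ) : ℝ) / 2 ^ (m + 1) := by
  have h := prod_erase_two_mul_abs_sin (n := m + 2) (k := m + 2) (by simp)
  have e : (Finset.Icc 1 (m + 2)).erase (m + 2) = Finset.Icc 1 (m + 1) := by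
    ext j; simp; omega
  have hm : ((m + 2 : ℕ) : ℝ) ≠ 0 := by positivity
  rw [e, Finset.prod_mul_distrib, Finset.prod_const, Nat.card_Icc] at h
  rw [eq_div_iff (by positivity), mul_comm]
  refine Eq.trans ?_ h
  congr 1
  refine Finset.prod_congr rfl fun k hk ↦ ?_
  rw [mul_div_cancel_left₀ _ hm, sin_sub_pi, abs_neg, abs_of_pos (sin_pos_of_mem hk)]

lemma dehom_S_eq (m : ℕ) :
    dehom (S (m + 2)) = C (sConst (m + 2) * (m + 2 : ℕ)) *
      (((Finset.Icc 1 (m + 1)).val.map fun k : ℕ ↦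
        cos (k * π / ((m + 2 : ℕ) : ℝ)) / sin (k * π / ((m + 2 : ℕ) : ℝ))).map
          fun a ↦ X - C a).prod := by
  have hm : ((m + 2 : ℕ) : ℝ) ≠ 0 := by positivity
  -- The last factor of `Fstar` is y itself: a simple zero at infinity, which becomes the constant 1
  -- and lowers the degree by one.
  rw [dehom_S, Finset.prod_Icc_succ_top (by omega), mul_div_cancel_left₀ _ hm, sin_pi, cos_pi,
    Multiset.map_map]
  have h1 : ∏ k ∈ Finset.Icc 1 (m + 1),
      (C (sin (k * π / ((m + 2 : ℕ) : ℝ))) * X - C (cos (k * π / ((m + 2 : ℕ) : ℝ)))) =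
      C (∏ k ∈ Finset.Icc 1 (m + 1), sin (k * π / ((m + 2 : ℕ) : ℝ))) *
      ∏ k ∈ Finset.Icc 1 (m + 1),
        (X - C (cos (k * π / ((m + 2 : ℕ) : ℝ)) / sin (k * π / ((m + 2 : ℕ) : ℝ)))) := by
    rw [map_prod, ← Finset.prod_mul_distrib]
    refine Finset.prod_congr rfl fun k hk ↦ ?_
    rw [mul_sub, ← C_mul, mul_div_cancel₀ _ (sin_pos_of_mem hk).ne']
  rw [h1, prod_sin_eq, Finset.prod_eq_multiset_prod]
  simp only [Function.comp_def, map_zero, zero_mul, map_neg, map_one, sub_neg_eq_add, zero_add,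
    mul_one]
  rw [← mul_assoc, ← C_mul]
  congr 2
  rw [sConst]
  field_simp
  ring

lemma abs_disc_S {n : ℕ} (hn : 2 ≤ n) :
    |disc (S n)| = sConst n ^ (2 * (n - 1)) * (n : ℝ) ^ n * 2 ^ ((n - 1) * (n - 2)) := by
  obtain ⟨m, rfl⟩ : ∃ m, n = m + 2 := ⟨n - 2, by omega⟩
  have hκ := sConst_pos (m + 2)
  have hm : (0 : ℝ) < ((m + 2 : ℕ) : ℝ) := by positivity
  have hf := dehom_S_eq m
  set s := ((Finset.Icc 1 (m + 1)).val.map fun k : ℕ ↦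
        cos (k * π / ((m + 2 : ℕ) : ℝ)) / sin (k * π / ((m + 2 : ℕ) : ℝ))) with hs
  have hmon : ((s.map fun a ↦ X - C a).prod).Monic := monic_multiset_prod_of_monic _ _
    fun a _ ↦ monic_X_sub_C a
  have hc : sConst (m + 2) * (m + 2 : ℕ) ≠ 0 := by positivity
  have hcard : s.card = m + 1 := by simp [hs]
  have hroots : (dehom (S (m + 2))).roots = s := by
    rw [hf, roots_C_mul _ hc, roots_multiset_prod_X_sub_C]
  have hdeg : (dehom (S (m + 2))).natDegree = m + 1 := by
    rw [hf, natDegree_C_mul hc, natDegree_multiset_prod_X_sub_C_eq_card, hcard]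
  have hlc : (dehom (S (m + 2))).leadingCoeff = sConst (m + 2) * (m + 2 : ℕ) := by
    rw [hf, leadingCoeff_mul, leadingCoeff_C, hmon.leadingCoeff, mul_one]
  have hsp : (dehom (S (m + 2))).Splits := by
    rw [splits_iff_card_roots, hroots, hdeg, hcard]
  rw [abs_disc_of_splits_succ (isHomogeneous_S _) hdeg hsp, hlc, hroots, hs, Multiset.map_map]
  -- At the root cot(kπ/n) the j-th linear factor equals sin(jπ/n - kπ/n) / sin(kπ/n) up to sign, so
  -- the derivative is a product of sines over j ≠ k.
  have hd : ∀ k ∈ Finset.Icc 1 (m + 1), |eval (cos (k * π / ((m + 2 : ℕ) : ℝ)) /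
      sin (k * π / ((m + 2 : ℕ) : ℝ))) (derivative (dehom (S (m + 2))))| =
      sConst (m + 2) * (m + 2 : ℕ) / sin (k * π / ((m + 2 : ℕ) : ℝ)) ^ m := by
    intro k hk
    have hsk := sin_pos_of_mem hk
    have hk' : k ∈ Finset.Icc 1 (m + 2) := by
      simp only [Finset.mem_Icc] at hk ⊢; omega
    rw [dehom_S, derivative_C_mul, eval_mul, eval_C, eval_derivative_prod_of_root _ hk' (by
      simp only [eval_sub, eval_mul, eval_C, eval_X]
      rw [mul_div_cancel₀ _ hsk.ne', sub_self])]
    have h2 := prod_erase_two_mul_abs_sin hk'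
    rw [Finset.prod_mul_distrib, Finset.prod_const, Finset.card_erase_of_mem hk', Nat.card_Icc] at h2
    have h3 : ∏ j ∈ (Finset.Icc 1 (m + 2)).erase k, |eval (cos (k * π / ((m + 2 : ℕ) : ℝ)) /
        sin (k * π / ((m + 2 : ℕ) : ℝ))) (C (sin (j * π / ((m + 2 : ℕ) : ℝ))) * X -
          C (cos (j * π / ((m + 2 : ℕ) : ℝ))))| =
        (∏ j ∈ (Finset.Icc 1 (m + 2)).erase k,
          |sin (j * π / ((m + 2 : ℕ) : ℝ) - k * π / ((m + 2 : ℕ) : ℝ))|) /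
            sin (k * π / ((m + 2 : ℕ) : ℝ)) ^ (m + 1) := by
      have e : sin (k * π / ((m + 2 : ℕ) : ℝ)) ^ (m + 1) =
          ∏ j ∈ (Finset.Icc 1 (m + 2)).erase k, sin (k * π / ((m + 2 : ℕ) : ℝ)) := by
        rw [Finset.prod_const, Finset.card_erase_of_mem hk', Nat.card_Icc]
        rfl
      rw [e, ← Finset.prod_div_distrib]
      refine Finset.prod_congr rfl fun j _ ↦ ?_
      rw [eq_div_iff hsk.ne', sin_sub]
      simp only [eval_sub, eval_mul, eval_C, eval_X]
      generalize sin (k * π / ((m + 2 : ℕ) : ℝ)) = σ at hsk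
      rw [← abs_of_pos hsk, ← abs_mul, abs_of_pos hsk]
      congr 1
      field_simp
    rw [abs_mul, abs_mul, Finset.abs_prod, h3]
    simp only [derivative_sub, derivative_C_mul, derivative_X, mul_one, derivative_C, sub_zero,
      eval_C]
    rw [abs_of_pos hsk, abs_of_pos (by positivity), sConst]
    rw [show m + 2 + 1 - 1 - 1 = m + 1 from rfl] at h2
    generalize sin (k * π / ((m + 2 : ℕ) : ℝ)) = σ at hsk
    generalize (∏ j ∈ (Finset.Icc 1 (m + 2)).erase k,
          |sin (j * π / ((m + 2 : ℕ) : ℝ) - k * π / ((m + 2 : ℕ) : ℝ))|) = P at h2 ⊢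
    rw [← h2]
    field_simp
    ring
  simp only [Function.comp_def]
  rw [← Finset.prod_eq_multiset_prod, Finset.prod_congr rfl hd, Finset.prod_div_distrib,
    Finset.prod_pow, prod_sin_eq, Finset.prod_const, Nat.card_Icc, abs_of_pos (by positivity)]
  simp only [Nat.add_sub_cancel, show m + 2 - 1 = m + 1 from rfl]
  rw [div_pow, ← pow_mul]
  field_simp
  ring

end BinaryForm

end

/-! ### Area as an integral over the projective line -/

noncomputable section

namespace BinaryForm

open MeasureTheory Set

lemma lintegral_abs_Icc {r : ℝ} (hr : 0 ≤ r) :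
    ∫⁻ y in Icc (-r) r, ENNReal.ofReal |y| = ENNReal.ofReal (r ^ 2) := by
  rw [← ofReal_integral_eq_lintegral_ofReal (continuous_abs.integrableOn_Icc)
    (Filter.Eventually.of_forall fun y ↦ abs_nonneg y), integral_Icc_eq_integral_Ioc,
    ← intervalIntegral.integral_of_le (by linarith)]
  congr 1
  rw [← intervalIntegral.integral_add_adjacent_intervals (b := 0)
    (continuous_abs.intervalIntegrable _ _) (continuous_abs.intervalIntegrable _ _)]
  have h1 : ∫ y in (-r)..0, |y| = ∫ y in (-r)..0, -y := by
    refine intervalIntegral.integral_congr fun y hy ↦ ?_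
    rw [uIcc_of_le (by linarith)] at hy
    exact abs_of_nonpos hy.2
  have h2 : ∫ y in (0 : ℝ)..r, |y| = ∫ y in (0 : ℝ)..r, y := by
    refine intervalIntegral.integral_congr fun y hy ↦ ?_
    rw [uIcc_of_le hr] at hy
    exact abs_of_nonneg hy.1
  rw [h1, h2, intervalIntegral.integral_neg, integral_id, integral_id]
  ring

lemma mul_abs_pow_le_one_iff {c : ℝ} (hc : 0 < c) {n : ℕ} (hn : n ≠ 0) (y : ℝ) :
    c * |y| ^ n ≤ 1 ↔ y ∈ Icc (-(c ^ (-(1 / (n : ℝ))))) (c ^ (-(1 / (n : ℝ)))) := by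
  have hr : 0 ≤ c ^ (-(1 / (n : ℝ))) := by positivity
  have hn' : (n : ℝ) ≠ 0 := by exact_mod_cast hn
  rw [mem_Icc, ← abs_le, ← pow_le_pow_iff_left₀ (abs_nonneg y) hr hn, ← Real.rpow_natCast (c ^ _),
    ← Real.rpow_mul hc.le, neg_mul, one_div, inv_mul_cancel₀ hn', Real.rpow_neg_one,
    ← one_div c, le_div_iff₀ hc, mul_comm]

/-- The area of the fundamental region of a form as an integral over the projective line. -/
theorem area_eq {F : MvPolynomial (Fin 2) ℝ} {n : ℕ} (hF : F.IsHomogeneous n) (hn : n ≠ 0)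
    (h0 : dehom F ≠ 0) :
    area F = ∫⁻ t, ENNReal.ofReal (|(dehom F).eval t| ^ (-(2 / (n : ℝ)))) := by
  set f := dehom F with hf
  have hcont : Continuous fun t ↦ f.eval t := f.continuous
  have hE : MeasurableSet {p : ℝ × ℝ | |MvPolynomial.eval ![p.1, p.2] F| ≤ 1} := by
    apply IsClosed.measurableSet
    refine isClosed_le (continuous_abs.comp ((MvPolynomial.continuous_eval F).comp ?_))
      continuous_const
    refine continuous_pi fun i ↦ ?_
    fin_cases i
    · exact continuous_fst
    · exact continuous_snd
  have hM : MeasurableSet {p : ℝ × ℝ | |f.eval p.2| * |p.1| ^ n ≤ 1} :=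
    (isClosed_le (by fun_prop) continuous_const).measurableSet
  have hae0 : ∀ᵐ y : ℝ, y ≠ 0 := by
    simp [ae_iff]
  -- On the line of height y the substitution x = ty has Jacobian |y|. After exchanging the
  -- integrals, y runs over |y| ≤ r = |f(t)|^(-1/n), and ∫ |y| dy = r^2.
  have step1 : area F = ∫⁻ y : ℝ, ∫⁻ t : ℝ,
      ENNReal.ofReal |y| * {p : ℝ × ℝ | |f.eval p.2| * |p.1| ^ n ≤ 1}.indicator 1 (y, t) := by
    rw [area, Measure.volume_eq_prod, Measure.prod_apply_symm hE]
    refine lintegral_congr_ae ?_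
    filter_upwards [hae0] with y hy
    have hset : (fun x ↦ (x, y)) ⁻¹' {p : ℝ × ℝ | |MvPolynomial.eval ![p.1, p.2] F| ≤ 1} =
        (· * y⁻¹) ⁻¹' {t : ℝ | |f.eval t| * |y| ^ n ≤ 1} := by
      ext x
      simp only [mem_preimage, mem_ofPred_eq]
      rw [eval_form hF x y hy, abs_mul, abs_pow, div_eq_mul_inv]
    have hms : MeasurableSet {t : ℝ | |f.eval t| * |y| ^ n ≤ 1} :=
      (isClosed_le (by fun_prop) continuous_const).measurableSet
    rw [hset, Real.volume_preimage_mul_right (inv_ne_zero hy), inv_inv,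
      lintegral_const_mul' _ _ ENNReal.ofReal_ne_top]
    congr 1
    rw [← lintegral_indicator_one hms]
    rfl
  rw [step1, lintegral_lintegral_swap]
  · refine lintegral_congr_ae ?_
    -- The finitely many zeros of f must be left out: a negative real power of 0 takes the default
    -- value 0 there.
    have hroots : ∀ᵐ t : ℝ, f.eval t ≠ 0 := by
      rw [ae_iff]
      have : {t : ℝ | ¬ f.eval t ≠ 0} = (f.roots.toFinset : Set ℝ) := by
        ext t
        simp [h0]
      rw [this]
      exact f.roots.toFinset.finite_toSet.measure_zero _
    filter_upwards [hroots] with t ht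
    have hc : 0 < |f.eval t| := abs_pos.2 ht
    have hr : 0 ≤ |f.eval t| ^ (-(1 / (n : ℝ))) := by positivity
    rw [show |f.eval t| ^ (-(2 / (n : ℝ))) = (|f.eval t| ^ (-(1 / (n : ℝ)))) ^ 2 by
      rw [← Real.rpow_natCast, ← Real.rpow_mul hc.le]; congr 1; push_cast; ring,
      ← lintegral_abs_Icc hr, ← lintegral_indicator measurableSet_Icc]
    refine lintegral_congr fun y ↦ ?_
    by_cases hy : |f.eval t| * |y| ^ n ≤ 1
    · rw [indicator_of_mem ((mul_abs_pow_le_one_iff hc hn y).1 hy),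
        indicator_of_mem (by exact hy)]
      simp
    · rw [indicator_of_notMem fun h ↦ hy ((mul_abs_pow_le_one_iff hc hn y).2 h),
        indicator_of_notMem (by exact hy), mul_zero]
  · apply Measurable.aemeasurable
    simp only [Function.uncurry_def]
    exact (by fun_prop : Measurable fun p : ℝ × ℝ ↦ ENNReal.ofReal |p.1|).mul
      (measurable_one.indicator hM)

end BinaryForm

end

/-! ### Changes of variable and averaging over periods -/

noncomputable section

namespace BinaryForm

open MeasureTheory Set Real

lemma image_two_mul_cos : (fun θ ↦ 2 * cos θ) '' Ioo 0 π = Ioo (-2) 2 := by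
  ext x
  simp only [mem_image, mem_Ioo]
  constructor
  · rintro ⟨θ, ⟨h0, h1⟩, rfl⟩
    have h2 : cos θ < 1 := by
      have := cos_lt_cos_of_nonneg_of_le_pi le_rfl h1.le h0
      rwa [cos_zero] at this
    have h3 : -1 < cos θ := by
      have := cos_lt_cos_of_nonneg_of_le_pi h0.le le_rfl h1
      rwa [cos_pi] at this
    constructor <;> linarith
  · rintro ⟨h1, h2⟩
    refine ⟨arccos (x / 2), ⟨arccos_pos.2 (by linarith), ?_⟩, ?_⟩
    · exact lt_of_le_of_ne (arccos_le_pi _) fun h ↦ by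
        rw [arccos_eq_pi] at h; linarith
    · rw [cos_arccos (by linarith) (by linarith)]; ring

lemma image_add_inv : (fun q : ℝ ↦ q + q⁻¹) '' Ioo 0 1 = Ioi 2 := by
  ext x
  simp only [mem_image, mem_Ioo, mem_Ioi]
  constructor
  · rintro ⟨q, ⟨h0, h1⟩, rfl⟩
    have : 0 < (1 - q) ^ 2 / q := by
      have : 0 < 1 - q := by linarith
      positivity
    have e : (1 - q) ^ 2 / q = q + q⁻¹ - 2 := by field_simp; ring
    linarith
  · intro hx
    set s := √(x ^ 2 - 4) with hs
    have hs2 : s ^ 2 = x ^ 2 - 4 := sq_sqrt (by nlinarith)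
    have hs0 : 0 ≤ s := sqrt_nonneg _
    have h1 : x - 2 < s := by
      by_contra! h
      nlinarith
    have h2 : s < x := by nlinarith
    refine ⟨(x - s) / 2, ⟨by linarith, by linarith⟩, ?_⟩
    have : x - s ≠ 0 := by linarith
    field_simp
    nlinarith

lemma injOn_add_inv : InjOn (fun q : ℝ ↦ q + q⁻¹) (Ioo 0 1) := by
  intro a ha b hb h
  have ha0 := ha.1
  have hb0 := hb.1
  have h1 : (a - b) * (a * b - 1) = 0 := by
    simp only at h
    field_simp at h
    linarith
  rcases mul_eq_zero.1 h1 with h2 | h2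
  · linarith
  · nlinarith [ha.2, hb.2]

/-- Integration over the line in the coordinates `x = 2 cos θ` and `x = ±(q + 1 / q)`. -/
theorem lintegral_joukowski (g : ℝ → ENNReal) :
    ∫⁻ x, g x = (∫⁻ θ in Ioo 0 π, ENNReal.ofReal (2 * sin θ) * g (2 * cos θ)) +
      (∫⁻ q in Ioo (0 : ℝ) 1, ENNReal.ofReal ((q ^ 2)⁻¹ - 1) * g (q + q⁻¹)) +
      ∫⁻ q in Ioo (0 : ℝ) 1, ENNReal.ofReal ((q ^ 2)⁻¹ - 1) * g (-(q + q⁻¹)) := by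
  have h1 : ∫⁻ x in Ioo (-2 : ℝ) 2, g x =
      ∫⁻ θ in Ioo 0 π, ENNReal.ofReal (2 * sin θ) * g (2 * cos θ) := by
    rw [← image_two_mul_cos, lintegral_image_eq_lintegral_abs_deriv_mul measurableSet_Ioo
      (fun θ _ ↦ ((hasDerivAt_cos θ).const_mul 2).hasDerivWithinAt)]
    · refine setLIntegral_congr_fun measurableSet_Ioo fun θ hθ ↦ ?_
      have := sin_pos_of_mem_Ioo hθ
      rw [mul_neg, abs_neg, abs_of_pos (by positivity)]
    · intro a ha b hb h
      exact injOn_cos ⟨ha.1.le, ha.2.le⟩ ⟨hb.1.le, hb.2.le⟩ (by simpa using h)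
  have hder : ∀ q ∈ Ioo (0 : ℝ) 1, HasDerivAt (fun q : ℝ ↦ q + q⁻¹) (1 + -(q ^ 2)⁻¹) q :=
    fun q hq ↦ (hasDerivAt_id q).add (hasDerivAt_inv hq.1.ne')
  have habs : ∀ q ∈ Ioo (0 : ℝ) 1, |1 + -(q ^ 2)⁻¹| = (q ^ 2)⁻¹ - 1 := by
    intro q hq
    have : 1 ≤ (q ^ 2)⁻¹ := by
      rw [one_le_inv₀ (by have := hq.1; positivity)]
      nlinarith [hq.1, hq.2]
    rw [abs_of_nonpos (by linarith)]
    ring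
  have h2 : ∫⁻ x in Ioi (2 : ℝ), g x =
      ∫⁻ q in Ioo (0 : ℝ) 1, ENNReal.ofReal ((q ^ 2)⁻¹ - 1) * g (q + q⁻¹) := by
    rw [← image_add_inv, lintegral_image_eq_lintegral_abs_deriv_mul measurableSet_Ioo
      (fun q hq ↦ (hder q hq).hasDerivWithinAt) injOn_add_inv]
    refine setLIntegral_congr_fun measurableSet_Ioo fun q hq ↦ ?_
    simp only [habs q hq]
  have h3 : ∫⁻ x in Iio (-2 : ℝ), g x =
      ∫⁻ q in Ioo (0 : ℝ) 1, ENNReal.ofReal ((q ^ 2)⁻¹ - 1) * g (-(q + q⁻¹)) := by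
    have himg : (fun q : ℝ ↦ -(q + q⁻¹)) '' Ioo 0 1 = Iio (-2) := by
      rw [← image_image (fun x : ℝ ↦ -x) (fun q : ℝ ↦ q + q⁻¹), image_add_inv]
      simp
    rw [← himg, lintegral_image_eq_lintegral_abs_deriv_mul measurableSet_Ioo
      (f := fun q : ℝ ↦ -(q + q⁻¹))
      (fun q hq ↦ (hder q hq).neg.hasDerivWithinAt)
      (fun a ha b hb h ↦ injOn_add_inv ha hb (neg_injective h))]
    refine setLIntegral_congr_fun measurableSet_Ioo fun q hq ↦ ?_
    simp only [abs_neg, habs q hq]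
  rw [← h1, ← h2, ← h3, ← lintegral_add_compl g (measurableSet_Ioo (a := (-2 : ℝ)) (b := 2)),
    add_assoc]
  congr 1
  -- The two outer rays fill the complement of (-2, 2) up to the null set {-2, 2}.
  rw [add_comm, ← lintegral_union measurableSet_Ioi]
  · refine setLIntegral_congr ?_
    have : ({-2, 2} : Set ℝ).Finite := by simp
    have h0 : ∀ᵐ x : ℝ, x ∉ ({-2, 2} : Set ℝ) := by
      rw [ae_iff]
      simp only [not_not]
      exact this.measure_zero volume
    filter_upwards [h0] with x hx
    simp only [mem_insert_iff, mem_singleton_iff, not_or] at hx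
    apply propext
    change ¬ (-2 < x ∧ x < 2) ↔ (x < -2 ∨ 2 < x)
    constructor
    · intro h
      by_contra! h'
      exact h ⟨lt_of_le_of_ne h'.1 (Ne.symm hx.1), lt_of_le_of_ne h'.2 hx.2⟩
    · rintro (h | h) ⟨h1, h2⟩ <;> linarith
  · rw [disjoint_left]
    intro x hx hx'
    simp only [mem_Iio, mem_Ioi] at hx hx'
    linarith

lemma image_cot : (fun t ↦ cos t / sin t) '' Ioo 0 π = univ := by
  rw [eq_univ_iff_forall]
  intro x
  have h1 := neg_pi_div_two_lt_arctan x
  have h2 := arctan_lt_pi_div_two x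
  refine ⟨π / 2 - arctan x, ⟨by linarith, by linarith⟩, ?_⟩
  simp only
  rw [cos_pi_div_two_sub, sin_pi_div_two_sub, ← tan_eq_sin_div_cos, tan_arctan]

theorem lintegral_cot (g : ℝ → ENNReal) :
    ∫⁻ x, g x = ∫⁻ t in Ioo 0 π, ENNReal.ofReal ((sin t ^ 2)⁻¹) * g (cos t / sin t) := by
  rw [← setLIntegral_univ, ← image_cot,
    lintegral_image_eq_lintegral_abs_deriv_mul (f' := fun t ↦ -(sin t ^ 2)⁻¹) measurableSet_Ioo]
  · refine setLIntegral_congr_fun measurableSet_Ioo fun t ht ↦ ?_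
    rw [abs_neg, abs_of_nonneg (by positivity)]
  · intro t ht
    have hs := (sin_pos_of_mem_Ioo ht).ne'
    have := (hasDerivAt_cos t).div (hasDerivAt_sin t) hs
    refine (this.congr_deriv ?_).hasDerivWithinAt
    field_simp
    linarith [sin_sq_add_cos_sq t]
  · intro a ha b hb h
    have hsa := (sin_pos_of_mem_Ioo ha).ne'
    have hsb := (sin_pos_of_mem_Ioo hb).ne'
    simp only at h
    have h1 : sin (b - a) = 0 := by
      rw [sin_sub]
      rw [div_eq_div_iff hsa hsb] at h
      linarith
    rw [sin_eq_zero_iff_of_lt_of_lt (by linarith [ha.2, hb.1]) (by linarith [ha.1, hb.2])] at h1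
    linarith

lemma setLIntegral_Ioc_add (F : ℝ → ENNReal) (a b c : ℝ) :
    ∫⁻ x in Ioc a b, F (x + c) = ∫⁻ x in Ioc (a + c) (b + c), F x := by
  rw [← (measurePreserving_add_right volume c).setLIntegral_comp_preimage_emb
    (measurableEmbedding_addRight c) F]
  congr 2
  ext x
  simp

lemma setLIntegral_Ioc_nat_mul (F : ℝ → ENNReal) {h : ℝ} (hh : 0 ≤ h) (n : ℕ) :
    ∫⁻ x in Ioc 0 (n * h), F x = ∑ k ∈ Finset.range n, ∫⁻ x in Ioc 0 h, F (x + k * h) := by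
  induction n with
  | zero => simp
  | succ n ih =>
    have hn : 0 ≤ n * h := by positivity
    rw [Finset.sum_range_succ, ← ih, setLIntegral_Ioc_add, zero_add, Nat.cast_succ, add_mul,
      one_mul, add_comm h, ← lintegral_union measurableSet_Ioc, Ioc_union_Ioc_eq_Ioc hn (by linarith)]
    rw [disjoint_left]
    intro x hx hx'
    linarith [hx.2, hx'.1]

lemma setLIntegral_Ioc_mul (F : ℝ → ENNReal) {n : ℕ} (hn : 0 < n) (b : ℝ) :
    ∫⁻ x in Ioc 0 (b / n), F (n * x) = (n : ENNReal)⁻¹ * ∫⁻ x in Ioc 0 b, F x := by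
  have hn' : (0 : ℝ) < n := by exact_mod_cast hn
  have himg : (fun x : ℝ ↦ n * x) '' Ioc 0 (b / n) = Ioc 0 b := by
    rw [image_mul_left_Ioc hn', mul_zero, mul_div_cancel₀ _ hn'.ne']
  rw [← himg, lintegral_image_eq_lintegral_abs_deriv_mul (f' := fun _ ↦ (n : ℝ)) measurableSet_Ioc
    (fun x _ ↦ by simpa using ((hasDerivAt_id x).const_mul (n : ℝ)).hasDerivWithinAt)
    (fun x _ y _ h ↦ mul_left_cancel₀ hn'.ne' h)]
  rw [lintegral_const_mul' _ _ ENNReal.ofReal_ne_top, abs_of_pos hn', ENNReal.ofReal_natCast,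
    ← mul_assoc, ENNReal.inv_mul_cancel (by exact_mod_cast hn.ne') (ENNReal.natCast_ne_top n),
    one_mul]

/-- Averaging a weight over the periods of a periodic function. -/
theorem setLIntegral_periodic_mul {g w : ℝ → ENNReal} (hg : Function.Periodic g π)
    (hgm : Measurable g) (hwm : Measurable w) {n : ℕ} (hn : 0 < n) :
    ∫⁻ θ in Ioc 0 π, g (n * θ) * w θ = ∫⁻ θ in Ioc 0 (π / n),
      g (n * θ) * ∑ k ∈ Finset.range n, w (θ + k * π / n) := by
  have hn' : (n : ℝ) ≠ 0 := by exact_mod_cast hn.ne'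
  have h := setLIntegral_Ioc_nat_mul (fun θ ↦ g (n * θ) * w θ) (h := π / n) (by positivity) n
  rw [mul_div_cancel₀ _ hn'] at h
  rw [h, ← lintegral_finsetSum' _ (fun k _ ↦ by fun_prop)]
  refine lintegral_congr fun θ ↦ ?_
  rw [Finset.mul_sum]
  refine Finset.sum_congr rfl fun k _ ↦ ?_
  have e : (n : ℝ) * (θ + k * (π / n)) = n * θ + k * π := by field_simp
  rw [e, hg.nat_mul k (n * θ), mul_div_assoc]

/-- Only the mean of the weight over the n translates by π/n matters, since g(nθ) does not
distinguish them. This replaces sin θ by a constant in the bounds for T_n and U_n. -/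
theorem setLIntegral_periodic_mul_le {g w : ℝ → ENNReal} (hg : Function.Periodic g π)
    (hgm : Measurable g) (hwm : Measurable w) {n : ℕ} (hn : 0 < n) {W : ENNReal}
    (hW : ∀ θ ∈ Ioc 0 (π / n), ∑ k ∈ Finset.range n, w (θ + k * π / n) ≤ n * W) :
    ∫⁻ θ in Ioc 0 π, g (n * θ) * w θ ≤ W * ∫⁻ θ in Ioc 0 π, g θ := by
  rw [setLIntegral_periodic_mul hg hgm hwm hn]
  calc _ ≤ ∫⁻ θ in Ioc 0 (π / n), g (n * θ) * (n * W) := by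
        refine setLIntegral_mono' measurableSet_Ioc fun θ hθ ↦ ?_
        gcongr
        exact hW θ hθ
    _ = _ := by
        rw [lintegral_mul_const _ (by fun_prop), setLIntegral_Ioc_mul _ hn]
        rw [mul_comm, mul_assoc, mul_left_comm, ← mul_assoc (n : ENNReal), ENNReal.mul_inv_cancel
          (by exact_mod_cast hn.ne') (ENNReal.natCast_ne_top n), one_mul]

theorem setLIntegral_periodic {g : ℝ → ENNReal} (hg : Function.Periodic g π)
    (hgm : Measurable g) {n : ℕ} (hn : 0 < n) :
    ∫⁻ θ in Ioc 0 π, g (n * θ) = ∫⁻ θ in Ioc 0 π, g θ := by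
  have h := setLIntegral_periodic_mul hg hgm (w := fun _ ↦ 1) measurable_const hn
  simp only [mul_one, Finset.sum_const, Finset.card_range, nsmul_eq_mul] at h
  rw [h, lintegral_mul_const _ (by fun_prop), setLIntegral_Ioc_mul _ hn, mul_comm, ← mul_assoc,
    ENNReal.mul_inv_cancel (by exact_mod_cast hn.ne') (ENNReal.natCast_ne_top n), one_mul]

theorem setLIntegral_periodic_shift {g : ℝ → ENNReal} (hg : Function.Periodic g π) :
    ∫⁻ θ in Ioc 0 π, g (θ + π / 2) = ∫⁻ θ in Ioc 0 π, g θ := by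
  have hpi := pi_pos
  have hsplit : ∀ F : ℝ → ENNReal, ∫⁻ θ in Ioc 0 π, F θ =
      (∫⁻ θ in Ioc 0 (π / 2), F θ) + ∫⁻ θ in Ioc 0 (π / 2), F (θ + π / 2) := by
    intro F
    have := setLIntegral_Ioc_nat_mul F (h := π / 2) (by positivity) 2
    rw [Nat.cast_ofNat, mul_div_cancel₀ _ two_ne_zero] at this
    simpa [Finset.sum_range_succ] using this
  rw [hsplit g, hsplit fun θ ↦ g (θ + π / 2), add_comm]
  congr 2
  ext θ
  rw [add_assoc, add_halves, hg]

end BinaryForm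

end

/-! ### The sine integral and the areas of the three families -/

noncomputable section

namespace BinaryForm

open MeasureTheory Set Real

/-- The Beta integral `∫ |sin t| ^ (-a)` over a half period. -/
def sinInt (a : ℝ) : ℝ := ∫ t in (0 : ℝ)..π, |sin t| ^ (-a)

lemma intervalIntegrable_abs_sin_rpow {a : ℝ} (ha : 0 ≤ a) (ha1 : a < 1) :
    IntervalIntegrable (fun t ↦ |sin t| ^ (-a)) volume 0 π := by
  have h1 : IntervalIntegrable (fun t : ℝ ↦ (2 / π) ^ (-a) * t ^ (-a)) volume 0 π :=
    (intervalIntegral.intervalIntegrable_rpow' (by linarith)).const_mul _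
  have h2 : IntervalIntegrable (fun t : ℝ ↦ (2 / π) ^ (-a) * (π - t) ^ (-a)) volume 0 π := by
    have := (h1.comp_sub_left π).symm
    simpa using this
  refine (h1.add h2).mono_fun ?_ ?_
  · exact (by fun_prop : Measurable fun t ↦ |sin t| ^ (-a)).aestronglyMeasurable
  · rw [uIoc_of_le pi_pos.le, ← restrict_Ioo_eq_restrict_Ioc]
    refine (ae_restrict_iff' measurableSet_Ioo).2 (Filter.Eventually.of_forall fun t ht ↦ ?_)
    obtain ⟨h0, hpi⟩ := ht
    have hs := sin_pos_of_pos_of_lt_pi h0 hpi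
    have hpt : 0 < π - t := by linarith
    beta_reduce
    rw [norm_of_nonneg (by positivity), abs_of_pos hs]
    refine le_trans ?_ (le_abs_self _)
    -- Jordan's inequality sin u ≥ 2u/π, applied at the nearer of the two endpoints 0 and π,
    -- dominates the integrand by a pure power.
    have key : ∀ u : ℝ, 0 < u → 2 / π * u ≤ sin t →
        sin t ^ (-a) ≤ (2 / π) ^ (-a) * u ^ (-a) := by
      intro u hu h
      rw [← mul_rpow (by positivity) hu.le]
      exact rpow_le_rpow_of_nonpos (by positivity) h (by linarith)
    have p1 : 0 ≤ (2 / π) ^ (-a) * t ^ (-a) := by positivity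
    have p2 : 0 ≤ (2 / π) ^ (-a) * (π - t) ^ (-a) := by positivity
    rcases le_total t (π / 2) with h | h
    · have := key t h0 (mul_le_sin h0.le h)
      linarith
    · have h3 := mul_le_sin hpt.le (by linarith : π - t ≤ π / 2)
      rw [sin_pi_sub] at h3
      have := key _ hpt h3
      linarith

lemma setLIntegral_abs_sin_rpow {a : ℝ} (ha : 0 ≤ a) (ha1 : a < 1) :
    ∫⁻ t in Ioc 0 π, ENNReal.ofReal (|sin t| ^ (-a)) = ENNReal.ofReal (sinInt a) := by
  rw [sinInt, intervalIntegral.integral_of_le pi_pos.le, ofReal_integral_eq_lintegral_ofReal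
    ((intervalIntegrable_iff_integrableOn_Ioc_of_le pi_pos.le).1
      (intervalIntegrable_abs_sin_rpow ha ha1))
    (Filter.Eventually.of_forall fun t ↦ by positivity)]

/-- On [0, 1], and symmetrically on [π - 1, π], sin u ≤ u gives 1/(1 - a); on the middle piece of
length π - 2 the integrand is at least 1. -/
lemma le_sinInt {a : ℝ} (ha : 0 ≤ a) (ha1 : a < 1) : π + 2 * a / (1 - a) ≤ sinInt a := by
  have hpi := pi_gt_three
  have hI := intervalIntegrable_abs_sin_rpow ha ha1
  have hsub : ∀ {x y : ℝ}, 0 ≤ x → x ≤ y → y ≤ π →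
      IntervalIntegrable (fun t ↦ |sin t| ^ (-a)) volume x y := by
    intro x y hx hxy hy
    refine hI.mono_set ?_
    rw [uIcc_of_le hxy, uIcc_of_le pi_pos.le]
    exact Icc_subset_Icc hx hy
  have e : sinInt a = ((∫ t in (0 : ℝ)..1, |sin t| ^ (-a)) + ∫ t in (1 : ℝ)..(π - 1),
      |sin t| ^ (-a)) + ∫ t in (π - 1)..π, |sin t| ^ (-a) := by
    rw [intervalIntegral.integral_add_adjacent_intervals
      (hsub le_rfl (by linarith) (by linarith)) (hsub (by linarith) (by linarith) (by linarith)),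
      intervalIntegral.integral_add_adjacent_intervals
      (hsub le_rfl (by linarith) (by linarith)) (hsub (by linarith) (by linarith) le_rfl), sinInt]
  have e3 : ∫ t in (π - 1)..π, |sin t| ^ (-a) = ∫ t in (0 : ℝ)..1, |sin t| ^ (-a) := by
    have := intervalIntegral.integral_comp_sub_left (a := 0) (b := 1)
      (fun t ↦ |sin t| ^ (-a)) π
    simp only [sin_pi_sub, sub_zero] at this
    exact this.symm
  have h1 : 1 / (1 - a) ≤ ∫ t in (0 : ℝ)..1, |sin t| ^ (-a) := by
    have h : ∫ t in (0 : ℝ)..1, t ^ (-a) = 1 / (1 - a) := by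
      rw [integral_rpow (Or.inl (by linarith)), one_rpow, zero_rpow (by linarith)]
      ring
    rw [← h]
    refine intervalIntegral.integral_mono_on_of_le_Ioo zero_le_one
      (intervalIntegral.intervalIntegrable_rpow' (by linarith))
      (hsub le_rfl (by linarith) (by linarith)) fun t ht ↦ ?_
    have hs := sin_pos_of_pos_of_lt_pi ht.1 (by linarith [ht.2])
    rw [abs_of_pos hs]
    exact rpow_le_rpow_of_nonpos hs (sin_le ht.1.le) (by linarith)
  have h2 : π - 2 ≤ ∫ t in (1 : ℝ)..(π - 1), |sin t| ^ (-a) := by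
    have h : ∫ t in (1 : ℝ)..(π - 1), (1 : ℝ) = π - 2 := by
      rw [intervalIntegral.integral_const]
      simp
      ring
    rw [← h]
    refine intervalIntegral.integral_mono_on_of_le_Ioo (by linarith)
      (by simp) (hsub (by linarith) (by linarith) (by linarith)) fun t ht ↦ ?_
    have hs := sin_pos_of_pos_of_lt_pi (by linarith [ht.1]) (by linarith [ht.2] : t < π)
    rw [abs_of_pos hs]
    exact one_le_rpow_of_pos_of_le_one_of_nonpos hs (sin_le_one t) (by linarith)
  rw [e, e3]
  have : 2 * a / (1 - a) = 2 * (1 / (1 - a)) - 2 := by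
    have : 1 - a ≠ 0 := by linarith
    field_simp
    ring
  linarith

lemma periodic_ofReal_abs_sin_rpow (a : ℝ) :
    Function.Periodic (fun t ↦ ENNReal.ofReal (|sin t| ^ (-a))) π := by
  intro t
  simp [sin_add_pi]

/-- The integral of `|p| ^ (-a)` over the line. -/
def areaInt (p : Polynomial ℝ) (a : ℝ) : ENNReal := ∫⁻ x, ENNReal.ofReal (|p.eval x| ^ (-a))

lemma lintegral_comp_mul {k : ℝ} (hk : 0 < k) (g : ℝ → ENNReal) :
    ∫⁻ x, g x = ENNReal.ofReal k * ∫⁻ x, g (k * x) := by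
  have himg : (fun x : ℝ ↦ k * x) '' univ = univ := by
    rw [image_univ, range_eq_univ]
    exact fun y ↦ ⟨y / k, by field_simp⟩
  conv_lhs => rw [← setLIntegral_univ, ← himg]
  rw [lintegral_image_eq_lintegral_abs_deriv_mul (f := fun x : ℝ ↦ k * x)
    (f' := fun _ ↦ k) MeasurableSet.univ
    (fun x _ ↦ by simpa only [mul_one] using
      ((hasDerivAt_id' x).const_mul k).hasDerivWithinAt)
    (fun x _ y _ h ↦ mul_left_cancel₀ hk.ne' h), lintegral_const_mul' _ _ ENNReal.ofReal_ne_top,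
    setLIntegral_univ, abs_of_pos hk]

lemma lintegral_comp_div_two (g : ℝ → ENNReal) :
    ∫⁻ x, g x = ENNReal.ofReal (1 / 2) * ∫⁻ x, g (x / 2) := by
  rw [lintegral_comp_mul one_half_pos]
  simp only [one_div, inv_mul_eq_div]

lemma area_homog {p : Polynomial ℝ} (hp : p.natDegree ≠ 0) :
    area (homog p) = areaInt p (2 / p.natDegree) := by
  have hp0 : p ≠ 0 := by rintro rfl; simp at hp
  rw [area_eq (isHomogeneous_homog p) hp (by rwa [dehom_homog]), dehom_homog, areaInt]

lemma area_T {n : ℕ} (hn : n ≠ 0) : area (T n) =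
    ENNReal.ofReal (2 ^ (2 / (n : ℝ) - 1)) * areaInt (Polynomial.Chebyshev.C ℝ n) (2 / n) := by
  have hdeg : (Polynomial.Chebyshev.T ℝ n).natDegree = n := by
    rw [Polynomial.Chebyshev.natDegree_T]; simp
  have e : (2 : ℝ) ^ (2 / (n : ℝ) - 1) = 1 / 2 * 2 ^ (2 / (n : ℝ)) := by
    rw [rpow_sub two_pos, rpow_one]
    ring
  rw [T, area_homog (by rwa [hdeg]), hdeg, areaInt, lintegral_comp_div_two, areaInt, e,
    ENNReal.ofReal_mul (by norm_num), mul_assoc]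
  congr 1
  rw [← lintegral_const_mul' _ _ ENNReal.ofReal_ne_top]
  refine lintegral_congr fun x ↦ ?_
  have h := congrArg (Polynomial.eval (x / 2)) (Polynomial.Chebyshev.C_comp_two_mul_X ℝ n)
  simp only [Polynomial.eval_comp, Polynomial.eval_mul, Polynomial.eval_ofNat,
    Polynomial.eval_X, mul_div_cancel₀ x (two_ne_zero' ℝ)] at h
  rw [h, abs_mul, abs_two, mul_rpow two_pos.le (abs_nonneg _), ← ENNReal.ofReal_mul (by positivity),
    ← mul_assoc, ← rpow_add two_pos, add_neg_cancel, rpow_zero, one_mul]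

lemma area_U {n : ℕ} (hn : n ≠ 0) : area (U n) =
    ENNReal.ofReal (1 / 2) * areaInt (Polynomial.Chebyshev.S ℝ n) (2 / n) := by
  have hdeg : (Polynomial.Chebyshev.U ℝ n).natDegree = n :=
    Polynomial.Chebyshev.natDegree_U_natCast ℝ n
  rw [U, area_homog (by rwa [hdeg]), hdeg, areaInt, lintegral_comp_div_two, areaInt]
  congr 1
  refine lintegral_congr fun x ↦ ?_
  have h := congrArg (Polynomial.eval (x / 2)) (Polynomial.Chebyshev.S_comp_two_mul_X ℝ n)
  simp only [Polynomial.eval_comp, Polynomial.eval_mul, Polynomial.eval_ofNat,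
    Polynomial.eval_X, mul_div_cancel₀ x (two_ne_zero' ℝ)] at h
  rw [h]

lemma dehom_S_ne_zero {n : ℕ} (hn : 2 ≤ n) : dehom (S n) ≠ 0 := by
  intro h
  -- At this angle |sin nt| = 1.
  have h1 := abs_eval_dehom_S (n := n) (by omega) (t := π / 2 / n) ?_
  · rw [h, Polynomial.eval_zero, abs_zero, zero_mul, mul_div_cancel₀ _ (by positivity),
      sin_pi_div_two, abs_one, mul_one] at h1
    exact (sConst_pos n).ne h1
  · apply ne_of_gt
    have hpi := pi_pos
    have : (2 : ℝ) ≤ n := by exact_mod_cast hn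
    apply sin_pos_of_pos_of_lt_pi (by positivity)
    rw [div_lt_iff₀ (by positivity)]
    nlinarith

/-- With x = cot t, the Jacobian 1/sin² t cancels against the power of sin t coming from
homogeneity, and |κ sin nt|^(-2/n) is left. By periodicity nt may be replaced by t. The exponent 2/n
is below 1 because n ≥ 3. -/
lemma area_S {n : ℕ} (hn : 3 ≤ n) :
    area (S n) = ENNReal.ofReal (sConst n ^ (-(2 / (n : ℝ))) * sinInt (2 / n)) := by
  have hn3 : (3 : ℝ) ≤ n := by exact_mod_cast hn
  have ha0 : 0 ≤ 2 / (n : ℝ) := by positivity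
  have ha1 : 2 / (n : ℝ) < 1 := by rw [div_lt_one (by positivity)]; linarith
  have hκ := sConst_pos n
  rw [area_eq (isHomogeneous_S n) (by omega) (dehom_S_ne_zero (by omega)), lintegral_cot,
    ENNReal.ofReal_mul (by positivity), ← setLIntegral_abs_sin_rpow ha0 ha1,
    ← setLIntegral_periodic (periodic_ofReal_abs_sin_rpow _) (by fun_prop) (by omega : 0 < n),
    ← lintegral_const_mul' _ _ ENNReal.ofReal_ne_top, restrict_Ioo_eq_restrict_Ioc]
  rw [← restrict_Ioo_eq_restrict_Ioc]
  refine setLIntegral_congr_fun measurableSet_Ioo fun t ht ↦ ?_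
  have hs := sin_pos_of_mem_Ioo ht
  have h := abs_eval_dehom_S (n := n) (by omega) hs.ne'
  rw [← ENNReal.ofReal_mul (by positivity), ← ENNReal.ofReal_mul (by positivity)]
  congr 1
  rw [← mul_rpow hκ.le (abs_nonneg _), ← h, mul_rpow (abs_nonneg _) (by positivity), mul_comm,
    abs_of_pos hs]
  congr 1
  rw [← rpow_natCast (sin t) n, ← rpow_mul hs.le, mul_neg, mul_div_cancel₀ _ (by positivity),
    rpow_neg hs.le, rpow_two]

end BinaryForm

end

/-! ### Integrals of functions close to 1, and cyclotomic quotients -/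

noncomputable section

namespace BinaryForm

open MeasureTheory Set Real

/-- G is at most c(1 + sR), where R absorbs its singularities and has bounded integral. For c near 1
and s near 0 the bound is close to W = ∫ w. -/
lemma lintegral_mul_near_one {α : Type*} [MeasurableSpace α] {μ : Measure α} {w G R : α → ℝ}
    {c s b W J : ℝ} (hs : 0 ≤ s) (hc : 0 ≤ c) (hb : 0 ≤ b) (hW : 0 ≤ W) (hJ : 0 ≤ J)
    (hwm : Measurable w)
    (hw : ∀ᵐ x ∂μ, 0 ≤ w x ∧ w x ≤ b) (hR : ∀ᵐ x ∂μ, 0 ≤ R x)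
    (hG : ∀ᵐ x ∂μ, 0 ≤ G x ∧ G x ≤ c * (1 + s * R x))
    (hWi : ∫⁻ x, ENNReal.ofReal (w x) ∂μ = ENNReal.ofReal W)
    (hRi : ∫⁻ x, ENNReal.ofReal (R x) ∂μ ≤ ENNReal.ofReal J) :
    ∫⁻ x, ENNReal.ofReal (w x * G x) ∂μ ≤ ENNReal.ofReal (c * (W + s * b * J)) := by
  calc ∫⁻ x, ENNReal.ofReal (w x * G x) ∂μ
      ≤ ∫⁻ x, ENNReal.ofReal c *
          (ENNReal.ofReal (w x) + ENNReal.ofReal (s * b) * ENNReal.ofReal (R x)) ∂μ := by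
        refine lintegral_mono_ae ?_
        filter_upwards [hw, hR, hG] with x hw hR hG
        rw [← ENNReal.ofReal_mul (by positivity), ← ENNReal.ofReal_add hw.1 (by positivity),
          ← ENNReal.ofReal_mul hc]
        refine ENNReal.ofReal_le_ofReal ?_
        calc w x * G x ≤ w x * (c * (1 + s * R x)) := mul_le_mul_of_nonneg_left hG.2 hw.1
          _ = c * (w x + w x * (s * R x)) := by ring
          _ ≤ c * (w x + b * (s * R x)) := by gcongr; exact hw.2
          _ = _ := by ring
    _ = ENNReal.ofReal c * (ENNReal.ofReal W +
          ENNReal.ofReal (s * b) * ∫⁻ x, ENNReal.ofReal (R x) ∂μ) := by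
        rw [lintegral_const_mul' _ _ ENNReal.ofReal_ne_top, lintegral_add_left (by fun_prop),
          lintegral_const_mul' _ _ ENNReal.ofReal_ne_top, hWi]
    _ ≤ ENNReal.ofReal c * (ENNReal.ofReal W + ENNReal.ofReal (s * b) * ENNReal.ofReal J) := by
        gcongr
    _ = _ := by
        rw [← ENNReal.ofReal_mul (by positivity), ← ENNReal.ofReal_add hW (by positivity),
          ← ENNReal.ofReal_mul hc]

/-- The matching lower bound needs no new estimate: G + 1/G ≥ 2, and the upper bound is applied to
1/G. -/
lemma le_lintegral_mul_near_one {α : Type*} [MeasurableSpace α] {μ : Measure α} {w G R : α → ℝ}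
    {c s b W J : ℝ} (hs : 0 ≤ s) (hc : 0 ≤ c) (hb : 0 ≤ b) (hW : 0 ≤ W) (hJ : 0 ≤ J)
    (hwm : Measurable w) (hGm : Measurable G)
    (hw : ∀ᵐ x ∂μ, 0 ≤ w x ∧ w x ≤ b) (hR : ∀ᵐ x ∂μ, 0 ≤ R x)
    (hG : ∀ᵐ x ∂μ, 0 < G x ∧ (G x)⁻¹ ≤ c * (1 + s * R x))
    (hWi : ∫⁻ x, ENNReal.ofReal (w x) ∂μ = ENNReal.ofReal W)
    (hRi : ∫⁻ x, ENNReal.ofReal (R x) ∂μ ≤ ENNReal.ofReal J) :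
    ENNReal.ofReal (2 * W) ≤ ∫⁻ x, ENNReal.ofReal (w x * G x) ∂μ +
      ENNReal.ofReal (c * (W + s * b * J)) := by
  have h1 := lintegral_mul_near_one hs hc hb hW hJ hwm hw hR (G := fun x ↦ (G x)⁻¹)
    (hG.mono fun x h ↦ ⟨inv_nonneg.2 h.1.le, h.2⟩) hWi hRi
  refine le_trans ?_ (add_le_add_right h1 _)
  rw [← lintegral_add_left (by fun_prop), ENNReal.ofReal_mul two_pos.le, ← hWi,
    ← lintegral_const_mul' _ _ ENNReal.ofReal_ne_top]
  refine lintegral_mono_ae ?_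
  filter_upwards [hw, hG] with x hw hG
  have h0 := inv_pos.2 hG.1
  rw [← ENNReal.ofReal_add (mul_nonneg hw.1 hG.1.le) (mul_nonneg hw.1 h0.le),
    ← ENNReal.ofReal_mul two_pos.le]
  refine ENNReal.ofReal_le_ofReal ?_
  have h2 : 2 ≤ G x + (G x)⁻¹ := by
    have h3 : G x * (G x)⁻¹ = 1 := mul_inv_cancel₀ hG.1.ne'
    nlinarith [sq_nonneg (G x - (G x)⁻¹)]
  nlinarith [hw.1]

/-- Bernoulli's inequality for the exponent 2s ≤ 1 and the base y^(-1/2). The fixed power -1/2 keeps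
the majorant integrable uniformly in s. -/
lemma rpow_neg_le_one_add {y s : ℝ} (hy : 0 < y) (hs : 0 ≤ s) (hs1 : s ≤ 1 / 2) :
    y ^ (-s) ≤ 1 + 2 * s * y ^ (-(1 / 2 : ℝ)) := by
  have h : y ^ (-s) = (1 + (y ^ (-(1 / 2 : ℝ)) - 1)) ^ (2 * s) := by
    rw [add_sub_cancel, ← rpow_mul hy.le]
    congr 1
    ring
  have h0 : 0 < y ^ (-(1 / 2 : ℝ)) := by positivity
  rw [h]
  refine (rpow_one_add_le_one_add_mul_self (by linarith) (by linarith) (by linarith)).trans ?_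
  nlinarith

/-- The polynomial `p` is, in the coordinate `x = z + 1 / z`, a quotient of products of factors
`z ^ e - 1` divided by `z ^ d`. -/
structure IsCycloQuotient (p : Polynomial ℝ) (d : ℕ) (A B : Finset ℕ) : Prop where
  disjoint : Disjoint A B
  pos : ∀ e ∈ A ∪ B, 0 < e
  norm_eq : ∀ z : ℂ, z ≠ 0 → ‖Polynomial.aeval (z + z⁻¹) p‖ * ‖z‖ ^ d * ∏ e ∈ B, ‖z ^ e - 1‖ =
    ∏ e ∈ A, ‖z ^ e - 1‖

namespace IsCycloQuotient

variable {p : Polynomial ℝ} {d : ℕ} {A B : Finset ℕ}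

/-- A two-sided bound from bounds on the individual factors. -/
lemma bounds (h : IsCycloQuotient p d A B) {z : ℂ} (hz : z ≠ 0) {m : ℕ → ℝ}
    (hm : ∀ e ∈ A ∪ B, 0 < m e) (h1 : ∀ e ∈ A ∪ B, m e ≤ ‖z ^ e - 1‖)
    (h2 : ∀ e ∈ A ∪ B, ‖z ^ e - 1‖ ≤ (m e)⁻¹) :
    ∏ e ∈ A ∪ B, m e ≤ ‖Polynomial.aeval (z + z⁻¹) p‖ * ‖z‖ ^ d ∧
      ‖Polynomial.aeval (z + z⁻¹) p‖ * ‖z‖ ^ d ≤ (∏ e ∈ A ∪ B, m e)⁻¹ := by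
  have hA : ∀ e ∈ A, e ∈ A ∪ B := fun e he ↦ Finset.mem_union_left _ he
  have hB : ∀ e ∈ B, e ∈ A ∪ B := fun e he ↦ Finset.mem_union_right _ he
  have hPB : 0 < ∏ e ∈ B, ‖z ^ e - 1‖ :=
    Finset.prod_pos fun e he ↦ (hm e (hB e he)).trans_le (h1 e (hB e he))
  have hmA : 0 < ∏ e ∈ A, m e := Finset.prod_pos fun e he ↦ hm e (hA e he)
  have hmB : 0 < ∏ e ∈ B, m e := Finset.prod_pos fun e he ↦ hm e (hB e he)
  have hA1 : ∏ e ∈ A, m e ≤ ∏ e ∈ A, ‖z ^ e - 1‖ :=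
    Finset.prod_le_prod (fun e he ↦ (hm e (hA e he)).le) fun e he ↦ h1 e (hA e he)
  have hA2 : ∏ e ∈ A, ‖z ^ e - 1‖ ≤ (∏ e ∈ A, m e)⁻¹ := by
    rw [← Finset.prod_inv_distrib]
    exact Finset.prod_le_prod (fun e he ↦ norm_nonneg _) fun e he ↦ h2 e (hA e he)
  have hB1 : ∏ e ∈ B, m e ≤ ∏ e ∈ B, ‖z ^ e - 1‖ :=
    Finset.prod_le_prod (fun e he ↦ (hm e (hB e he)).le) fun e he ↦ h1 e (hB e he)
  have hB2 : ∏ e ∈ B, ‖z ^ e - 1‖ ≤ (∏ e ∈ B, m e)⁻¹ := by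
    rw [← Finset.prod_inv_distrib]
    exact Finset.prod_le_prod (fun e he ↦ norm_nonneg _) fun e he ↦ h2 e (hB e he)
  have hq : ‖Polynomial.aeval (z + z⁻¹) p‖ * ‖z‖ ^ d =
      (∏ e ∈ A, ‖z ^ e - 1‖) / ∏ e ∈ B, ‖z ^ e - 1‖ := by
    rw [eq_div_iff hPB.ne', h.norm_eq z hz]
  rw [hq, Finset.prod_union h.disjoint]
  constructor
  · rw [le_div_iff₀ hPB, mul_assoc]
    calc (∏ e ∈ A, m e) * ((∏ e ∈ B, m e) * ∏ e ∈ B, ‖z ^ e - 1‖)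
        ≤ (∏ e ∈ A, m e) * 1 := by
          gcongr
          calc _ ≤ (∏ e ∈ B, m e) * (∏ e ∈ B, m e)⁻¹ := by gcongr
            _ = 1 := mul_inv_cancel₀ hmB.ne'
      _ ≤ _ := by rw [mul_one]; exact hA1
  · rw [div_le_iff₀ hPB, mul_inv, mul_assoc]
    calc _ ≤ (∏ e ∈ A, m e)⁻¹ * 1 := by rw [mul_one]; exact hA2
      _ ≤ _ := by
        gcongr
        rw [← div_eq_inv_mul, le_div_iff₀ hmB, one_mul]
        exact hB1

end IsCycloQuotient

lemma lintegral_outer_weight :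
    ∫⁻ q in Ioo (0 : ℝ) 1, ENNReal.ofReal (1 - q ^ 2) = ENNReal.ofReal (2 / 3) := by
  rw [← ofReal_integral_eq_lintegral_ofReal]
  · rw [← integral_Ioc_eq_integral_Ioo, ← intervalIntegral.integral_of_le zero_le_one]
    congr 1
    rw [intervalIntegral.integral_sub (by simp) (by simp), integral_pow]
    norm_num
  · exact (by fun_prop : Continuous fun q : ℝ ↦ 1 - q ^ 2).integrableOn_Icc.mono_set
      Ioo_subset_Icc_self
  · refine (ae_restrict_iff' measurableSet_Ioo).2 (Filter.Eventually.of_forall fun q hq ↦ ?_)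
    simp only [Pi.zero_apply]
    nlinarith [hq.1, hq.2]

lemma lintegral_outer_singular :
    ∫⁻ q in Ioo (0 : ℝ) 1, ENNReal.ofReal ((1 - q) ^ (-(1 / 2 : ℝ))) = ENNReal.ofReal 2 := by
  have hint : IntervalIntegrable (fun q : ℝ ↦ (1 - q) ^ (-(1 / 2 : ℝ))) volume 0 1 := by
    have : IntervalIntegrable (fun q : ℝ ↦ q ^ (-(1 / 2 : ℝ))) volume 0 1 :=
      intervalIntegral.intervalIntegrable_rpow' (by norm_num)
    simpa using (this.comp_sub_left 1).symm
  rw [← ofReal_integral_eq_lintegral_ofReal]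
  · rw [← integral_Ioc_eq_integral_Ioo, ← intervalIntegral.integral_of_le zero_le_one]
    congr 1
    have := intervalIntegral.integral_comp_sub_left (a := 0) (b := 1)
      (fun q : ℝ ↦ q ^ (-(1 / 2 : ℝ))) 1
    rw [this, sub_self, sub_zero, integral_rpow (Or.inl (by norm_num))]
    norm_num
  · exact ((intervalIntegrable_iff_integrableOn_Ioc_of_le zero_le_one).1 hint).mono_set
      Ioo_subset_Ioc_self
  · refine (ae_restrict_iff' measurableSet_Ioo).2 (Filter.Eventually.of_forall fun q hq ↦ ?_)
    have : 0 < 1 - q := by linarith [hq.2]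
    simp only [Pi.zero_apply]
    positivity

lemma lintegral_inner_weight :
    ∫⁻ θ in Ioo 0 π, ENNReal.ofReal (2 * sin θ) = ENNReal.ofReal 4 := by
  rw [← ofReal_integral_eq_lintegral_ofReal]
  · rw [← integral_Ioc_eq_integral_Ioo, ← intervalIntegral.integral_of_le pi_pos.le]
    congr 1
    rw [intervalIntegral.integral_const_mul, integral_sin]
    norm_num
  · exact (by fun_prop : Continuous fun θ : ℝ ↦ 2 * sin θ).integrableOn_Icc.mono_set
      Ioo_subset_Icc_self
  · refine (ae_restrict_iff' measurableSet_Ioo).2 (Filter.Eventually.of_forall fun q hq ↦ ?_)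
    have := sin_pos_of_mem_Ioo hq
    simp only [Pi.zero_apply]
    positivity

/-- The bound does not depend on e: after θ = 2x the range (0, π/2] is enlarged to a full period of
|sin|, over which the frequency e is invisible. -/
lemma lintegral_inner_singular {e : ℕ} (he : 0 < e) :
    ∫⁻ θ in Ioo 0 π, ENNReal.ofReal (|sin (e * (θ / 2))| ^ (-(1 / 2 : ℝ))) ≤
      ENNReal.ofReal (2 * sinInt (1 / 2)) := by
  set g : ℝ → ENNReal := fun t ↦ ENNReal.ofReal (|sin t| ^ (-(1 / 2 : ℝ))) with hg
  have himg : (fun x : ℝ ↦ 2 * x) '' Ioc 0 (π / 2) = Ioc 0 π := by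
    rw [image_mul_left_Ioc two_pos, mul_zero, mul_div_cancel₀ _ two_ne_zero]
  rw [restrict_Ioo_eq_restrict_Ioc, ← himg,
    lintegral_image_eq_lintegral_abs_deriv_mul (f' := fun _ ↦ (2 : ℝ)) measurableSet_Ioc
    (fun x _ ↦ by simpa using ((hasDerivAt_id x).const_mul (2 : ℝ)).hasDerivWithinAt)
    (fun x _ y _ h ↦ mul_left_cancel₀ two_ne_zero h),
    lintegral_const_mul' _ _ ENNReal.ofReal_ne_top, abs_two, ENNReal.ofReal_mul two_pos.le,
    ← setLIntegral_abs_sin_rpow (by norm_num) (by norm_num),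
    ← setLIntegral_periodic (periodic_ofReal_abs_sin_rpow _) (by fun_prop) he]
  gcongr 1
  simp only [mul_div_cancel_left₀ _ (two_ne_zero' ℝ)]
  refine lintegral_mono_set ?_
  exact Ioc_subset_Ioc_right (by linarith [pi_pos])

end BinaryForm

end

/-! ### Area integral of a cyclotomic quotient and its limit 16/3 -/

noncomputable section

namespace BinaryForm

open MeasureTheory Set Real

lemma rpow_neg_bounds {P L σ : ℝ} (hL : 0 < L) (h1 : L ≤ P) (h2 : P ≤ L⁻¹) (hσ : 0 ≤ σ) :
    0 < P ^ (-σ) ∧ P ^ (-σ) ≤ L ^ (-σ) ∧ (P ^ (-σ))⁻¹ ≤ L ^ (-σ) := by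
  have hP : 0 < P := hL.trans_le h1
  refine ⟨by positivity, rpow_le_rpow_of_nonpos hL h1 (by linarith), ?_⟩
  rw [← rpow_neg hP.le, neg_neg, rpow_neg hL.le, ← inv_rpow hL.le]
  exact rpow_le_rpow hP.le h2 hσ

/-- The product is a geometric mean of the y_e^(-s), so by AM-GM it is at most their average, to
which Bernoulli applies termwise. The singularities thus enter only through an average over E. -/
lemma prod_rpow_neg_le {E : Finset ℕ} (hE : E.Nonempty) {y : ℕ → ℝ} (hy : ∀ e ∈ E, 0 < y e)
    {σ s : ℝ} (hσ : 0 ≤ σ) (hs : s = σ * E.card) (hs1 : s ≤ 1 / 2) :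
    (∏ e ∈ E, y e / 2) ^ (-σ) ≤
      2 ^ s * (1 + 2 * s * ((E.card : ℝ)⁻¹ * ∑ e ∈ E, y e ^ (-(1 / 2 : ℝ)))) := by
  have hK : (0 : ℝ) < E.card := by exact_mod_cast hE.card_pos
  have hs0 : 0 ≤ s := by rw [hs]; positivity
  have hM : 0 < ∏ e ∈ E, y e := Finset.prod_pos hy
  rw [Finset.prod_div_distrib, Finset.prod_const, div_rpow hM.le (by positivity),
    ← rpow_natCast, ← rpow_mul two_pos.le, div_eq_inv_mul, ← rpow_neg two_pos.le,
    show -((E.card : ℝ) * -σ) = s by rw [hs]; ring]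
  gcongr
  have h1 : (∏ e ∈ E, y e) ^ (-σ) = ∏ e ∈ E, (y e ^ (-s)) ^ ((E.card : ℝ)⁻¹) := by
    rw [← Real.finsetProd_rpow _ _ fun e he ↦ (hy e he).le]
    refine Finset.prod_congr rfl fun e he ↦ ?_
    rw [← rpow_mul (hy e he).le, hs]
    congr 1
    field_simp
  have h2 := Real.geom_mean_le_arith_mean_weighted E (fun _ ↦ (E.card : ℝ)⁻¹)
    (fun e ↦ y e ^ (-s)) (fun _ _ ↦ by positivity)
    (by rw [Finset.sum_const, nsmul_eq_mul, mul_inv_cancel₀ hK.ne'])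
    (fun e he ↦ rpow_nonneg (hy e he).le _)
  rw [h1]
  refine h2.trans ?_
  calc ∑ e ∈ E, (E.card : ℝ)⁻¹ * y e ^ (-s)
      ≤ ∑ e ∈ E, (E.card : ℝ)⁻¹ * (1 + 2 * s * y e ^ (-(1 / 2 : ℝ))) := by
        refine Finset.sum_le_sum fun e he ↦ ?_
        gcongr
        exact rpow_neg_le_one_add (hy e he) hs0 hs1
    _ = _ := by
        rw [← Finset.mul_sum, Finset.sum_add_distrib, Finset.sum_const, nsmul_eq_mul, mul_one,
          mul_add, inv_mul_cancel₀ hK.ne', ← Finset.mul_sum]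
        ring

lemma norm_aeval_ofReal (p : Polynomial ℝ) (x : ℝ) :
    ‖Polynomial.aeval (x : ℂ) p‖ = |p.eval x| := by
  have : Polynomial.aeval (x : ℂ) p = ((p.eval x : ℝ) : ℂ) :=
    Polynomial.aeval_algebraMap_apply_eq_algebraMap_eval x p
  rw [this, Complex.norm_real, norm_eq_abs]

/-- Upper bound for the area integral of a quotient of cyclotomic products, as a function of
`s = (2 / d) * #(factors)`. -/
def cycloBound (s : ℝ) : ℝ :=
  2 ^ s * (4 + 2 * s * 2 * (2 * sinInt (1 / 2))) + 2 * (1 * (2 / 3 + 2 * s * 1 * 2))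

lemma sinInt_nonneg (a : ℝ) : 0 ≤ sinInt a :=
  intervalIntegral.integral_nonneg pi_pos.le fun t _ ↦ by positivity

lemma ae_sin_ne_zero (E : Finset ℕ) (hE : ∀ e ∈ E, 0 < e) :
    ∀ᵐ θ : ℝ, ∀ e ∈ E, sin (e * (θ / 2)) ≠ 0 := by
  rw [ae_iff]
  refine Countable.measure_zero (s := {θ : ℝ | ¬∀ e ∈ E, sin (e * (θ / 2)) ≠ 0}) ?_ _
  refine (countable_range fun x : ℤ × ℕ ↦ 2 * (x.1 * π) / (x.2 : ℝ)).mono ?_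
  intro θ hθ
  simp only [mem_ofPred_eq, not_forall, not_not] at hθ
  obtain ⟨e, he, hs⟩ := hθ
  have he' : (e : ℝ) ≠ 0 := by exact_mod_cast (hE e he).ne'
  obtain ⟨n, hn⟩ := sin_eq_zero_iff.1 hs
  refine ⟨(n, e), ?_⟩
  simp only
  rw [hn]
  field_simp

namespace IsCycloQuotient

variable {p : Polynomial ℝ} {d : ℕ} {A B : Finset ℕ}

/-- On the unit circle |z^e - 1| = 2|sin(eθ/2)| = 2y with 0 < y ≤ 1, which lies between y/2 and 2/y.
-/
lemma inner_bounds (h : IsCycloQuotient p d A B) {θ : ℝ}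
    (hθ : ∀ e ∈ A ∪ B, sin (e * (θ / 2)) ≠ 0) :
    ∏ e ∈ A ∪ B, |sin (e * (θ / 2))| / 2 ≤ |p.eval (2 * cos θ)| ∧
      |p.eval (2 * cos θ)| ≤ (∏ e ∈ A ∪ B, |sin (e * (θ / 2))| / 2)⁻¹ := by
  have hn : ∀ e : ℕ, ‖Complex.exp (θ * Complex.I) ^ e - 1‖ = 2 * |sin (e * (θ / 2))| := by
    intro e
    have := norm_exp_mul_I_sub (e * (θ / 2)) 0
    rw [sub_zero] at this
    rw [← this, ← Complex.exp_nat_mul]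
    congr 2
    · congr 1; push_cast; ring
    · simp
  have hx : Complex.exp (θ * Complex.I) + (Complex.exp (θ * Complex.I))⁻¹ =
      ((2 * cos θ : ℝ) : ℂ) := by
    rw [← Complex.exp_neg]
    push_cast
    rw [Complex.two_cos, neg_mul]
  have key := h.bounds (z := Complex.exp (θ * Complex.I)) (Complex.exp_ne_zero _)
    (m := fun e ↦ |sin (e * (θ / 2))| / 2) (fun e he ↦ by have := hθ e he; positivity)
    (fun e he ↦ by
      rw [hn]
      have := abs_nonneg (sin (e * (θ / 2)))
      linarith)
    (fun e he ↦ by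
      rw [hn]
      have h1 := abs_sin_le_one (e * (θ / 2))
      have h2 := abs_pos.2 (hθ e he)
      rw [inv_div, le_div_iff₀ h2]
      nlinarith)
  rw [hx, norm_aeval_ofReal, Complex.norm_exp_ofReal_mul_I, one_pow, mul_one] at key
  exact key

/-- For |z| = q each |z^e - 1| lies between 1 - q and 1 + q ≤ 1/(1 - q). The parameter r = ±q covers
both outer rays. -/
lemma outer_bounds (h : IsCycloQuotient p d A B) {q r : ℝ} (hq : q ∈ Ioo (0 : ℝ) 1)
    (hr : |r| = q) :
    (1 - q) ^ (A ∪ B).card ≤ |p.eval (r + r⁻¹)| * q ^ d ∧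
      |p.eval (r + r⁻¹)| * q ^ d ≤ ((1 - q) ^ (A ∪ B).card)⁻¹ := by
  obtain ⟨hq0, hq1⟩ := hq
  have hr0 : (r : ℂ) ≠ 0 := by
    rw [Complex.ofReal_ne_zero]
    rintro rfl
    simp at hr
    linarith
  have hpow : ∀ e ∈ A ∪ B, ‖(r : ℂ) ^ e‖ ≤ q := by
    intro e he
    rw [norm_pow, Complex.norm_real, norm_eq_abs, hr]
    exact pow_le_of_le_one hq0.le hq1.le (h.pos e he).ne'
  have key := h.bounds (z := (r : ℂ)) hr0 (m := fun _ ↦ 1 - q) (fun e he ↦ by linarith)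
    (fun e he ↦ by
      have := norm_sub_norm_le (1 : ℂ) ((r : ℂ) ^ e)
      rw [norm_sub_rev, norm_one] at this
      linarith [hpow e he])
    (fun e he ↦ by
      have h1 := norm_sub_le ((r : ℂ) ^ e) 1
      rw [norm_one] at h1
      have h2 : 1 + q ≤ (1 - q)⁻¹ := by
        rw [← one_div, le_div_iff₀ (by linarith)]
        nlinarith
      linarith [hpow e he])
  have hx : (r : ℂ) + (r : ℂ)⁻¹ = ((r + r⁻¹ : ℝ) : ℂ) := by push_cast; rfl
  rw [hx, norm_aeval_ofReal, Complex.norm_real, norm_eq_abs, hr, Finset.prod_const] at key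
  exact key

variable {s : ℝ}

lemma inner_integral (h : IsCycloQuotient p d A B) (hE : (A ∪ B).Nonempty)
    (hs : s = 2 / (d : ℝ) * (A ∪ B).card) (hs1 : s ≤ 1 / 2) :
    ∫⁻ θ in Ioo 0 π, ENNReal.ofReal (2 * sin θ) * ENNReal.ofReal (|p.eval (2 * cos θ)| ^
        (-(2 / (d : ℝ)))) ≤ ENNReal.ofReal (2 ^ s * (4 + 2 * s * 2 * (2 * sinInt (1 / 2)))) ∧
    ENNReal.ofReal (2 * 4) ≤ (∫⁻ θ in Ioo 0 π, ENNReal.ofReal (2 * sin θ) *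
      ENNReal.ofReal (|p.eval (2 * cos θ)| ^ (-(2 / (d : ℝ))))) +
        ENNReal.ofReal (2 ^ s * (4 + 2 * s * 2 * (2 * sinInt (1 / 2)))) := by
  set μ := volume.restrict (Ioo 0 π) with hμ
  set R : ℝ → ℝ := fun θ ↦ ((A ∪ B).card : ℝ)⁻¹ *
    ∑ e ∈ A ∪ B, |sin (e * (θ / 2))| ^ (-(1 / 2 : ℝ)) with hRdef
  have hs0 : 0 ≤ s := by rw [hs]; positivity
  have hK : (0 : ℝ) < (A ∪ B).card := by exact_mod_cast hE.card_pos
  have hG : ∀ᵐ θ ∂μ, 0 < |p.eval (2 * cos θ)| ^ (-(2 / (d : ℝ))) ∧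
      |p.eval (2 * cos θ)| ^ (-(2 / (d : ℝ))) ≤ 2 ^ s * (1 + 2 * s * R θ) ∧
      (|p.eval (2 * cos θ)| ^ (-(2 / (d : ℝ))))⁻¹ ≤ 2 ^ s * (1 + 2 * s * R θ) := by
    filter_upwards [ae_restrict_of_ae (ae_sin_ne_zero _ h.pos)] with θ hθ
    obtain ⟨h1, h2⟩ := h.inner_bounds hθ
    have hy : ∀ e ∈ A ∪ B, 0 < |sin (e * (θ / 2))| := fun e he ↦ abs_pos.2 (hθ e he)
    have hL : 0 < ∏ e ∈ A ∪ B, |sin (e * (θ / 2))| / 2 :=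
      Finset.prod_pos fun e he ↦ by have := hy e he; positivity
    obtain ⟨h3, h4, h5⟩ := rpow_neg_bounds hL h1 h2 (σ := 2 / (d : ℝ)) (by positivity)
    have h6 := prod_rpow_neg_le hE hy (σ := 2 / (d : ℝ)) (by positivity) hs hs1
    exact ⟨h3, h4.trans h6, h5.trans h6⟩
  have hw : ∀ᵐ θ ∂μ, 0 ≤ 2 * sin θ ∧ 2 * sin θ ≤ 2 := by
    refine (ae_restrict_iff' measurableSet_Ioo).2 (Filter.Eventually.of_forall fun θ hθ ↦ ?_)
    have := sin_pos_of_mem_Ioo hθ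
    exact ⟨by positivity, by linarith [sin_le_one θ]⟩
  have hR : ∀ᵐ θ ∂μ, 0 ≤ R θ := Filter.Eventually.of_forall fun θ ↦ by
    simp only [hRdef]; positivity
  have hRi : ∫⁻ θ, ENNReal.ofReal (R θ) ∂μ ≤ ENNReal.ofReal (2 * sinInt (1 / 2)) := by
    have e1 : ∀ θ, ENNReal.ofReal (R θ) = ENNReal.ofReal ((A ∪ B).card : ℝ)⁻¹ *
        ∑ e ∈ A ∪ B, ENNReal.ofReal (|sin (e * (θ / 2))| ^ (-(1 / 2 : ℝ))) := by
      intro θ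
      rw [hRdef, ENNReal.ofReal_mul (by positivity),
        ENNReal.ofReal_sum_of_nonneg fun e _ ↦ by positivity]
    simp only [e1]
    rw [lintegral_const_mul' _ _ ENNReal.ofReal_ne_top,
      lintegral_finsetSum _ fun e _ ↦ by fun_prop]
    calc _ ≤ ENNReal.ofReal ((A ∪ B).card : ℝ)⁻¹ *
          ∑ e ∈ A ∪ B, ENNReal.ofReal (2 * sinInt (1 / 2)) := by
          gcongr with e he
          exact lintegral_inner_singular (h.pos e he)
      _ = _ := by
          rw [Finset.sum_const, nsmul_eq_mul, ← mul_assoc, ← ENNReal.ofReal_natCast,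
            ← ENNReal.ofReal_mul (by positivity), inv_mul_cancel₀ hK.ne', ENNReal.ofReal_one,
            one_mul]
  have hJ := sinInt_nonneg (1 / 2)
  have hcong : ∫⁻ θ, ENNReal.ofReal (2 * sin θ) * ENNReal.ofReal (|p.eval (2 * cos θ)| ^
      (-(2 / (d : ℝ)))) ∂μ = ∫⁻ θ, ENNReal.ofReal (2 * sin θ *
        |p.eval (2 * cos θ)| ^ (-(2 / (d : ℝ)))) ∂μ := by
    refine lintegral_congr_ae ?_
    filter_upwards [hw] with θ hθ
    rw [ENNReal.ofReal_mul hθ.1]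
  have hpm : Measurable fun θ ↦ p.eval (2 * cos θ) :=
    (p.continuous.comp (by fun_prop : Continuous fun θ : ℝ ↦ 2 * cos θ)).measurable
  rw [hcong]
  exact ⟨lintegral_mul_near_one (by positivity) (by positivity) two_pos.le (by norm_num)
      (by positivity) (by fun_prop) hw hR (hG.mono fun θ h ↦ ⟨h.1.le, h.2.1⟩)
      lintegral_inner_weight hRi,
    le_lintegral_mul_near_one (by positivity) (by positivity) two_pos.le (by norm_num)
      (by positivity) (by fun_prop) (by fun_prop) hw hR (hG.mono fun θ h ↦ ⟨h.1, h.2.2⟩)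
      lintegral_inner_weight hRi⟩

lemma outer_integral (h : IsCycloQuotient p d A B) (hd : d ≠ 0)
    (hs : s = 2 / (d : ℝ) * (A ∪ B).card) (hs1 : s ≤ 1 / 2) {x : ℝ → ℝ}
    (hx : ∀ q ∈ Ioo (0 : ℝ) 1, ∃ r : ℝ, |r| = q ∧ x q = r + r⁻¹) (hxm : Measurable x) :
    ∫⁻ q in Ioo (0 : ℝ) 1, ENNReal.ofReal ((q ^ 2)⁻¹ - 1) * ENNReal.ofReal (|p.eval (x q)| ^
        (-(2 / (d : ℝ)))) ≤ ENNReal.ofReal (1 * (2 / 3 + 2 * s * 1 * 2)) ∧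
    ENNReal.ofReal (2 * (2 / 3)) ≤ (∫⁻ q in Ioo (0 : ℝ) 1, ENNReal.ofReal ((q ^ 2)⁻¹ - 1) *
      ENNReal.ofReal (|p.eval (x q)| ^ (-(2 / (d : ℝ))))) +
        ENNReal.ofReal (1 * (2 / 3 + 2 * s * 1 * 2)) := by
  set μ := volume.restrict (Ioo (0 : ℝ) 1) with hμ
  have hs0 : 0 ≤ s := by rw [hs]; positivity
  have hd' : (d : ℝ) ≠ 0 := by exact_mod_cast hd
  have hmem : ∀ᵐ q ∂μ, q ∈ Ioo (0 : ℝ) 1 := ae_restrict_mem measurableSet_Ioo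
  have hG : ∀ᵐ q ∂μ, 0 < (|p.eval (x q)| * q ^ d) ^ (-(2 / (d : ℝ))) ∧
      (|p.eval (x q)| * q ^ d) ^ (-(2 / (d : ℝ))) ≤
        1 * (1 + 2 * s * (1 - q) ^ (-(1 / 2 : ℝ))) ∧
      ((|p.eval (x q)| * q ^ d) ^ (-(2 / (d : ℝ))))⁻¹ ≤
        1 * (1 + 2 * s * (1 - q) ^ (-(1 / 2 : ℝ))) := by
    filter_upwards [hmem] with q hq
    obtain ⟨r, hr, hxr⟩ := hx q hq
    obtain ⟨h1, h2⟩ := h.outer_bounds hq hr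
    rw [← hxr] at h1 h2
    have hq1 : 0 < 1 - q := by linarith [hq.2]
    obtain ⟨h3, h4, h5⟩ := rpow_neg_bounds (by positivity) h1 h2 (σ := 2 / (d : ℝ)) (by positivity)
    have h6 : ((1 - q) ^ (A ∪ B).card) ^ (-(2 / (d : ℝ))) ≤
        1 * (1 + 2 * s * (1 - q) ^ (-(1 / 2 : ℝ))) := by
      rw [← rpow_natCast, ← rpow_mul hq1.le, one_mul,
        show ((A ∪ B).card : ℝ) * -(2 / (d : ℝ)) = -s by rw [hs]; ring]
      exact rpow_neg_le_one_add hq1 hs0 hs1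
    exact ⟨h3, h4.trans h6, h5.trans h6⟩
  have hw : ∀ᵐ q ∂μ, 0 ≤ 1 - q ^ 2 ∧ 1 - q ^ 2 ≤ 1 := by
    filter_upwards [hmem] with q hq
    exact ⟨by nlinarith [hq.1, hq.2], by nlinarith [hq.1, hq.2]⟩
  have hR : ∀ᵐ q ∂μ, 0 ≤ (1 - q) ^ (-(1 / 2 : ℝ)) := by
    filter_upwards [hmem] with q hq
    have hq1 : 0 < 1 - q := by linarith [hq.2]
    positivity
  -- Since (q^d)^(-2/d) = q^(-2), the growth of p removes the singular factor of the Jacobian and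
  -- leaves the weight 1 - q^2.
  have hcong : ∫⁻ q, ENNReal.ofReal ((q ^ 2)⁻¹ - 1) * ENNReal.ofReal (|p.eval (x q)| ^
      (-(2 / (d : ℝ)))) ∂μ = ∫⁻ q, ENNReal.ofReal ((1 - q ^ 2) *
        (|p.eval (x q)| * q ^ d) ^ (-(2 / (d : ℝ)))) ∂μ := by
    refine lintegral_congr_ae ?_
    filter_upwards [hmem] with q hq
    have hq0 := hq.1
    have h1 : 0 ≤ (q ^ 2)⁻¹ - 1 := by
      rw [sub_nonneg, one_le_inv₀ (by positivity)]
      nlinarith [hq.1, hq.2]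
    rw [← ENNReal.ofReal_mul h1, mul_rpow (abs_nonneg _) (by positivity), ← rpow_natCast q d,
      ← rpow_mul hq0.le, mul_neg, mul_div_cancel₀ _ hd', rpow_neg hq0.le, rpow_two]
    congr 1
    field_simp
  have hpm : Measurable fun q ↦ p.eval (x q) := p.continuous.measurable.comp hxm
  rw [hcong]
  exact ⟨lintegral_mul_near_one (by positivity) zero_le_one zero_le_one (by norm_num)
      (by norm_num) (by fun_prop) hw hR (hG.mono fun θ h ↦ ⟨h.1.le, h.2.1⟩)
      lintegral_outer_weight lintegral_outer_singular.le,
    le_lintegral_mul_near_one (by positivity) zero_le_one zero_le_one (by norm_num)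
      (by norm_num) (by fun_prop) (by fun_prop) hw hR (hG.mono fun θ h ↦ ⟨h.1, h.2.2⟩)
      lintegral_outer_weight lintegral_outer_singular.le⟩

/-- The integral of the limiting function is 4 + 2/3 + 2/3 = 16/3, twice which is 32/3. As
`cycloBound` takes the value 16/3 at 0, both bounds close up when s tends to 0. -/
theorem areaInt_bounds (h : IsCycloQuotient p d A B) (hE : (A ∪ B).Nonempty) (hd : d ≠ 0)
    (hs : s = 2 / (d : ℝ) * (A ∪ B).card) (hs1 : s ≤ 1 / 2) :
    areaInt p (2 / d) ≤ ENNReal.ofReal (cycloBound s) ∧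
      ENNReal.ofReal (32 / 3 - cycloBound s) ≤ areaInt p (2 / d) := by
  obtain ⟨i1, i2⟩ := h.inner_integral hE hs hs1
  obtain ⟨o1, o2⟩ := h.outer_integral hd hs hs1 (x := fun q ↦ q + q⁻¹)
    (fun q hq ↦ ⟨q, abs_of_pos hq.1, rfl⟩) (by fun_prop)
  obtain ⟨u1, u2⟩ := h.outer_integral hd hs hs1 (x := fun q ↦ -(q + q⁻¹))
    (fun q hq ↦ ⟨-q, by rw [abs_neg, abs_of_pos hq.1], by rw [inv_neg]; ring⟩) (by fun_prop)
  have hs0 : 0 ≤ s := by rw [hs]; positivity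
  have hJ := sinInt_nonneg (1 / 2)
  have hsplit : ENNReal.ofReal (cycloBound s) =
      ENNReal.ofReal (2 ^ s * (4 + 2 * s * 2 * (2 * sinInt (1 / 2)))) +
        ENNReal.ofReal (1 * (2 / 3 + 2 * s * 1 * 2)) +
        ENNReal.ofReal (1 * (2 / 3 + 2 * s * 1 * 2)) := by
    rw [← ENNReal.ofReal_add (by positivity) (by positivity),
      ← ENNReal.ofReal_add (by positivity) (by positivity), cycloBound]
    congr 1
    ring
  have hc0 : 0 ≤ cycloBound s := by rw [cycloBound]; positivity
  rw [areaInt, lintegral_joukowski]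
  refine ⟨?_, ?_⟩
  · rw [hsplit]
    exact add_le_add (add_le_add i1 o1) u1
  · rw [ENNReal.ofReal_sub _ hc0, tsub_le_iff_right, hsplit]
    have h3 := add_le_add (add_le_add i2 o2) u2
    rw [← ENNReal.ofReal_add (by positivity) (by positivity),
      ← ENNReal.ofReal_add (by positivity) (by positivity)] at h3
    rw [show (32 / 3 : ℝ) = 2 * 4 + 2 * (2 / 3) + 2 * (2 / 3) by norm_num]
    refine h3.trans (le_of_eq ?_)
    ring

end IsCycloQuotient

lemma tendsto_cycloBound : Filter.Tendsto cycloBound (nhds 0) (nhds (16 / 3)) := by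
  have h : Continuous cycloBound := by
    unfold cycloBound
    have : Continuous fun s : ℝ ↦ (2 : ℝ) ^ s := continuous_const_rpow two_ne_zero
    fun_prop
  have h0 := h.tendsto 0
  have : cycloBound 0 = 16 / 3 := by norm_num [cycloBound]
  rwa [this] at h0

theorem tendsto_areaInt {ι : Type*} {l : Filter ι} {p : ι → Polynomial ℝ} {d : ι → ℕ}
    {A B : ι → Finset ℕ} (h : ∀ᶠ i in l, IsCycloQuotient (p i) (d i) (A i) (B i))
    (hE : ∀ᶠ i in l, (A i ∪ B i).Nonempty) (hd : ∀ᶠ i in l, d i ≠ 0)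
    (hs : Filter.Tendsto (fun i ↦ 2 / (d i : ℝ) * (A i ∪ B i).card) l (nhds 0)) :
    Filter.Tendsto (fun i ↦ areaInt (p i) (2 / d i)) l (nhds (16 / 3)) := by
  have h163 : (16 / 3 : ENNReal) = ENNReal.ofReal (16 / 3) := by
    rw [ENNReal.ofReal_div_of_pos (by norm_num)]
    norm_num
  have hb := tendsto_cycloBound.comp hs
  have hup := ENNReal.tendsto_ofReal hb
  have hlow := ENNReal.tendsto_ofReal (hb.const_sub (32 / 3))
  rw [show (32 / 3 - 16 / 3 : ℝ) = 16 / 3 by norm_num] at hlow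
  have hev := hs.eventually (eventually_le_nhds (by norm_num : (0 : ℝ) < 1 / 2))
  rw [h163]
  refine tendsto_of_tendsto_of_tendsto_of_le_of_le' hlow hup ?_ ?_
  · filter_upwards [h, hE, hd, hev] with i h hE hd hi
    exact (h.areaInt_bounds hE hd rfl hi).2
  · filter_upwards [h, hE, hd, hev] with i h hE hd hi
    exact (h.areaInt_bounds hE hd rfl hi).1

end BinaryForm

end

/-! ### Limits and exact expressions of Q for the Chebyshev forms -/

noncomputable section

namespace BinaryForm

open MeasureTheory Set Real Filter

section Joukowski

variable {K : Type*} [Field K] {z : K}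

lemma eval_C_add_inv (hz : z ≠ 0) (n : ℕ) :
    (Polynomial.Chebyshev.C K n).eval (z + z⁻¹) = z ^ n + z⁻¹ ^ n := by
  induction n using Nat.twoStepInduction with
  | zero => norm_num
  | one => simp
  | more n h0 h1 =>
    push_cast at *
    rw [Polynomial.Chebyshev.C_add_two]
    simp only [Polynomial.eval_sub, Polynomial.eval_mul, Polynomial.eval_X, h0, h1]
    have e : z * z⁻¹ = 1 := mul_inv_cancel₀ hz
    linear_combination (z ^ n + z⁻¹ ^ n) * e

lemma eval_S_add_inv (hz : z ≠ 0) (n : ℕ) :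
    (Polynomial.Chebyshev.S K n).eval (z + z⁻¹) * z ^ n = ∑ k ∈ Finset.range (n + 1), (z ^ 2) ^ k := by
  induction n using Nat.twoStepInduction with
  | zero => simp
  | one =>
    simp [Finset.sum_range_succ]
    field_simp
    ring
  | more n h0 h1 =>
    push_cast at *
    rw [Polynomial.Chebyshev.S_add_two]
    simp only [Polynomial.eval_sub, Polynomial.eval_mul, Polynomial.eval_X]
    rw [sub_mul, pow_add, ← mul_assoc, ← mul_assoc _ (z ^ n), h0]
    rw [Finset.sum_range_succ] at h1
    rw [Finset.sum_range_succ _ (n + 2), Finset.sum_range_succ _ (n + 1)]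
    have e : (z + z⁻¹) * Polynomial.eval (z + z⁻¹) (Polynomial.Chebyshev.S K (n + 1)) * z ^ n * z ^ 2
        = (z ^ 2 + 1) * (Polynomial.eval (z + z⁻¹) (Polynomial.Chebyshev.S K (n + 1)) * z ^ (n + 1)) := by
      field_simp
      ring
    rw [e, h1]
    ring

end Joukowski

/-- z^n C_n(z + 1/z) = z^(2n) + 1 = (z^(4n) - 1)/(z^(2n) - 1). -/
lemma isCycloQuotient_C {n : ℕ} (hn : n ≠ 0) :
    IsCycloQuotient (Polynomial.Chebyshev.C ℝ n) n {4 * n} {2 * n} where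
  disjoint := by simp; omega
  pos := by
    intro e he
    simp at he
    omega
  norm_eq := by
    intro z hz
    rw [Finset.prod_singleton, Finset.prod_singleton, Polynomial.Chebyshev.aeval_C,
      eval_C_add_inv hz, ← norm_pow, ← norm_mul, ← norm_mul]
    congr 1
    rw [inv_pow]
    field_simp
    ring

lemma isCycloQuotient_S {n : ℕ} (hn : n ≠ 0) :
    IsCycloQuotient (Polynomial.Chebyshev.S ℝ n) n {2 * (n + 1)} {2} where
  disjoint := by simp; omega
  pos := by
    intro e he
    simp at he
    omega
  norm_eq := by
    intro z hz
    rw [Finset.prod_singleton, Finset.prod_singleton, Polynomial.Chebyshev.aeval_S,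
      ← norm_pow, ← norm_mul, eval_S_add_inv hz, ← norm_mul, geom_sum_mul, pow_mul]

lemma tendsto_areaInt_C :
    Tendsto (fun n : ℕ ↦ areaInt (Polynomial.Chebyshev.C ℝ n) (2 / n)) atTop (nhds (16 / 3)) := by
  refine tendsto_areaInt (A := fun n ↦ {4 * n}) (B := fun n ↦ {2 * n})
    ((eventually_ne_atTop 0).mono fun n hn ↦ isCycloQuotient_C hn)
    (.of_forall fun n ↦ by simp) (eventually_ne_atTop 0) ?_
  refine squeeze_zero (g := fun n : ℕ ↦ 4 / (n : ℝ)) (fun n ↦ by positivity) (fun n ↦ ?_)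
    (tendsto_const_div_atTop_nhds_zero_nat 4)
  have : (({4 * n} ∪ {2 * n} : Finset ℕ).card : ℝ) ≤ 2 := by
    exact_mod_cast Finset.card_union_le _ _
  calc _ ≤ 2 / (n : ℝ) * 2 := by gcongr
    _ = _ := by ring

lemma tendsto_areaInt_S :
    Tendsto (fun n : ℕ ↦ areaInt (Polynomial.Chebyshev.S ℝ n) (2 / n)) atTop (nhds (16 / 3)) := by
  refine tendsto_areaInt (A := fun n ↦ {2 * (n + 1)}) (B := fun _ ↦ {2})
    ((eventually_ne_atTop 0).mono fun n hn ↦ isCycloQuotient_S hn)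
    (.of_forall fun n ↦ by simp) (eventually_ne_atTop 0) ?_
  refine squeeze_zero (g := fun n : ℕ ↦ 4 / (n : ℝ)) (fun n ↦ by positivity) (fun n ↦ ?_)
    (tendsto_const_div_atTop_nhds_zero_nat 4)
  have : (({2 * (n + 1)} ∪ {2} : Finset ℕ).card : ℝ) ≤ 2 := by
    exact_mod_cast Finset.card_union_le _ _
  calc _ ≤ 2 / (n : ℝ) * 2 := by gcongr
    _ = _ := by ring

lemma disc_T_ne_zero {n : ℕ} (hn : 2 ≤ n) : disc (T n) ≠ 0 := by
  rw [← abs_pos, abs_disc_T hn]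
  positivity

lemma disc_U_ne_zero {n : ℕ} (hn : 2 ≤ n) : disc (U n) ≠ 0 := by
  rw [← abs_pos, abs_disc_U hn]
  positivity

lemma disc_S_ne_zero {n : ℕ} (hn : 2 ≤ n) : disc (S n) ≠ 0 := by
  have := sConst_pos n
  rw [← abs_pos, abs_disc_S hn]
  positivity

lemma totalDegree_S {n : ℕ} (hn : 2 ≤ n) : (S n).totalDegree = n :=
  (isHomogeneous_S n).totalDegree fun h ↦ dehom_S_ne_zero hn (by rw [h, dehom, map_zero])

lemma Q_T {n : ℕ} (hn : 2 ≤ n) : Q (T n) =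
    ENNReal.ofReal ((n : ℝ) ^ (1 / ((n : ℝ) - 1)) * 2 ^ (1 / (n : ℝ))) *
      areaInt (Polynomial.Chebyshev.C ℝ n) (2 / n) := by
  have h2 : (2 : ℝ) ≤ n := by exact_mod_cast hn
  have h1 : (n : ℝ) - 1 ≠ 0 := by linarith
  have h0 : (n : ℝ) ≠ 0 := by linarith
  rw [Q, totalDegree_T, area_T (by omega), abs_disc_T hn, ← mul_assoc,
    ← ENNReal.ofReal_mul (by positivity)]
  congr 2
  rw [mul_rpow (by positivity) (by positivity), ← rpow_natCast, ← rpow_natCast,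
    ← rpow_mul (by positivity), ← rpow_mul (by positivity), mul_right_comm,
    ← rpow_add two_pos, mul_comm]
  push_cast [Nat.cast_sub (by omega : 1 ≤ n)]
  congr 2 <;> field_simp
  ring

lemma Q_U {n : ℕ} (hn : 2 ≤ n) : Q (U n) =
    ENNReal.ofReal (2 ^ (1 / ((n : ℝ) - 1)) *
      ((n : ℝ) + 1) ^ (((n : ℝ) - 2) / (n * ((n : ℝ) - 1)))) *
      areaInt (Polynomial.Chebyshev.S ℝ n) (2 / n) := by
  have h2 : (2 : ℝ) ≤ n := by exact_mod_cast hn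
  have h1 : (n : ℝ) - 1 ≠ 0 := by linarith
  have h0 : (n : ℝ) ≠ 0 := by linarith
  have e : (1 / 2 : ℝ) = 2 ^ (-1 : ℝ) := by rw [rpow_neg_one]; norm_num
  rw [Q, totalDegree_U, area_U (by omega), abs_disc_U hn, ← mul_assoc,
    ← ENNReal.ofReal_mul (by positivity)]
  congr 2
  rw [mul_rpow (by positivity) (by positivity), ← rpow_natCast, ← rpow_natCast,
    ← rpow_mul (by positivity), ← rpow_mul (by positivity), mul_right_comm, e,
    ← rpow_add two_pos]
  push_cast [Nat.cast_sub hn]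
  congr 2 <;> field_simp
  ring

lemma Q_S {n : ℕ} (hn : 3 ≤ n) : Q (S n) =
    ENNReal.ofReal ((n : ℝ) ^ (1 / ((n : ℝ) - 1)) * 2 ^ (1 - 2 / (n : ℝ)) * sinInt (2 / n)) := by
  have h2 : (3 : ℝ) ≤ n := by exact_mod_cast hn
  have h1 : (n : ℝ) - 1 ≠ 0 := by linarith
  have h0 : (n : ℝ) ≠ 0 := by linarith
  have hκ := sConst_pos n
  rw [Q, totalDegree_S (by omega), area_S hn, abs_disc_S (by omega),
    ← ENNReal.ofReal_mul (by positivity)]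
  rw [← mul_assoc]
  congr 2
  rw [mul_rpow (by positivity) (by positivity), mul_rpow (by positivity) (by positivity),
    ← rpow_natCast, ← rpow_natCast, ← rpow_natCast, ← rpow_mul (by positivity),
    ← rpow_mul (by positivity), ← rpow_mul (by positivity)]
  push_cast [Nat.cast_sub (by omega : 2 ≤ n), Nat.cast_sub (by omega : 1 ≤ n)]
  have e1 : 2 * ((n : ℝ) - 1) * (1 / (n * (n - 1))) = 2 / n := by field_simp
  have e2 : (n : ℝ) * (1 / (n * (n - 1))) = 1 / (n - 1) := by field_simp
  have e3 : ((n : ℝ) - 1) * (n - 2) * (1 / (n * (n - 1))) = 1 - 2 / n := by field_simp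
  rw [e1, e2, e3]
  -- Q is invariant under scaling of the form, so the power of 2 in `S` plays no role.
  have e4 : sConst n ^ (2 / (n : ℝ)) * sConst n ^ (-(2 / (n : ℝ))) = 1 := by
    rw [← rpow_add hκ, add_neg_cancel, rpow_zero]
  linear_combination ((n : ℝ) ^ (1 / ((n : ℝ) - 1)) * 2 ^ (1 - 2 / (n : ℝ))) * e4

lemma Q_S_ne_top {n : ℕ} (hn : 3 ≤ n) : Q (S n) ≠ ⊤ := by
  rw [Q_S hn]
  exact ENNReal.ofReal_ne_top

lemma tendsto_ofReal_mul {ι : Type*} {l : Filter ι} {c : ι → ℝ} {f : ι → ENNReal} {x : ENNReal}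
    (hx : x ≠ 0) (hc : Tendsto c l (nhds 1)) (hf : Tendsto f l (nhds x)) :
    Tendsto (fun i ↦ ENNReal.ofReal (c i) * f i) l (nhds x) := by
  have := ENNReal.Tendsto.mul (ENNReal.tendsto_ofReal hc) (Or.inl (by simp)) hf (Or.inl hx)
  simpa using this

lemma tendsto_Q_T : Tendsto (fun n : ℕ ↦ Q (T n)) atTop (nhds (16 / 3)) := by
  have h1 : Tendsto (fun n : ℕ ↦ (n : ℝ) ^ (1 / ((n : ℝ) - 1))) atTop (nhds 1) := by
    have := (tendsto_rpow_div_mul_add 1 1 (-1) zero_ne_one).comp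
      (tendsto_natCast_atTop_atTop (R := ℝ))
    refine this.congr fun n ↦ ?_
    simp [sub_eq_add_neg]
  have h2 : Tendsto (fun n : ℕ ↦ (2 : ℝ) ^ (1 / (n : ℝ))) atTop (nhds 1) := by
    simpa using tendsto_const_nhds.rpow (tendsto_const_div_atTop_nhds_zero_nat (1 : ℝ))
      (Or.inl (two_ne_zero' ℝ))
  refine (tendsto_ofReal_mul (by simp) (by simpa only [mul_one] using h1.mul h2) tendsto_areaInt_C).congr' ?_
  filter_upwards [eventually_ge_atTop 2] with n hn
  rw [Q_T hn]

lemma tendsto_Q_U : Tendsto (fun n : ℕ ↦ Q (U n)) atTop (nhds (16 / 3)) := by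
  have h1 : Tendsto (fun n : ℕ ↦ (2 : ℝ) ^ (1 / ((n : ℝ) - 1))) atTop (nhds 1) := by
    have h : Tendsto (fun n : ℕ ↦ 1 / ((n : ℝ) - 1)) atTop (nhds 0) :=
      tendsto_const_nhds.div_atTop
        (tendsto_atTop_add_const_right _ (-1) (tendsto_natCast_atTop_atTop (R := ℝ)))
    simpa using tendsto_const_nhds.rpow h (Or.inl (two_ne_zero' ℝ))
  have h2 : Tendsto (fun n : ℕ ↦ ((n : ℝ) + 1) ^ (((n : ℝ) - 2) / (n * ((n : ℝ) - 1)))) atTop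
      (nhds 1) := by
    have h3 : Tendsto (fun n : ℕ ↦ ((n : ℝ) + 1) ^ (1 / (n : ℝ))) atTop (nhds 1) := by
      have := (tendsto_rpow_div_mul_add 1 1 (-1) zero_ne_one).comp
        (tendsto_atTop_add_const_right _ 1 (tendsto_natCast_atTop_atTop (R := ℝ)))
      refine this.congr fun n ↦ ?_
      simp
    refine tendsto_of_tendsto_of_tendsto_of_le_of_le' tendsto_const_nhds h3 ?_ ?_ <;>
      filter_upwards [eventually_ge_atTop 2] with n hn
    all_goals
      have h2 : (2 : ℝ) ≤ n := by exact_mod_cast hn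
      have h1 : 0 < (n : ℝ) - 1 := by linarith
    · exact one_le_rpow (by linarith) (div_nonneg (by linarith) (by positivity))
    · refine rpow_le_rpow_of_exponent_le (by linarith) ?_
      rw [div_le_div_iff₀ (by positivity) (by positivity)]
      nlinarith
  refine (tendsto_ofReal_mul (by simp) (by simpa only [mul_one] using h1.mul h2) tendsto_areaInt_S).congr' ?_
  filter_upwards [eventually_ge_atTop 2] with n hn
  rw [Q_U hn]

end BinaryForm

end

/-! ### Means of powers of sin over translates, and a sharper outer part -/

noncomputable section

namespace BinaryForm

open MeasureTheory Set Real

lemma sin_pi_div_two_mul_pos {N : ℕ} (hN : 0 < N) : 0 < sin (π / (2 * N)) := by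
  have hN' : (1 : ℝ) ≤ N := by exact_mod_cast hN
  have := pi_pos
  apply sin_pos_of_pos_of_lt_pi (by positivity)
  rw [div_lt_iff₀ (by positivity)]
  nlinarith

lemma sum_cos_add_mul (φ δ : ℝ) (N : ℕ) :
    (∑ k ∈ Finset.range N, cos (φ + k * δ)) * (2 * sin (δ / 2)) =
      sin (φ + N * δ - δ / 2) - sin (φ - δ / 2) := by
  induction N with
  | zero => simp
  | succ N ih =>
    have h : cos (φ + N * δ) * (2 * sin (δ / 2)) =
        sin (φ + N * δ + δ / 2) - sin (φ + N * δ - δ / 2) := by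
      rw [sin_add, sin_sub]
      ring
    rw [Finset.sum_range_succ, add_mul, ih, h]
    push_cast
    have e : φ + (N + 1) * δ - δ / 2 = φ + N * δ + δ / 2 := by ring
    rw [e]
    ring

/-- The sum telescopes to a single sine over sin(π/(2N)). For sin² and sin⁴ the corresponding means
are exactly 1/2 and 3/8, because the oscillating terms run over full turns. -/
lemma sum_sin_add_mul_le {N : ℕ} (hN : 0 < N) (θ : ℝ) :
    ∑ k ∈ Finset.range N, sin (θ + k * π / N) ≤ (sin (π / (2 * N)))⁻¹ := by
  have hN' : (1 : ℝ) ≤ N := by exact_mod_cast hN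
  have hpos := sin_pi_div_two_mul_pos hN
  have h := sum_cos_add_mul (θ - π / 2) (π / N) N
  have e1 : ∀ k : ℕ, cos (θ - π / 2 + k * (π / N)) = sin (θ + k * π / N) := by
    intro k
    rw [← cos_sub_pi_div_two]
    congr 1
    ring
  have e2 : π / N / 2 = π / (2 * N) := by ring
  have e3 : θ - π / 2 + N * (π / N) - π / (2 * N) = θ - π / 2 - π / (2 * N) + π := by
    rw [mul_div_cancel₀ _ (by positivity)]
    ring
  simp only [e1, e2] at h
  rw [e3, sin_add_pi] at h
  rw [← mul_one (sin (π / (2 * N)))⁻¹, ← div_eq_inv_mul, le_div_iff₀ hpos]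
  have := neg_one_le_sin (θ - π / 2 - π / (2 * N))
  linarith

lemma sum_cos_full_turn {N j : ℕ} (hj : 0 < j) (hjN : j < N) (φ : ℝ) :
    ∑ k ∈ Finset.range N, cos (φ + k * (2 * j * π / N)) = 0 := by
  have hN' : (0 : ℝ) < N := by exact_mod_cast hj.trans hjN
  have hj' : (0 : ℝ) < j := by exact_mod_cast hj
  have hjN' : (j : ℝ) < N := by exact_mod_cast hjN
  have hpos : 0 < sin (2 * j * π / N / 2) := by
    have := pi_pos
    apply sin_pos_of_pos_of_lt_pi (by positivity)
    rw [div_div, div_lt_iff₀ (by positivity)]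
    nlinarith
  have h := sum_cos_add_mul φ (2 * j * π / N) N
  have e : φ + N * (2 * j * π / N) - 2 * j * π / N / 2 =
      φ - 2 * j * π / N / 2 + j * (2 * π) := by
    rw [mul_div_cancel₀ _ hN'.ne']
    ring
  rw [e, sin_add_nat_mul_two_pi, sub_self] at h
  exact (mul_eq_zero.1 h).resolve_right (by positivity)

lemma sum_sin_sq {N : ℕ} (hN : 2 ≤ N) (θ : ℝ) :
    ∑ k ∈ Finset.range N, sin (θ + k * π / N) ^ 2 = N / 2 := by
  have h := sum_cos_full_turn one_pos (by omega : 1 < N) (2 * θ)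
  have e : ∀ k : ℕ, sin (θ + k * π / N) ^ 2 =
      1 / 2 - cos (2 * θ + k * (2 * (1 : ℕ) * π / N)) / 2 := by
    intro k
    rw [sin_sq_eq_half_sub]
    congr 3
    push_cast
    ring
  simp only [e, Finset.sum_sub_distrib, ← Finset.sum_div, h]
  simp

lemma sum_sin_pow_four {N : ℕ} (hN : 3 ≤ N) (θ : ℝ) :
    ∑ k ∈ Finset.range N, sin (θ + k * π / N) ^ 4 = 3 * N / 8 := by
  have h1 := sum_cos_full_turn one_pos (by omega : 1 < N) (2 * θ)
  have h2 := sum_cos_full_turn two_pos (by omega : 2 < N) (4 * θ)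
  have e : ∀ k : ℕ, sin (θ + k * π / N) ^ 4 =
      3 / 8 - cos (2 * θ + k * (2 * (1 : ℕ) * π / N)) / 2 +
        cos (4 * θ + k * (2 * (2 : ℕ) * π / N)) / 8 := by
    intro k
    have e1 : 2 * θ + k * (2 * (1 : ℕ) * π / N) = 2 * (θ + k * π / N) := by push_cast; ring
    have e2 : 4 * θ + k * (2 * (2 : ℕ) * π / N) = 2 * (2 * (θ + k * π / N)) := by push_cast; ring
    rw [e1, e2, cos_two_mul (2 * _), cos_two_mul]
    have := sin_sq (θ + k * π / N)
    have e3 : sin (θ + k * π / N) ^ 4 = (sin (θ + k * π / N) ^ 2) ^ 2 := by ring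
    rw [e3, this]
    ring
  simp only [e, Finset.sum_add_distrib, Finset.sum_sub_distrib, ← Finset.sum_div, h1, h2]
  simp
  ring

/-- A lower bound for `N * sin (π / (2 * N))`. -/
lemma le_mul_sin_pi_div {N : ℕ} (hN : 0 < N) :
    1.57075 - 0.64603 / (N : ℝ) ^ 2 ≤ N * sin (π / (2 * N)) := by
  have hN' : (0 : ℝ) < N := by exact_mod_cast hN
  have hpi := pi_pos
  have h := sin_gt_sub_cube (x := π / (2 * N)) (by positivity)
  have h1 := pi_gt_d4
  have h2 := pi_lt_d4
  have h3 : π ^ 3 ≤ 31.00944 := by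
    calc π ^ 3 ≤ 3.1416 ^ 3 := by gcongr
      _ ≤ _ := by norm_num
  calc 1.57075 - 0.64603 / (N : ℝ) ^ 2 ≤ π / 2 - π ^ 3 / 48 / (N : ℝ) ^ 2 := by
        gcongr
        · linarith
        · linarith
    _ = N * (π / (2 * N) - (π / (2 * N)) ^ 3 / 6) := by field_simp; ring
    _ ≤ _ := by gcongr

lemma lintegral_outer_weight_mul {κ : ℝ} (hκ : κ ≤ 1) :
    ∫⁻ q in Ioo (0 : ℝ) 1, ENNReal.ofReal ((1 - q ^ 2) * (1 - κ * q ^ 2)) =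
      ENNReal.ofReal (2 / 3 - 2 * κ / 15) := by
  have hc : Continuous fun q : ℝ ↦ (1 - q ^ 2) * (1 - κ * q ^ 2) := by fun_prop
  rw [← ofReal_integral_eq_lintegral_ofReal]
  · rw [← integral_Ioc_eq_integral_Ioo, ← intervalIntegral.integral_of_le zero_le_one]
    congr 1
    have e : ∀ q : ℝ, (1 - q ^ 2) * (1 - κ * q ^ 2) = (1 - (1 + κ) * q ^ 2) + κ * q ^ 4 := by
      intro q
      ring
    simp only [e]
    rw [intervalIntegral.integral_add (Continuous.intervalIntegrable (by fun_prop) _ _)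
      (Continuous.intervalIntegrable (by fun_prop) _ _),
      intervalIntegral.integral_sub (by simp) (Continuous.intervalIntegrable (by fun_prop) _ _),
      intervalIntegral.integral_const_mul, intervalIntegral.integral_const_mul, integral_pow,
      integral_pow]
    norm_num
    ring
  · exact hc.integrableOn_Icc.mono_set Ioo_subset_Icc_self
  · refine (ae_restrict_iff' measurableSet_Ioo).2 (Filter.Eventually.of_forall fun q hq ↦ ?_)
    have h1 : q ^ 2 ≤ 1 := by nlinarith [hq.1, hq.2]
    have h2 : κ * q ^ 2 ≤ 1 := by nlinarith [sq_nonneg q]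
    exact mul_nonneg (by linarith) (by linarith)

/-- The part of the integral of `|p| ^ (-2 / n)` outside `[-2, 2]`. -/
lemma areaInt_le {p : Polynomial ℝ} {n : ℕ} (hn : n ≠ 0) {κ : ℝ} (hκ : κ ≤ 1)
    (h : ∀ z : ℝ, z ≠ 0 → |z| < 1 →
      (|p.eval (z + z⁻¹)| * |z| ^ n) ^ (-(2 / (n : ℝ))) ≤ 1 - κ * z ^ 2) :
    areaInt p (2 / n) ≤ (∫⁻ θ in Ioo 0 π, ENNReal.ofReal (2 * sin θ) *
      ENNReal.ofReal (|p.eval (2 * cos θ)| ^ (-(2 / (n : ℝ))))) +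
      ENNReal.ofReal (2 * (2 / 3 - 2 * κ / 15)) := by
  have key : ∀ z : ℝ, z ≠ 0 → |z| < 1 → ENNReal.ofReal ((z ^ 2)⁻¹ - 1) *
      ENNReal.ofReal (|p.eval (z + z⁻¹)| ^ (-(2 / (n : ℝ)))) ≤
      ENNReal.ofReal ((1 - z ^ 2) * (1 - κ * z ^ 2)) := by
    intro z hz hz1
    have hz0 : 0 < |z| := abs_pos.2 hz
    have h2 : z ^ 2 ≤ 1 := by rw [← sq_abs]; nlinarith
    have h3 : 0 ≤ (z ^ 2)⁻¹ - 1 := by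
      rw [sub_nonneg]
      exact one_le_inv_iff₀.2 ⟨by positivity, h2⟩
    rw [← ENNReal.ofReal_mul h3]
    refine ENNReal.ofReal_le_ofReal ?_
    have h4 := h z hz hz1
    rw [mul_rpow (abs_nonneg _) (by positivity), ← rpow_natCast |z| n, ← rpow_mul hz0.le,
      mul_neg, mul_div_cancel₀ _ (by exact_mod_cast hn), rpow_neg hz0.le, rpow_two, sq_abs] at h4
    have e : (z ^ 2)⁻¹ - 1 = (1 - z ^ 2) * (z ^ 2)⁻¹ := by field_simp
    rw [e, mul_assoc, mul_comm (z ^ 2)⁻¹]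
    exact mul_le_mul_of_nonneg_left h4 (by linarith)
  rw [areaInt, lintegral_joukowski, add_assoc, two_mul, ENNReal.ofReal_add (by linarith)
    (by linarith), ← lintegral_outer_weight_mul hκ]
  refine add_le_add_right (add_le_add ?_ ?_) _ <;>
    refine setLIntegral_mono' measurableSet_Ioo fun q hq ↦ ?_
  · exact key q hq.1.ne' (by rw [abs_of_pos hq.1]; exact hq.2)
  · have := key (-q) (neg_ne_zero.2 hq.1.ne') (by rw [abs_neg, abs_of_pos hq.1]; exact hq.2)
    rw [inv_neg, ← neg_add, neg_sq] at this
    exact this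

end BinaryForm

end

/-! ### Upper bounds for the area integrals of C_n and S_n -/

noncomputable section

namespace BinaryForm

open MeasureTheory Set Real

lemma add_mul_pi_div_mem {N : ℕ} (hN : 0 < N) {θ : ℝ} (hθ : θ ∈ Ioc 0 (π / N)) {k : ℕ}
    (hk : k < N) : θ + k * π / N ∈ Icc 0 π := by
  have hN' : (0 : ℝ) < N := by exact_mod_cast hN
  have hk' : (k : ℝ) + 1 ≤ N := by exact_mod_cast hk
  have hpi := pi_pos
  refine ⟨add_nonneg hθ.1.le (by positivity), ?_⟩
  calc θ + k * π / N ≤ π / N + k * π / N := by gcongr; exact hθ.2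
    _ = (k + 1) * π / N := by ring
    _ ≤ N * π / N := by gcongr
    _ = π := by field_simp

lemma setLIntegral_sin_weight_le {N : ℕ} (hN : 0 < N) {a W : ℝ} (ha : 0 ≤ a) (ha1 : a < 1)
    {w : ℝ → ℝ} (hwm : Measurable w) (hW0 : 0 ≤ W)
    (hw : ∀ θ ∈ Icc 0 π, 0 ≤ w θ)
    (hW : ∀ θ ∈ Ioc 0 (π / N), ∑ k ∈ Finset.range N, w (θ + k * π / N) ≤ N * W) :
    ∫⁻ θ in Ioo 0 π, ENNReal.ofReal (|sin (N * θ)| ^ (-a)) * ENNReal.ofReal (w θ) ≤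
      ENNReal.ofReal (W * sinInt a) := by
  rw [restrict_Ioo_eq_restrict_Ioc, ENNReal.ofReal_mul hW0, ← setLIntegral_abs_sin_rpow ha ha1]
  refine setLIntegral_periodic_mul_le (g := fun t ↦ ENNReal.ofReal (|sin t| ^ (-a)))
    (w := fun θ ↦ ENNReal.ofReal (w θ)) (periodic_ofReal_abs_sin_rpow a) (by fun_prop)
    (by fun_prop) hN fun θ hθ ↦ ?_
  rw [← ENNReal.ofReal_sum_of_nonneg, ← ENNReal.ofReal_natCast, ← ENNReal.ofReal_mul (by simp)]
  · exact ENNReal.ofReal_le_ofReal (hW θ hθ)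
  · intro k hk
    exact hw _ (add_mul_pi_div_mem hN hθ (Finset.mem_range.1 hk))

lemma areaInt_C_le {n : ℕ} (hn : 3 ≤ n) :
    areaInt (Polynomial.Chebyshev.C ℝ n) (2 / n) ≤
      ENNReal.ofReal (2 ^ (1 - 2 / (n : ℝ)) / (n * sin (π / (2 * n))) * sinInt (2 / n) + 4 / 3) := by
  have hn3 : (3 : ℝ) ≤ n := by exact_mod_cast hn
  have ha0 : 0 ≤ 2 / (n : ℝ) := by positivity
  have ha1 : 2 / (n : ℝ) < 1 := by rw [div_lt_one (by positivity)]; linarith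
  have hσ := sin_pi_div_two_mul_pos (by omega : 0 < n)
  have hI := sinInt_nonneg (2 / n)
  -- z^n C_n(z + 1/z) = z^(2n) + 1 ≥ 1, so the outer part is at most 2 · 2/3.
  have htail : ∀ z : ℝ, z ≠ 0 → |z| < 1 →
      (|(Polynomial.Chebyshev.C ℝ n).eval (z + z⁻¹)| * |z| ^ n) ^ (-(2 / (n : ℝ))) ≤
        1 - 0 * z ^ 2 := by
    intro z hz _
    rw [eval_C_add_inv hz, ← abs_pow, ← abs_mul, zero_mul, sub_zero]
    refine rpow_le_one_of_one_le_of_nonpos ?_ (by linarith)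
    have e : (z ^ n + z⁻¹ ^ n) * z ^ n = (z ^ n) ^ 2 + 1 := by
      rw [inv_pow]
      field_simp
    rw [e]
    exact (by nlinarith [sq_nonneg (z ^ n)] : (1 : ℝ) ≤ (z ^ n) ^ 2 + 1).trans (le_abs_self _)
  refine (areaInt_le (by omega) zero_le_one htail).trans ?_
  rw [ENNReal.ofReal_add (by positivity) (by norm_num)]
  refine add_le_add ?_ (ENNReal.ofReal_le_ofReal (by norm_num))
  generalize ha : 2 / (n : ℝ) = a at *
  -- C_n(2 cos θ) = 2 cos nθ; the quarter-turn shift turns the cosine into a sine without changing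
  -- the integral over a period.
  set g : ℝ → ENNReal := fun t ↦ ENNReal.ofReal (|sin (t + π / 2)| ^ (-a)) with hg
  have hgp : Function.Periodic g π := by
    intro t
    simp only [hg]
    rw [add_right_comm]
    exact periodic_ofReal_abs_sin_rpow a _
  have hgI : ∫⁻ θ in Ioc 0 π, g θ = ENNReal.ofReal (sinInt a) := by
    rw [setLIntegral_periodic_shift (periodic_ofReal_abs_sin_rpow a),
      setLIntegral_abs_sin_rpow ha0 ha1]
  have e : 2 ^ (1 - a) / (n * sin (π / (2 * n))) * sinInt a =
      (2 ^ (1 - a) * (n * sin (π / (2 * n)))⁻¹) * sinInt a := by rw [div_eq_mul_inv]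
  rw [e, ENNReal.ofReal_mul (by positivity), ← hgI]
  calc _ = ∫⁻ θ in Ioo 0 π, g (n * θ) * ENNReal.ofReal (2 ^ (1 - a) * sin θ) := by
        refine setLIntegral_congr_fun measurableSet_Ioo fun θ hθ ↦ ?_
        have hs := sin_pos_of_mem_Ioo hθ
        have hC := Polynomial.Chebyshev.C_two_mul_real_cos θ n
        push_cast at hC
        simp only [hg]
        rw [hC, sin_add_pi_div_two, ← ENNReal.ofReal_mul (by positivity),
          ← ENNReal.ofReal_mul (by positivity), abs_mul, abs_two,
          mul_rpow two_pos.le (abs_nonneg _), sub_eq_add_neg, rpow_add two_pos, rpow_one]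
        congr 1
        ring
    _ ≤ _ := by
        rw [restrict_Ioo_eq_restrict_Ioc]
        refine setLIntegral_periodic_mul_le hgp (by fun_prop) (by fun_prop) (by omega) ?_
        intro θ hθ
        rw [← ENNReal.ofReal_sum_of_nonneg, ← ENNReal.ofReal_natCast,
          ← ENNReal.ofReal_mul (by simp), ← Finset.mul_sum]
        · refine ENNReal.ofReal_le_ofReal ?_
          have := sum_sin_add_mul_le (by omega : 0 < n) θ
          calc _ ≤ 2 ^ (1 - a) * (sin (π / (2 * n)))⁻¹ := by gcongr
            _ = _ := by field_simp
        · intro k hk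
          have := sin_nonneg_of_mem_Icc
            (add_mul_pi_div_mem (by omega) hθ (Finset.mem_range.1 hk))
          positivity

/-- As S_n(2 cos θ) sin θ = sin((n + 1)θ), the weight is 2 (sin θ)^(1 + 2/n) with frequency N = n +
1. Its mean over translates is accessible once the power is majorized by a combination of sin, sin²
and sin⁴. The parameter κ sharpens the outer part, with q standing for z². -/
lemma areaInt_S_le {n : ℕ} (hn : 3 ≤ n) {α β γ κ : ℝ} (hα : 0 ≤ α) (hκ : κ ≤ 1)
    (hs : ∀ s ∈ Icc (0 : ℝ) 1, s ^ (1 + 2 / (n : ℝ)) ≤ α * s + β * s ^ 2 + γ * s ^ 4)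
    (ht : ∀ q ∈ Icc (0 : ℝ) 1,
      (∑ k ∈ Finset.range (n + 1), q ^ k) ^ (-(2 / (n : ℝ))) ≤ 1 - κ * q) :
    areaInt (Polynomial.Chebyshev.S ℝ n) (2 / n) ≤
      ENNReal.ofReal (2 * (α / ((n + 1 : ℕ) * sin (π / (2 * (n + 1 : ℕ)))) + β / 2 + 3 * γ / 8) *
        sinInt (2 / n) + (4 / 3 - 4 * κ / 15)) := by
  have hn3 : (3 : ℝ) ≤ n := by exact_mod_cast hn
  have ha0 : 0 ≤ 2 / (n : ℝ) := by positivity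
  have ha1 : 2 / (n : ℝ) < 1 := by rw [div_lt_one (by positivity)]; linarith
  have hI := sinInt_nonneg (2 / n)
  have hσ := sin_pi_div_two_mul_pos (by omega : 0 < n + 1)
  have htail : ∀ z : ℝ, z ≠ 0 → |z| < 1 →
      (|(Polynomial.Chebyshev.S ℝ n).eval (z + z⁻¹)| * |z| ^ n) ^ (-(2 / (n : ℝ))) ≤
        1 - κ * z ^ 2 := by
    intro z hz hz1
    rw [← abs_pow, ← abs_mul, eval_S_add_inv hz, abs_of_nonneg
      (Finset.sum_nonneg fun k _ ↦ by positivity)]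
    refine ht _ ⟨sq_nonneg z, ?_⟩
    rw [← sq_abs]
    nlinarith [abs_nonneg z]
  refine (areaInt_le (by omega) hκ htail).trans ?_
  generalize ha : 2 / (n : ℝ) = a at *
  have hsum : ∀ θ ∈ Ioc 0 (π / (n + 1 : ℕ)),
      ∑ k ∈ Finset.range (n + 1), 2 * sin (θ + k * π / (n + 1 : ℕ)) ^ (1 + a) ≤ (n + 1 : ℕ) *
        (2 * (α / ((n + 1 : ℕ) * sin (π / (2 * (n + 1 : ℕ)))) + β / 2 + 3 * γ / 8)) := by
    intro θ hθ
    calc _ ≤ ∑ k ∈ Finset.range (n + 1), 2 * (α * sin (θ + k * π / (n + 1 : ℕ)) +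
            β * sin (θ + k * π / (n + 1 : ℕ)) ^ 2 + γ * sin (θ + k * π / (n + 1 : ℕ)) ^ 4) := by
          gcongr with k hk
          exact hs _ ⟨sin_nonneg_of_mem_Icc
            (add_mul_pi_div_mem (by omega) hθ (Finset.mem_range.1 hk)), sin_le_one _⟩
      _ = 2 * (α * ∑ k ∈ Finset.range (n + 1), sin (θ + k * π / (n + 1 : ℕ)) +
            β * ((n + 1 : ℕ) / 2) + γ * (3 * (n + 1 : ℕ) / 8)) := by
          rw [← sum_sin_sq (by omega) θ, ← sum_sin_pow_four (by omega) θ]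
          simp only [Finset.mul_sum, Finset.sum_add_distrib, mul_add]
      _ ≤ 2 * (α * (sin (π / (2 * (n + 1 : ℕ))))⁻¹ +
            β * ((n + 1 : ℕ) / 2) + γ * (3 * (n + 1 : ℕ) / 8)) := by
          gcongr
          exact sum_sin_add_mul_le (by omega) θ
      _ = _ := by field_simp
  have hnn : ∀ θ ∈ Icc 0 π, 0 ≤ 2 * sin θ ^ (1 + a) := by
    intro θ hθ
    have := sin_nonneg_of_mem_Icc hθ
    positivity
  -- No sign is imposed on β and γ; nonnegativity follows because this quantity dominates a mean of
  -- nonnegative numbers.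
  have hW0 : 0 ≤ 2 * (α / ((n + 1 : ℕ) * sin (π / (2 * (n + 1 : ℕ)))) + β / 2 + 3 * γ / 8) := by
    have hm : π / (n + 1 : ℕ) ∈ Ioc 0 (π / (n + 1 : ℕ)) := ⟨by have := pi_pos; positivity, le_rfl⟩
    have h1 := hsum _ hm
    have h2 : 0 ≤ ∑ k ∈ Finset.range (n + 1),
        2 * sin (π / (n + 1 : ℕ) + k * π / (n + 1 : ℕ)) ^ (1 + a) :=
      Finset.sum_nonneg fun k hk ↦
        hnn _ (add_mul_pi_div_mem (by omega) hm (Finset.mem_range.1 hk))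
    exact nonneg_of_mul_nonneg_right (h2.trans h1) (by positivity)
  have hmain := setLIntegral_sin_weight_le (w := fun θ ↦ 2 * sin θ ^ (1 + a))
    (by omega : 0 < n + 1) ha0 ha1 (by fun_prop) hW0 hnn hsum
  rw [ENNReal.ofReal_add (by positivity) (by linarith)]
  refine add_le_add (le_trans (le_of_eq ?_) hmain) (ENNReal.ofReal_le_ofReal (by linarith))
  refine setLIntegral_congr_fun measurableSet_Ioo fun θ hθ ↦ ?_
  have hs := sin_pos_of_mem_Ioo hθ
  have hS := Polynomial.Chebyshev.S_two_mul_real_cos θ n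
  push_cast at hS
  push_cast
  rw [← hS, ← ENNReal.ofReal_mul (by positivity), ← ENNReal.ofReal_mul (by positivity), abs_mul,
    mul_rpow (abs_nonneg _) (abs_nonneg _), abs_of_pos hs, rpow_add hs, rpow_one, rpow_neg hs.le]
  congr 1
  field_simp

end BinaryForm

end

/-! ### Numerical comparison with Q of `S n` -/

noncomputable section

namespace BinaryForm

open MeasureTheory Set Real

lemma add_div_le_sinInt {n : ℕ} (hn : 3 ≤ n) : 3.1415 + 4 / ((n : ℝ) - 2) ≤ sinInt (2 / n) := by
  have hn3 : (3 : ℝ) ≤ n := by exact_mod_cast hn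
  have h1 : 0 < (n : ℝ) - 2 := by linarith
  have h := le_sinInt (a := 2 / n) (by positivity) (by rw [div_lt_one (by positivity)]; linarith)
  have e : 2 * (2 / (n : ℝ)) / (1 - 2 / n) = 4 / (n - 2) := by
    have : 1 - 2 / (n : ℝ) = (n - 2) / n := by field_simp
    rw [this]
    field_simp
    norm_num
  rw [e] at h
  linarith [pi_gt_d4]

/-- Put b = 2^(1/n), σ = n sin(π/(2n)) and J = `sinInt (2 / n)`. After cancellation the claim
follows from b (J/σ + 2b²/3) ≤ J. The numbers r ≥ b, s ≤ σ and I ≤ J are rational bounds that reduce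
it to arithmetic. -/
lemma Q_T_le_Q_S {n : ℕ} (hn : 3 ≤ n) {r s I : ℝ} (hr : 0 < r) (hrn : 2 ≤ r ^ n) (hs : 0 < s)
    (hsn : s ≤ 1.57075 - 0.64603 / (n : ℝ) ^ 2) (hI : I ≤ 3.1415 + 4 / ((n : ℝ) - 2))
    (hrs : r ≤ s) (h : 2 / 3 * r ^ 3 ≤ (1 - r / s) * I) : Q (T n) ≤ Q (S n) := by
  have hn3 : (3 : ℝ) ≤ n := by exact_mod_cast hn
  have hI0 := hI.trans (add_div_le_sinInt hn)
  have hJ := sinInt_nonneg (2 / n)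
  have hσ := sin_pi_div_two_mul_pos (by omega : 0 < n)
  have hsσ := hsn.trans (le_mul_sin_pi_div (by omega : 0 < n))
  rw [Q_T (by omega), Q_S hn, mul_assoc, ENNReal.ofReal_mul (by positivity),
    ENNReal.ofReal_mul (p := (n : ℝ) ^ (1 / ((n : ℝ) - 1))) (by positivity), mul_assoc]
  gcongr ENNReal.ofReal _ * ?_
  refine (mul_le_mul_right (areaInt_C_le hn) _).trans ?_
  rw [← ENNReal.ofReal_mul (by positivity)]
  refine ENNReal.ofReal_le_ofReal ?_
  generalize sinInt (2 / n) = J at *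
  generalize (n : ℝ) * sin (π / (2 * n)) = σ at *
  have hb1 : (2 : ℝ) ^ (1 / (n : ℝ)) ≤ r := by
    have := rpow_le_rpow two_pos.le hrn (by positivity : 0 ≤ 1 / (n : ℝ))
    rwa [← rpow_natCast r n, ← rpow_mul hr.le, mul_one_div_cancel (by positivity), rpow_one] at this
  have hb2 : (2 : ℝ) ^ (1 - 2 / (n : ℝ)) = 2 / (2 ^ (1 / (n : ℝ))) ^ 2 := by
    rw [rpow_sub two_pos, rpow_one, ← rpow_natCast, ← rpow_mul two_pos.le]
    congr 2
    push_cast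
    ring
  rw [hb2]
  have hb0 : (0 : ℝ) < 2 ^ (1 / (n : ℝ)) := by positivity
  generalize (2 : ℝ) ^ (1 / (n : ℝ)) = b at *
  have h1 : 0 ≤ 1 - r / s := by rw [sub_nonneg, div_le_one hs]; exact hrs
  have hσ0 : 0 < σ := hs.trans_le hsσ
  have key : b * (J / σ + 2 / 3 * b ^ 2) ≤ J := by
    calc b * (J / σ + 2 / 3 * b ^ 2) ≤ r * (J / s + 2 / 3 * r ^ 2) := by gcongr
      _ = r / s * J + 2 / 3 * r ^ 3 := by ring
      _ ≤ r / s * J + (1 - r / s) * J := by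
        exact add_le_add_right (h.trans (mul_le_mul_of_nonneg_left hI0 h1)) _
      _ = J := by ring
  calc _ = 2 / b ^ 2 * (b * (J / σ + 2 / 3 * b ^ 2)) := by field_simp; ring
    _ ≤ _ := by gcongr

lemma Q_T_le_Q_S_of_four_le {n : ℕ} (hn : 4 ≤ n) : Q (T n) ≤ Q (S n) := by
  rcases lt_or_ge n 7 with h | h
  · interval_cases n
    · exact Q_T_le_Q_S (r := 1.1893) (s := 1.5303) (I := 5.1415) (by omega) (by norm_num)
        (by norm_num) (by norm_num) (by norm_num) (by norm_num) (by norm_num) (by norm_num)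
    · exact Q_T_le_Q_S (r := 1.149) (s := 1.5449) (I := 4.47) (by omega) (by norm_num)
        (by norm_num) (by norm_num) (by norm_num) (by norm_num) (by norm_num) (by norm_num)
    · exact Q_T_le_Q_S (r := 1.123) (s := 1.552) (I := 4.1) (by omega) (by norm_num)
        (by norm_num) (by norm_num) (by norm_num) (by norm_num) (by norm_num) (by norm_num)
  · have h7 : (7 : ℝ) ≤ n := by exact_mod_cast h
    -- The values r and s are chosen for n = 7 and remain valid beyond by monotonicity; the term
    -- 4/(n - 2) is no longer needed.
    refine Q_T_le_Q_S (r := 1.1041) (s := 1.5575) (I := 3.1415) (by omega) (by norm_num) ?_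
      (by norm_num) ?_ ?_ (by norm_num) (by norm_num)
    · calc (2 : ℝ) ≤ 1.1041 ^ 7 := by norm_num
        _ ≤ _ := pow_le_pow_right₀ (by norm_num) h
    · calc (1.5575 : ℝ) ≤ 1.57075 - 0.64603 / 7 ^ 2 := by norm_num
        _ ≤ _ := by gcongr
    · have : 0 ≤ (n : ℝ) - 2 := by linarith
      exact le_add_of_nonneg_right (by positivity)

/-- Here r bounds the ratio of the discriminant factors of U_n and of S_n, including the 2^(-2/n) of
the latter; K bounds half the mean weight, and s and I bound (n + 1) sin(π/(2(n + 1))) and `sinInt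
(2 / n)` from below. -/
lemma Q_U_le_Q_S {n : ℕ} (hn : 3 ≤ n) {α β γ κ r s I K : ℝ} (hα : 0 ≤ α) (hκ : κ ≤ 1)
    (hpow : ∀ s ∈ Icc (0 : ℝ) 1, s ^ (1 + 2 / (n : ℝ)) ≤ α * s + β * s ^ 2 + γ * s ^ 4)
    (htail : ∀ q ∈ Icc (0 : ℝ) 1,
      (∑ k ∈ Finset.range (n + 1), q ^ k) ^ (-(2 / (n : ℝ))) ≤ 1 - κ * q)
    (hr : 0 < r) (hrn : 2 ^ (3 * n - 2) * ((n : ℝ) + 1) ^ (n - 2) ≤ r ^ (n * (n - 1)) * (n : ℝ) ^ n)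
    (hs : 0 < s) (hsn : s ≤ 1.57075 - 0.64603 / ((n : ℝ) + 1) ^ 2)
    (hI : I ≤ 3.1415 + 4 / ((n : ℝ) - 2)) (hK : α / s + β / 2 + 3 * γ / 8 ≤ K) (hK0 : 0 ≤ K) (hrK : r * K ≤ 1)
    (h : r * (2 / 3 - 2 * κ / 15) ≤ (1 - r * K) * I) : Q (U n) ≤ Q (S n) := by
  have hn3 : (3 : ℝ) ≤ n := by exact_mod_cast hn
  have hI0 := hI.trans (add_div_le_sinInt hn)
  have hJ := sinInt_nonneg (2 / n)
  have hσ := sin_pi_div_two_mul_pos (by omega : 0 < n + 1)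
  have hsσ := le_mul_sin_pi_div (by omega : 0 < n + 1)
  rw [Q_U (by omega), Q_S hn]
  refine (mul_le_mul_right (areaInt_S_le hn hα hκ hpow htail) _).trans ?_
  rw [← ENNReal.ofReal_mul (by positivity)]
  refine ENNReal.ofReal_le_ofReal ?_
  generalize sinInt (2 / n) = J at *
  generalize ((n + 1 : ℕ) : ℝ) * sin (π / (2 * (n + 1 : ℕ))) = σ at *
  push_cast at hsσ
  replace hsσ := hsn.trans hsσ
  have hc : 2 ^ (1 / ((n : ℝ) - 1)) * ((n : ℝ) + 1) ^ (((n : ℝ) - 2) / (n * ((n : ℝ) - 1))) ≤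
      r * (n : ℝ) ^ (1 / ((n : ℝ) - 1)) * 2 ^ (-(2 / (n : ℝ))) := by
    have hn1 : 0 < (n : ℝ) - 1 := by linarith
    have hm : 0 < (n : ℝ) * (n - 1) := by positivity
    have h1 := rpow_le_rpow (by positivity) hrn (by positivity : 0 ≤ 1 / ((n : ℝ) * (n - 1)))
    rw [mul_rpow (by positivity) (by positivity), mul_rpow (by positivity) (by positivity),
      ← rpow_natCast, ← rpow_natCast, ← rpow_natCast, ← rpow_natCast,
      ← rpow_mul (by positivity), ← rpow_mul (by positivity), ← rpow_mul (by positivity),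
      ← rpow_mul (by positivity)] at h1
    push_cast [Nat.cast_sub (by omega : 2 ≤ n), Nat.cast_sub (by omega : 1 ≤ n),
      Nat.cast_sub (by omega : 2 ≤ 3 * n)] at h1
    have e1 : (3 * (n : ℝ) - 2) * (1 / (n * (n - 1))) = 1 / (n - 1) + 2 / n := by field_simp; ring
    have e2 : ((n : ℝ) - 2) * (1 / (n * (n - 1))) = (n - 2) / (n * (n - 1)) := by field_simp
    have e3 : (n : ℝ) * (n - 1) * (1 / (n * (n - 1))) = 1 := by field_simp
    have e4 : (n : ℝ) * (1 / (n * (n - 1))) = 1 / (n - 1) := by field_simp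
    rw [e1, e2, e3, e4, rpow_one, rpow_add two_pos, mul_right_comm] at h1
    rw [rpow_neg two_pos.le, ← div_eq_mul_inv, le_div_iff₀ (by positivity)]
    exact h1
  have key : r * (K * J + (2 / 3 - 2 * κ / 15)) ≤ J := by
    have := h.trans (mul_le_mul_of_nonneg_left hI0 (by linarith))
    linarith
  have hKσ : α / σ + β / 2 + 3 * γ / 8 ≤ K := by
    refine le_trans ?_ hK
    gcongr
  have hS0 : 0 ≤ K * J + (2 / 3 - 2 * κ / 15) := by
    have : 0 ≤ 2 / 3 - 2 * κ / 15 := by linarith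
    positivity
  calc _ ≤ (2 ^ (1 / ((n : ℝ) - 1)) *
        ((n : ℝ) + 1) ^ (((n : ℝ) - 2) / (n * ((n : ℝ) - 1)))) *
          (2 * (K * J + (2 / 3 - 2 * κ / 15))) := by
        refine mul_le_mul_of_nonneg_left ?_ (by positivity)
        have := mul_le_mul_of_nonneg_right hKσ hJ
        linarith
    _ ≤ (r * (n : ℝ) ^ (1 / ((n : ℝ) - 1)) * 2 ^ (-(2 / (n : ℝ)))) *
          (2 * (K * J + (2 / 3 - 2 * κ / 15))) := by gcongr
    _ = (n : ℝ) ^ (1 / ((n : ℝ) - 1)) * 2 ^ (-(2 / (n : ℝ))) * 2 *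
          (r * (K * J + (2 / 3 - 2 * κ / 15))) := by ring
    _ ≤ (n : ℝ) ^ (1 / ((n : ℝ) - 1)) * 2 ^ (-(2 / (n : ℝ))) * 2 * J := by gcongr
    _ = _ := by
      rw [sub_eq_add_neg 1, rpow_add two_pos, rpow_one]
      ring

lemma geom_sum_rpow_neg_le_one {n : ℕ} {a q : ℝ} (ha : 0 ≤ a) (hq : 0 ≤ q) :
    (∑ k ∈ Finset.range (n + 1), q ^ k) ^ (-a) ≤ 1 := by
  refine rpow_le_one_of_one_le_of_nonpos ?_ (by linarith)
  rw [Finset.sum_range_succ']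
  have : 0 ≤ ∑ k ∈ Finset.range n, q ^ (k + 1) := Finset.sum_nonneg fun k _ ↦ by positivity
  linarith [pow_zero q]

/-- The case of `Q_U_le_Q_S` based on Bernoulli's inequality. -/
lemma Q_U_le_Q_S_of_bernoulli {n : ℕ} (hn : 3 ≤ n) {r s I K : ℝ} (hr : 0 < r)
    (hrn : 2 ^ (3 * n - 2) * ((n : ℝ) + 1) ^ (n - 2) ≤ r ^ (n * (n - 1)) * (n : ℝ) ^ n)
    (hs : 0 < s) (hsn : s ≤ 1.57075 - 0.64603 / ((n : ℝ) + 1) ^ 2)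
    (hI : I ≤ 3.1415 + 4 / ((n : ℝ) - 2)) (hK : (1 - 2 / n) / s + 1 / n ≤ K) (hrK : r * K ≤ 1)
    (h : r * (2 / 3) ≤ (1 - r * K) * I) : Q (U n) ≤ Q (S n) := by
  have hn3 : (3 : ℝ) ≤ n := by exact_mod_cast hn
  have ha1 : 2 / (n : ℝ) ≤ 1 := by rw [div_le_one (by positivity)]; linarith
  have hK0 : 0 ≤ (1 - 2 / (n : ℝ)) / s + 1 / n :=
    add_nonneg (div_nonneg (by linarith) hs.le) (by positivity)
  refine Q_U_le_Q_S hn (α := 1 - 2 / n) (β := 2 / n) (γ := 0) (κ := 0) (by linarith) zero_le_one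
    (fun s hs ↦ ?_) (fun q hq ↦ ?_) hr hrn hs hsn hI (le_trans (le_of_eq (by ring)) hK) (hK0.trans hK) hrK
    (by simpa using h)
  · rcases hs.1.eq_or_lt with rfl | h0
    · rw [zero_rpow (by positivity)]
      simp
    · rw [rpow_add h0, rpow_one]
      -- The majorant is s times the tangent of s^(2/n) at s = 1.
      have := rpow_one_add_le_one_add_mul_self (s := s - 1) (by linarith)
        (by positivity : 0 ≤ 2 / (n : ℝ)) ha1
      rw [add_sub_cancel] at this
      nlinarith
  · rw [zero_mul, sub_zero]
    exact geom_sum_rpow_neg_le_one (by positivity) hq.1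

lemma Q_U_le_Q_S_of_six_le {n : ℕ} (hn : 6 ≤ n) : Q (U n) ≤ Q (S n) := by
  rcases lt_or_ge n 14 with h | h
  · interval_cases n
    · exact Q_U_le_Q_S_of_bernoulli (r := 1.311) (s := 1.5575) (I := 4.1415) (K := 0.5948) (by omega)
        (by norm_num) (by norm_num) (by norm_num) (by norm_num) (by norm_num) (by norm_num)
        (by norm_num) (by norm_num)
    · exact Q_U_le_Q_S_of_bernoulli (r := 1.268) (s := 1.56) (I := 3.94) (K := 0.602) (by omega)
        (by norm_num) (by norm_num) (by norm_num) (by norm_num) (by norm_num) (by norm_num)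
        (by norm_num) (by norm_num)
    · exact Q_U_le_Q_S_of_bernoulli (r := 1.235) (s := 1.56) (I := 3.8) (K := 0.606) (by omega)
        (by norm_num) (by norm_num) (by norm_num) (by norm_num) (by norm_num) (by norm_num)
        (by norm_num) (by norm_num)
    · exact Q_U_le_Q_S_of_bernoulli (r := 1.21) (s := 1.56) (I := 3.7) (K := 0.61) (by omega)
        (by norm_num) (by norm_num) (by norm_num) (by norm_num) (by norm_num) (by norm_num)
        (by norm_num) (by norm_num)
    · exact Q_U_le_Q_S_of_bernoulli (r := 1.19) (s := 1.56) (I := 3.6) (K := 0.613) (by omega)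
        (by norm_num) (by norm_num) (by norm_num) (by norm_num) (by norm_num) (by norm_num)
        (by norm_num) (by norm_num)
    · exact Q_U_le_Q_S_of_bernoulli (r := 1.173) (s := 1.56) (I := 3.5) (K := 0.616) (by omega)
        (by norm_num) (by norm_num) (by norm_num) (by norm_num) (by norm_num) (by norm_num)
        (by norm_num) (by norm_num)
    · exact Q_U_le_Q_S_of_bernoulli (r := 1.16) (s := 1.56) (I := 3.5) (K := 0.618) (by omega)
        (by norm_num) (by norm_num) (by norm_num) (by norm_num) (by norm_num) (by norm_num)
        (by norm_num) (by norm_num)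
    · exact Q_U_le_Q_S_of_bernoulli (r := 1.147) (s := 1.56) (I := 3.5) (K := 0.62) (by omega)
        (by norm_num) (by norm_num) (by norm_num) (by norm_num) (by norm_num) (by norm_num)
        (by norm_num) (by norm_num)
  · have h14 : (14 : ℝ) ≤ n := by exact_mod_cast h
    refine Q_U_le_Q_S_of_bernoulli (r := 1.167) (s := 1.5675) (I := 3.1415) (K := 0.638) (by omega)
      (by norm_num) ?_ (by norm_num) ?_ ?_ ?_ (by norm_num) (by norm_num)
    · refine mul_le_mul ?_ ?_ (by positivity) (by positivity)
      -- Because 1.167^9 > 4, it is enough that 9(3n - 2) ≤ 2n(n - 1), which holds from n = 14 on.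
      · rw [← pow_le_pow_iff_left₀ (by positivity) (by positivity) (by norm_num : 9 ≠ 0), ← pow_mul]
        have e : ((1.167 : ℝ) ^ (n * (n - 1))) ^ 9 = (1.167 ^ 9) ^ (n * (n - 1)) := by
          rw [← pow_mul, ← pow_mul, mul_comm]
        rw [e]
        calc (2 : ℝ) ^ ((3 * n - 2) * 9) ≤ 2 ^ (2 * (n * (n - 1))) := by
              refine pow_le_pow_right₀ one_le_two ?_
              obtain ⟨k, rfl⟩ := Nat.exists_eq_add_of_le h
              have : 14 + k - 1 = 13 + k := by omega
              rw [this]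
              have : 3 * (14 + k) - 2 = 40 + 3 * k := by omega
              rw [this]
              nlinarith
          _ = (2 ^ 2) ^ (n * (n - 1)) := by rw [pow_mul]
          _ ≤ _ := by gcongr; norm_num
      · have h1 : (1 + 1 / (n : ℝ)) ^ n ≤ 3 := by
          calc (1 + 1 / (n : ℝ)) ^ n ≤ exp (1 / n) ^ n := by
                gcongr
                rw [add_comm]
                exact add_one_le_exp _
            _ = exp 1 := by rw [← exp_nat_mul, mul_one_div_cancel (by positivity)]
            _ ≤ 3 := by linarith [exp_one_lt_d9]
        have h2 : ((n : ℝ) + 1) ^ (n - 2) * (n + 1) ^ 2 = (1 + 1 / (n : ℝ)) ^ n * (n : ℝ) ^ n := by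
          rw [← pow_add, Nat.sub_add_cancel (by omega), ← mul_pow]
          congr 1
          field_simp
        refine le_of_mul_le_mul_right ?_ (by positivity : 0 < ((n : ℝ) + 1) ^ 2)
        rw [h2, mul_comm ((n : ℝ) ^ n)]
        gcongr
        nlinarith
    · calc (1.5675 : ℝ) ≤ 1.57075 - 0.64603 / (14 + 1) ^ 2 := by norm_num
        _ ≤ _ := by gcongr
    · have : 0 ≤ (n : ℝ) - 2 := by linarith
      exact le_add_of_nonneg_right (by positivity)
    -- With x = 1/n the left side (1 - 2x)/s + x is less than 1/s, since 2/s > 1, and 1/1.5675 <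
    -- 0.638.
    · have : 0 < 1 / (n : ℝ) := by positivity
      have e : 2 / (n : ℝ) = 2 * (1 / n) := by ring
      rw [e]
      generalize 1 / (n : ℝ) = x at *
      rw [div_add' _ _ _ (by norm_num), div_le_iff₀ (by norm_num)]
      linarith

lemma Q_U_five_le_Q_S : Q (U 5) ≤ Q (S 5) := by
  refine Q_U_le_Q_S (n := 5) (α := 0.5415) (β := 0.46655) (γ := 0) (κ := 0.2) (r := 1.373)
    (s := 1.5528) (I := 4.4748) (K := 0.58203) (by norm_num) (by norm_num) (by norm_num)
    (fun s hs ↦ ?_) (fun q hq ↦ ?_) (by norm_num) (by norm_num) (by norm_num) (by norm_num)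
    (by norm_num) (by norm_num) (by norm_num) (by norm_num) (by norm_num)
  · rcases hs.1.eq_or_lt with rfl | h0
    · rw [zero_rpow (by positivity)]
      simp
    -- Weighted AM-GM gives the tangent of s^(2/5) at s = 0.95^5: its constant term is (3/5) · 0.95²
    -- = 0.5415 = α, and its slope (2/5)/0.95³ is just below β.
    · have h := geom_mean_le_arith_mean2_weighted (by norm_num : (0 : ℝ) ≤ 2 / 5)
        (by norm_num : (0 : ℝ) ≤ 3 / 5) hs.1 (by positivity : (0 : ℝ) ≤ 0.95 ^ 5) (by norm_num)
      have e : ((0.95 : ℝ) ^ 5) ^ (3 / 5 : ℝ) = 0.95 ^ 3 := by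
        rw [← rpow_natCast, ← rpow_mul (by norm_num), ← rpow_natCast]
        norm_num
      rw [e] at h
      rw [rpow_add h0, rpow_one]
      norm_num at h ⊢
      nlinarith
  · have h1 : 1 + q ≤ ∑ k ∈ Finset.range (5 + 1), q ^ k := by
      have := hq.1
      simp only [Finset.sum_range_succ, Finset.sum_range_zero, zero_add, pow_zero, pow_one]
      have : 0 ≤ q ^ 2 + q ^ 3 + q ^ 4 + q ^ 5 := by positivity
      linarith
    have h0 : 0 < 1 + q := by linarith [hq.1]
    have h5 : 0 < 1 - q / 5 := by linarith [hq.2]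
    calc _ ≤ (1 + q) ^ (-(2 / (5 : ℝ))) := by
          push_cast
          exact rpow_le_rpow_of_nonpos h0 h1 (by norm_num)
      _ = ((1 + q) ^ 2)⁻¹ ^ (1 / 5 : ℝ) := by
          rw [← rpow_two, ← rpow_neg h0.le, ← rpow_mul h0.le]
          norm_num
      _ ≤ ((1 - q / 5) ^ 5) ^ (1 / 5 : ℝ) := by
          refine rpow_le_rpow (by positivity) ?_ (by norm_num)
          rw [inv_le_iff_one_le_mul₀ (by positivity), ← sub_nonneg]
          have h2 := hq.1
          have h3 : 0 ≤ 1 - q := by linarith [hq.2]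
          have e : (1 - q / 5) ^ 5 * (1 + q) ^ 2 - 1 = q * ((1 - q) * (3125 + 1250 * q +
            375 * q ^ 2 + 1150 * q ^ 3 + 949 * q ^ 4 + 972 * q ^ 5) + 971 * q ^ 6) / 3125 := by
            ring
          rw [e]
          positivity
      _ = 1 - 0.2 * q := by
          rw [← rpow_natCast, ← rpow_mul h5.le]
          norm_num
          ring

lemma Q_U_four_le_Q_S : Q (U 4) ≤ Q (S 4) := by
  refine Q_U_le_Q_S (n := 4) (α := 282 / 833) (β := 1909 / 2499) (γ := -256 / 2499) (κ := 1 / 2)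
    (r := 1.4679) (s := 1.5449) (I := 5.1415) (K := 0.5627) (by norm_num) (by norm_num)
    (by norm_num) (fun s hs ↦ ?_) (fun q hq ↦ ?_) (by norm_num) (by norm_num) (by norm_num)
    (by norm_num) (by norm_num) (by norm_num) (by norm_num) (by norm_num) (by norm_num)
  -- With s = u² the exponent 3/2 becomes polynomial. The coefficients make the majorant touch u³
  -- doubly at u = 3/4 and meet it at u = 1, as the factorization shows.
  · obtain ⟨u, hu, rfl⟩ : ∃ u : ℝ, 0 ≤ u ∧ s = u ^ 2 := ⟨√s, sqrt_nonneg s, (sq_sqrt hs.1).symm⟩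
    have hu1 : u ≤ 1 := by nlinarith [hs.2]
    have e : (u ^ 2) ^ (1 + 2 / ((4 : ℕ) : ℝ)) = u ^ 3 := by
      rw [← rpow_natCast, ← rpow_mul hu, ← rpow_natCast]
      norm_num
    rw [e, ← sub_nonneg]
    have h1 : 0 ≤ 1 - u := by linarith
    have : 282 / 833 * u ^ 2 + 1909 / 2499 * (u ^ 2) ^ 2 + -256 / 2499 * (u ^ 2) ^ 4 - u ^ 3 =
      u ^ 2 * ((u - 3 / 4) ^ 2 * (1 - u) *
        (256 * u ^ 3 + 640 * u ^ 2 + 1072 * u + 1504) / 2499) := by ring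
    rw [this]
    positivity
  · have hg : ∑ k ∈ Finset.range (4 + 1), q ^ k = 1 + q + q ^ 2 + q ^ 3 + q ^ 4 := by
      simp [Finset.sum_range_succ]
    obtain ⟨h0, h1⟩ := hq
    have h2 : 0 < 1 - q / 2 := by linarith
    have hp : 0 < 1 + q + q ^ 2 + q ^ 3 + q ^ 4 := by positivity
    rw [hg]
    calc _ = (1 + q + q ^ 2 + q ^ 3 + q ^ 4)⁻¹ ^ (1 / 2 : ℝ) := by
          rw [inv_rpow hp.le, ← rpow_neg hp.le]
          norm_num
      _ ≤ ((1 - q / 2) ^ 2) ^ (1 / 2 : ℝ) := by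
          refine rpow_le_rpow (by positivity) ?_ (by norm_num)
          rw [inv_le_iff_one_le_mul₀ (by positivity), ← sub_nonneg]
          have h3 : 0 ≤ 1 - q := by linarith
          -- The slope κ = 1/2 is the exact first-order coefficient 2/n for n = 4, so the difference
          -- starts at q².
          have e : (1 - q / 2) ^ 2 * (1 + q + q ^ 2 + q ^ 3 + q ^ 4) - 1 =
            q ^ 2 / 4 * ((1 - q) * (1 + 2 * q + 3 * q ^ 2) + q ^ 4) := by
            ring
          rw [e]
          positivity
      _ = 1 - 1 / 2 * q := by
          rw [← sqrt_eq_rpow, sqrt_sq h2.le]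
          ring

/-- The cubic forms with three real zeros are all linearly equivalent. -/
lemma lintegral_cubic {p : Polynomial ℝ} {k : ℝ} (hk : 0 < k)
    (hp : ∀ x, p.eval x = x ^ 3 - 3 * k ^ 2 * x) :
    areaInt p (2 / 3) = ENNReal.ofReal (k⁻¹ * sinInt (2 / 3)) := by
  set g : ℝ → ENNReal := fun t ↦ ENNReal.ofReal (|sin t| ^ (-(2 / 3 : ℝ))) with hg
  have hgp : Function.Periodic g π := periodic_ofReal_abs_sin_rpow _
  have hgp' : Function.Periodic (fun t ↦ g (t + π / 2)) π := by
    intro t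
    simp only
    rw [add_right_comm]
    exact hgp _
  have hI : ∫⁻ t in Ioo 0 π, g (3 * t + π / 2) = ENNReal.ofReal (sinInt (2 / 3)) := by
    have := setLIntegral_periodic hgp' (by fun_prop) (n := 3) (by norm_num)
    push_cast at this
    rw [restrict_Ioo_eq_restrict_Ioc, this, setLIntegral_periodic_shift hgp,
      setLIntegral_abs_sin_rpow (by norm_num) (by norm_num)]
  rw [areaInt, lintegral_comp_mul hk, lintegral_cot,
    ENNReal.ofReal_mul (by positivity), ← hI, ← lintegral_const_mul' _ _ ENNReal.ofReal_ne_top,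
    ← lintegral_const_mul' _ _ ENNReal.ofReal_ne_top]
  refine setLIntegral_congr_fun measurableSet_Ioo fun t ht ↦ ?_
  have hs := sin_pos_of_mem_Ioo ht
  -- The triple-angle formula: cos³ t - 3 cos t sin² t = cos 3t.
  have e : p.eval (k * (cos t / sin t)) = cos (3 * t) * (k ^ 3 / sin t ^ 3) := by
    rw [hp, cos_three_mul]
    field_simp
    rw [sin_sq]
    ring
  have e1 : (k ^ 3 / sin t ^ 3) ^ (-(2 / 3 : ℝ)) = sin t ^ 2 / k ^ 2 := by
    rw [← div_pow, ← rpow_natCast, ← rpow_mul (by positivity)]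
    push_cast
    norm_num
    rw [div_pow, inv_div]
  simp only [hg]
  rw [sin_add_pi_div_two, e, abs_mul, abs_of_pos (by positivity : 0 < k ^ 3 / sin t ^ 3),
    mul_rpow (abs_nonneg _) (by positivity), e1, ← ENNReal.ofReal_mul (by positivity),
    ← ENNReal.ofReal_mul (by positivity), ← ENNReal.ofReal_mul (by positivity)]
  congr 1
  field_simp

lemma Q_S_three : Q (S 3) = ENNReal.ofReal (3 ^ (1 / 2 : ℝ) * 2 ^ (1 / 3 : ℝ) * sinInt (2 / 3)) := by
  rw [Q_S le_rfl]
  norm_num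

lemma Q_T_three_le_Q_S : Q (T 3) ≤ Q (S 3) := by
  have h := lintegral_cubic (p := Polynomial.Chebyshev.C ℝ 3) one_pos fun x ↦ by
    have := Polynomial.Chebyshev.C_add_two ℝ 1
    norm_num at this
    rw [this, Polynomial.Chebyshev.C_two]
    simp
    ring
  have hJ := sinInt_nonneg (2 / 3)
  rw [Q_S_three, Q_T (by norm_num)]
  push_cast
  rw [h, ← ENNReal.ofReal_mul (by positivity)]
  norm_num

/-- S_3 = x³ - 2x, so 3k² = 2. The constants agree exactly, and the inequality is an equality. -/
lemma Q_U_three_le_Q_S : Q (U 3) ≤ Q (S 3) := by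
  have h := lintegral_cubic (p := Polynomial.Chebyshev.S ℝ 3) (k := √(2 / 3)) (by positivity)
    fun x ↦ by
      have := Polynomial.Chebyshev.S_add_two ℝ 1
      norm_num at this
      rw [this, Polynomial.Chebyshev.S_two, sq_sqrt (by norm_num)]
      simp
      ring
  have hJ := sinInt_nonneg (2 / 3)
  rw [Q_S_three, Q_U (by norm_num)]
  push_cast
  rw [h, ← ENNReal.ofReal_mul (by positivity), ← mul_assoc]
  refine ENNReal.ofReal_le_ofReal (mul_le_mul_of_nonneg_right (le_of_eq ?_) hJ)
  have e4 : (3 + 1 : ℝ) = 2 ^ (2 : ℝ) := by norm_num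
  rw [e4, ← rpow_mul two_pos.le, sqrt_eq_rpow, ← inv_rpow (by norm_num), inv_div,
    div_rpow (by norm_num) (by norm_num)]
  norm_num
  have h2 : (0 : ℝ) < 2 ^ (1 / 2 : ℝ) := by positivity
  field_simp

theorem Q_T_le {n : ℕ} (hn : 3 ≤ n) : Q (T n) ≤ Q (S n) := by
  rcases hn.eq_or_lt with rfl | h
  · exact Q_T_three_le_Q_S
  · exact Q_T_le_Q_S_of_four_le h

theorem Q_U_le {n : ℕ} (hn : 3 ≤ n) : Q (U n) ≤ Q (S n) := by
  rcases lt_or_ge n 6 with h | h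
  · interval_cases n
    · exact Q_U_three_le_Q_S
    · exact Q_U_four_le_Q_S
    · exact Q_U_five_le_Q_S
  · exact Q_U_le_Q_S_of_six_le h

end BinaryForm

end

/-! ### Minimal polynomials of ζ + 1/ζ and cyclotomic polynomials -/

noncomputable section

namespace BinaryForm

open Polynomial IntermediateField

/-- Substituting `X + 1 / X` in a monic polynomial and clearing denominators. -/
lemma exists_monic_eval_add_inv {K : Type*} [Field K] {p : K[X]} (hp : p.Monic) :
    ∃ r : K[X], r.Monic ∧ r.natDegree = 2 * p.natDegree ∧
      ∀ {L : Type _} [Field L] [Algebra K L] (z : L), z ≠ 0 →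
        aeval z r = aeval (z + z⁻¹) p * z ^ p.natDegree := by
  set d := p.natDegree with hd
  have hm : ((X ^ 2 + C (1 : K)) ^ d).Monic := (monic_X_pow_add_C 1 two_ne_zero).pow d
  have hdeg : ∀ i, ((X ^ 2 + C (1 : K)) ^ i).natDegree = 2 * i := fun i ↦ by
    rw [natDegree_pow, natDegree_X_pow_add_C, mul_comm]
  set s : K[X] := ∑ i ∈ Finset.range d, C (p.coeff i) * (X ^ 2 + C 1) ^ i * X ^ (d - i) with hs
  have hlt : s.degree < ((X ^ 2 + C (1 : K)) ^ d).degree := by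
    rw [degree_eq_natDegree hm.ne_zero, hdeg, ← mem_degreeLT]
    refine Submodule.sum_mem _ fun i hi ↦ ?_
    have hi' := Finset.mem_range.1 hi
    rw [mem_degreeLT]
    refine lt_of_le_of_lt degree_le_natDegree (Nat.cast_lt.2 ?_)
    refine lt_of_le_of_lt (natDegree_mul_le.trans (add_le_add (natDegree_C_mul_le _ _) le_rfl)) ?_
    rw [hdeg, natDegree_X_pow]
    omega
  refine ⟨(X ^ 2 + C 1) ^ d + s, hm.add_of_left hlt, ?_, fun z hz ↦ ?_⟩
  · rw [natDegree_add_eq_left_of_degree_lt hlt, hdeg]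
  · have e : (X ^ 2 + C 1) ^ d + s =
        ∑ i ∈ Finset.range (d + 1), C (p.coeff i) * (X ^ 2 + C 1) ^ i * X ^ (d - i) := by
      rw [Finset.sum_range_succ, ← hs, hd, hp.coeff_natDegree]
      simp [add_comm]
    rw [e, map_sum, aeval_eq_sum_range, ← hd, Finset.sum_mul]
    refine Finset.sum_congr rfl fun i hi ↦ ?_
    have hi' := Nat.lt_succ_iff.1 (Finset.mem_range.1 hi)
    have h1 : z + z⁻¹ = (z ^ 2 + 1) / z := by field_simp
    have h2 : z ^ d = z ^ i * z ^ (d - i) := by rw [← pow_add, Nat.add_sub_cancel' hi']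
    simp only [map_mul, map_pow, map_add, aeval_X, aeval_C, map_one, h1, h2, div_pow, Algebra.smul_def]
    field_simp

/-- ℚ(α) is a real subfield of ℚ(ζ), while ζ is not real for m ≥ 3, so the index is at least 2. -/
lemma two_mul_natDegree_minpoly_le {m : ℕ} (hm : 3 ≤ m) {ζ : ℂ} (hζ : IsPrimitiveRoot ζ m)
    {α : ℝ} (hα : (α : ℂ) = ζ + ζ⁻¹) : 2 * (minpoly ℚ (α : ℂ)).natDegree ≤ m.totient := by
  have hmin := cyclotomic_eq_minpoly_rat hζ (by omega)
  have hint : IsIntegral ℚ ζ := (hζ.isIntegral (by omega)).tower_top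
  have hintα : IsIntegral ℚ (α : ℂ) := by
    rw [hα]
    exact hint.add (hζ.inv.isIntegral (by omega)).tower_top
  have hL : Module.finrank ℚ ℚ⟮ζ⟯ = m.totient := by
    rw [adjoin.finrank hint, ← hmin, natDegree_cyclotomic]
  have hfd : FiniteDimensional ℚ ℚ⟮ζ⟯ := adjoin.finiteDimensional hint
  have hle : ℚ⟮(α : ℂ)⟯ ≤ ℚ⟮ζ⟯ := by
    rw [adjoin_simple_le_iff, hα]
    exact add_mem (mem_adjoin_simple_self ℚ ζ) (inv_mem (mem_adjoin_simple_self ℚ ζ))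
  have hdvd := finrank_dvd_of_le_right hle
  rw [hL, adjoin.finrank hintα] at hdvd
  obtain ⟨k, hk⟩ := hdvd
  have hφ := Nat.totient_pos.2 (by omega : 0 < m)
  rcases Nat.lt_or_ge k 2 with h | h
  · exfalso
    have hk1 : k = 1 := by
      interval_cases k
      · omega
      · rfl
    have heq := eq_of_le_of_finrank_eq hle (by
      rw [hL, adjoin.finrank hintα, hk, hk1, mul_one])
    have hreal : ℚ⟮(α : ℂ)⟯ ≤ (Complex.ofRealAm.restrictScalars ℚ).fieldRange := by
      rw [adjoin_simple_le_iff]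
      exact ⟨α, rfl⟩
    have hmem : ζ ∈ (Complex.ofRealAm.restrictScalars ℚ).fieldRange :=
      hreal (heq ▸ mem_adjoin_simple_self ℚ ζ)
    obtain ⟨x, hx⟩ := hmem
    have hx' : (x : ℂ) = ζ := hx
    have hx1 : x ^ m = 1 := by
      have := hζ.pow_eq_one
      rw [← hx'] at this
      exact_mod_cast this
    have hxabs : |x| = 1 := by
      have : |x| ^ m = 1 := by rw [← abs_pow, hx1, abs_one]
      exact (pow_eq_one_iff_of_nonneg (abs_nonneg x) (by omega)).1 this
    have hx2 : x ^ 2 = 1 := by rw [← sq_abs, hxabs, one_pow]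
    have : m ∣ 2 := hζ.dvd_of_pow_eq_one 2 (by rw [← hx']; exact_mod_cast hx2)
    have := Nat.le_of_dvd two_pos this
    omega
  · rw [hk, mul_comm]
    exact Nat.mul_le_mul_left _ h

/-- The integral polynomial `P` is the minimal polynomial of the numbers `ζ + 1 / ζ` with `ζ` a
primitive root of unity of order `m`. -/
structure IsHalfCyclotomic (P : ℤ[X]) (m : ℕ) : Prop where
  monic : P.Monic
  two_mul_natDegree : 2 * P.natDegree = m.totient
  eval_eq : ∀ z : ℂ, z ≠ 0 →
    aeval (z + z⁻¹) P * z ^ P.natDegree = (cyclotomic m ℂ).eval z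

lemma exists_isHalfCyclotomic {m : ℕ} (hm : 3 ≤ m) {ζ : ℂ} (hζ : IsPrimitiveRoot ζ m)
    {α : ℝ} (hα : (α : ℂ) = ζ + ζ⁻¹) : ∃ P : ℤ[X], IsHalfCyclotomic P m ∧
      (minpoly ℚ α).map (algebraMap ℚ ℝ) = P.map (Int.castRingHom ℝ) := by
  have hζ0 : ζ ≠ 0 := hζ.ne_zero (by omega)
  have hint : IsIntegral ℤ (α : ℂ) := by
    rw [hα]
    exact (hζ.isIntegral (by omega)).add (hζ.inv.isIntegral (by omega))
  have hQ : minpoly ℚ (α : ℂ) = (minpoly ℤ (α : ℂ)).map (algebraMap ℤ ℚ) :=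
    minpoly.isIntegrallyClosed_eq_field_fractions' ℚ hint
  have hR : minpoly ℚ (α : ℂ) = minpoly ℚ α :=
    minpoly.algebraMap_eq (algebraMap ℝ ℂ).injective α
  have hmon := minpoly.monic hint
  have hdeg : (minpoly ℚ (α : ℂ)).natDegree = (minpoly ℤ (α : ℂ)).natDegree := by
    rw [hQ, hmon.natDegree_map]
  obtain ⟨r, hr, hrd, hre⟩ := exists_monic_eval_add_inv (minpoly.monic hint.tower_top (A := ℚ))
  -- r vanishes at ζ, so the cyclotomic polynomial divides it, and the degree bound forces equality
  -- of the monic polynomials.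
  have hcyc : r = cyclotomic m ℚ := by
    refine (eq_of_monic_of_dvd_of_natDegree_le (cyclotomic.monic m ℚ) hr ?_ ?_)
    · rw [cyclotomic_eq_minpoly_rat hζ (by omega)]
      refine minpoly.dvd ℚ ζ ?_
      rw [hre ζ hζ0, ← hα, minpoly.aeval, zero_mul]
    · rw [hrd, natDegree_cyclotomic]
      exact two_mul_natDegree_minpoly_le hm hζ hα
  refine ⟨minpoly ℤ (α : ℂ), ⟨hmon, ?_, fun z hz ↦ ?_⟩, ?_⟩
  · rw [← hdeg, ← hrd, hcyc, natDegree_cyclotomic]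
  · have := hre z hz
    rw [hcyc, hdeg, hQ, aeval_map_algebraMap] at this
    rw [← this, aeval_def, eval₂_eq_eval_map, map_cyclotomic]
  · rw [← hR, hQ, Polynomial.map_map]
    congr 1

end BinaryForm

end

/-! ### Möbius factorization and bounds for the totient -/

noncomputable section

namespace BinaryForm

open Polynomial

/-- The divisors `e` of `m` with `μ (m / e) = k`. -/
def moebiusDivisors (m : ℕ) (k : ℤ) : Finset ℕ :=
  m.divisors.filter fun e ↦ ArithmeticFunction.moebius (m / e) = k

/-- Möbius inversion, Φ_m = ∏ (X^e - 1)^μ(m/e), with the negative exponents moved to the left. -/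
lemma cyclotomic_mul_prod {m : ℕ} : cyclotomic m ℂ * ∏ e ∈ moebiusDivisors m (-1), (X ^ e - 1) =
    ∏ e ∈ moebiusDivisors m 1, (X ^ e - 1) := by
  apply RatFunc.algebraMap_injective ℂ
  rw [map_mul, cyclotomic_eq_prod_X_pow_sub_one_pow_moebius,
    Nat.prod_divisorsAntidiagonal' (f := fun i j ↦
      algebraMap ℂ[X] (RatFunc ℂ) (X ^ j - 1) ^ ArithmeticFunction.moebius i), map_prod, map_prod,
    moebiusDivisors, moebiusDivisors, Finset.prod_filter, Finset.prod_filter,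
    ← Finset.prod_mul_distrib]
  refine Finset.prod_congr rfl fun e he ↦ ?_
  have hu : algebraMap ℂ[X] (RatFunc ℂ) (X ^ e - 1) ≠ 0 := by
    rw [Ne, map_eq_zero_iff _ (RatFunc.algebraMap_injective ℂ)]
    exact (monic_X_pow_sub_C (1 : ℂ) (Nat.pos_of_mem_divisors he).ne').ne_zero
  rcases ArithmeticFunction.moebius_eq_or (m / e) with h | h | h
  · simp [h]
  · simp [h]
  · rw [h, if_pos rfl, if_neg (by norm_num), zpow_neg_one, inv_mul_cancel₀ hu]

/-- Such an e has m/e squarefree, hence is determined by the set of primes dividing m/e. -/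
lemma card_moebiusDivisors_le (m : ℕ) :
    (moebiusDivisors m 1 ∪ moebiusDivisors m (-1)).card ≤ 2 ^ m.primeFactors.card := by
  rw [← Finset.card_powerset]
  have hmem : ∀ e ∈ moebiusDivisors m 1 ∪ moebiusDivisors m (-1),
      e ∈ m.divisors ∧ Squarefree (m / e) := by
    intro e he
    simp only [moebiusDivisors, Finset.mem_union, Finset.mem_filter] at he
    rw [← ArithmeticFunction.moebius_ne_zero_iff_squarefree]
    rcases he with ⟨h1, h2⟩ | ⟨h1, h2⟩ <;> simp [h1, h2]
  refine Finset.card_le_card_of_injOn (fun e ↦ (m / e).primeFactors) (fun e he ↦ ?_) ?_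
  · obtain ⟨h1, -⟩ := hmem e he
    rw [Nat.mem_divisors] at h1
    simp only [Finset.coe_powerset, Set.mem_preimage, Set.mem_powerset_iff, Finset.coe_subset]
    exact Nat.primeFactors_mono (Nat.div_dvd_of_dvd h1.1) h1.2
  · intro e he f hf hef
    obtain ⟨h1, h2⟩ := hmem e he
    obtain ⟨h3, h4⟩ := hmem f hf
    rw [Nat.mem_divisors] at h1 h3
    have h5 : m / e = m / f := by
      rw [← Nat.prod_primeFactors_of_squarefree h2, ← Nat.prod_primeFactors_of_squarefree h4]
      exact congrArg (fun s : Finset ℕ ↦ ∏ p ∈ s, p) hef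
    have h6 := Nat.div_mul_cancel h1.1
    have h7 := Nat.div_mul_cancel h3.1
    rw [← h5] at h7
    exact Nat.eq_of_mul_eq_mul_left (Nat.pos_of_ne_zero h2.ne_zero) (h6.trans h7.symm)

lemma IsHalfCyclotomic.isCycloQuotient {P : ℤ[X]} {m : ℕ} (h : IsHalfCyclotomic P m) :
    IsCycloQuotient (P.map (Int.castRingHom ℝ)) P.natDegree (moebiusDivisors m 1)
      (moebiusDivisors m (-1)) where
  disjoint := by
    rw [Finset.disjoint_left]
    intro e he hf
    simp only [moebiusDivisors, Finset.mem_filter] at he hf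
    have := he.2.symm.trans hf.2
    norm_num at this
  pos := by
    intro e he
    simp only [moebiusDivisors, Finset.mem_union, Finset.mem_filter] at he
    rcases he with he | he <;> exact Nat.pos_of_mem_divisors he.1
  norm_eq := by
    intro z hz
    have e : aeval (z + z⁻¹) (P.map (Int.castRingHom ℝ)) = aeval (z + z⁻¹) P :=
      aeval_map_algebraMap ℝ _ P
    have h1 := congrArg (fun p ↦ ‖eval z p‖) (cyclotomic_mul_prod (m := m))
    simp only [eval_mul, eval_prod, eval_sub, eval_pow, eval_X, eval_one, norm_mul,
      norm_prod] at h1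
    rw [e, ← h1, ← h.eval_eq z hz, norm_mul, norm_pow]

lemma moebiusDivisors_union_nonempty {m : ℕ} (hm : m ≠ 0) :
    (moebiusDivisors m 1 ∪ moebiusDivisors m (-1)).Nonempty := by
  refine ⟨m, Finset.mem_union_left _ ?_⟩
  simp [moebiusDivisors, hm, Nat.div_self (Nat.pos_of_ne_zero hm)]

/-- Shows that 2^ω(m)/φ(m), and so the ratio of factor count to degree, is O(m^(-1/3)). The
inequality is local: 8p ≤ c_p (p - 1)³ with c_2 = 16, c_3 = 3 and c_p = 1 otherwise, and 16 · 3 =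
48. -/
lemma mul_eight_pow_le {m : ℕ} (hm : m ≠ 0) :
    m * 8 ^ m.primeFactors.card ≤ 48 * m.totient ^ 3 := by
  have hc : ∏ p ∈ m.primeFactors, ((if p = 2 then 16 else 1) * (if p = 3 then 3 else 1)) ≤ 48 := by
    rw [Finset.prod_mul_distrib, Finset.prod_ite_eq', Finset.prod_ite_eq']
    split_ifs <;> norm_num
  have hm' := Nat.prod_factorization_pow_eq_self hm
  have hφ := Nat.totient_eq_prod_factorization hm
  rw [Finsupp.prod, Nat.support_factorization] at hm' hφ
  have hlhs : m * 8 ^ m.primeFactors.card =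
      ∏ p ∈ m.primeFactors, p ^ m.factorization p * 8 := by
    rw [Finset.prod_mul_distrib, hm', Finset.prod_const]
  rw [hlhs, hφ]
  refine le_trans ?_ (Nat.mul_le_mul_right _ hc)
  rw [← Finset.prod_pow, ← Finset.prod_mul_distrib]
  refine Finset.prod_le_prod' fun p hp ↦ ?_
  have hpp := Nat.prime_of_mem_primeFactors hp
  have hk : m.factorization p ≠ 0 :=
    (hpp.factorization_pos_of_dvd hm (Nat.dvd_of_mem_primeFactors hp)).ne'
  obtain ⟨k, hk⟩ := Nat.exists_eq_succ_of_ne_zero hk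
  rw [hk, Nat.succ_sub_one, mul_pow, ← pow_mul, pow_succ]
  have hpk : p ^ k ≤ p ^ (k * 3) := Nat.pow_le_pow_right hpp.pos (by omega)
  have key : p * 8 ≤ (if p = 2 then 16 else 1) * (if p = 3 then 3 else 1) * (p - 1) ^ 3 := by
    rcases Nat.lt_or_ge p 5 with h | h
    · have := hpp.two_le
      interval_cases p
      · norm_num
      · norm_num
      · norm_num at hpp
    · obtain ⟨q, rfl⟩ := Nat.exists_eq_add_of_le h
      rw [if_neg (by omega), if_neg (by omega)]
      have : 5 + q - 1 = 4 + q := by omega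
      rw [this]
      ring_nf
      nlinarith [Nat.zero_le (q ^ 3), Nat.zero_le (q ^ 2)]
  calc p ^ k * p * 8 = p ^ k * (p * 8) := by ring
    _ ≤ p ^ (k * 3) * ((if p = 2 then 16 else 1) * (if p = 3 then 3 else 1) * (p - 1) ^ 3) :=
      Nat.mul_le_mul hpk key
    _ = _ := by ring

lemma le_totient_pow_three {m : ℕ} (hm : m ≠ 0) : m ≤ 48 * m.totient ^ 3 :=
  (Nat.le_mul_of_pos_right _ (by positivity)).trans (mul_eight_pow_le hm)

end BinaryForm

end

/-! ### Discriminants of the minimal polynomials -/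

noncomputable section

namespace BinaryForm

open Polynomial

/-- Identifies the product with the absolute value of an integer, which is at least 1 as soon as it
is nonzero. -/
lemma prod_norm_aeval_roots {A H : ℤ[X]} (hA : A.Monic) {k : ℕ} (hk : H.natDegree ≤ k) :
    ((A.map (Int.castRingHom ℂ)).roots.map fun w ↦ ‖aeval w H‖).prod =
      |((resultant A H A.natDegree k : ℤ) : ℝ)| := by
  have h := resultant_eq_prod_eval (A.map (Int.castRingHom ℂ)) (H.map (Int.castRingHom ℂ)) k
    (natDegree_map_le.trans hk) (IsAlgClosed.splits _)
  rw [resultant_map_map, (hA.map _).leadingCoeff, one_pow, one_mul, hA.natDegree_map] at h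
  have h1 := congrArg norm h
  rw [eq_intCast, Complex.norm_intCast] at h1
  rw [h1, ← normHom_apply, map_multiset_prod, Multiset.map_map]
  congr 2
  ext w
  simp only [Function.comp_apply, normHom_apply]
  rw [aeval_def, eval₂_eq_eval_map]
  rfl

lemma one_le_prod_norm_aeval_roots {A H : ℤ[X]} (hA : A.Monic)
    (h : ∀ w ∈ (A.map (Int.castRingHom ℂ)).roots, aeval w H ≠ 0) :
    1 ≤ ((A.map (Int.castRingHom ℂ)).roots.map fun w ↦ ‖aeval w H‖).prod := by
  have h0 : ((A.map (Int.castRingHom ℂ)).roots.map fun w ↦ ‖aeval w H‖).prod ≠ 0 := by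
    rw [Ne, Multiset.prod_eq_zero_iff, Multiset.mem_map]
    rintro ⟨w, hw, hw0⟩
    exact h w hw (norm_eq_zero.1 hw0)
  rw [prod_norm_aeval_roots hA le_rfl] at h0 ⊢
  rw [← Int.cast_abs]
  exact_mod_cast Int.one_le_abs (by simpa using h0)

lemma exists_add_inv_eq (x : ℂ) : ∃ w : ℂ, w ≠ 0 ∧ w + w⁻¹ = x := by
  obtain ⟨s, hs⟩ := IsAlgClosed.exists_pow_nat_eq (x ^ 2 - 4) two_pos
  have h : (x + s) / 2 * ((x - s) / 2) = 1 := by linear_combination -hs / 4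
  have h0 : (x + s) / 2 ≠ 0 := left_ne_zero_of_mul_eq_one h
  refine ⟨(x + s) / 2, h0, ?_⟩
  rw [inv_eq_of_mul_eq_one_right h]
  ring

namespace IsHalfCyclotomic

variable {P : ℤ[X]} {m : ℕ}

/-- Two expressions for Φ_m'(w) at a primitive root w are compared: one from Φ_m(z) = z^d P(z +
1/z), the other from X^m - 1 = Φ_m G. The factor w² - 1 comes from the derivative of z + 1/z. -/
lemma norm_derivative_mul (h : IsHalfCyclotomic P m) (hm : m ≠ 0) {G : ℤ[X]}
    (hG : X ^ m - 1 = cyclotomic m ℤ * G) {w : ℂ} (hw : w ≠ 0) (hx : aeval (w + w⁻¹) P = 0) :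
    ‖aeval (w + w⁻¹) (derivative P)‖ * ‖aeval w ((X ^ 2 - 1) * G)‖ = m := by
  have hΦ0 : (cyclotomic m ℂ).eval w = 0 := by rw [← h.eval_eq w hw, hx, zero_mul]
  have hmC : (m : ℂ) ≠ 0 := by exact_mod_cast hm
  have : NeZero (m : ℂ) := ⟨hmC⟩
  have hprim : IsPrimitiveRoot w m := isRoot_cyclotomic_iff.1 hΦ0
  have hnorm : ‖w‖ = 1 := hprim.norm'_eq_one hm
  have hd1 : (derivative (cyclotomic m ℂ)).eval w =
      aeval (w + w⁻¹) (derivative P) * (1 - (w ^ 2)⁻¹) * w ^ P.natDegree := by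
    have h1 : HasDerivAt (fun z : ℂ ↦ z + z⁻¹) (1 - (w ^ 2)⁻¹) w := by
      rw [sub_eq_add_neg]
      exact (hasDerivAt_id' w).add (hasDerivAt_inv hw)
    have h2 := ((P.hasDerivAt_aeval (w + w⁻¹)).comp w h1).mul (hasDerivAt_pow P.natDegree w)
    have h3 : HasDerivAt (fun z ↦ (cyclotomic m ℂ).eval z) _ w :=
      h2.congr_of_eventuallyEq (by
        filter_upwards [isOpen_ne.mem_nhds hw] with z hz
        exact (h.eval_eq z hz).symm)
    rw [((cyclotomic m ℂ).hasDerivAt w).unique h3]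
    simp [hx]
  have hd2 : (m : ℂ) * w ^ (m - 1) = (derivative (cyclotomic m ℂ)).eval w * aeval w G := by
    have h1 := congrArg (fun p : ℤ[X] ↦ aeval w (derivative p)) hG
    have h2 : aeval w (cyclotomic m ℤ) = 0 := by
      rw [aeval_def, eval₂_eq_eval_map, map_cyclotomic, hΦ0]
    have h3 : aeval w (derivative (cyclotomic m ℤ)) = (derivative (cyclotomic m ℂ)).eval w := by
      rw [aeval_def, eval₂_eq_eval_map, ← derivative_map, map_cyclotomic]
    simp only [derivative_sub, derivative_X_pow, derivative_one, sub_zero, derivative_mul, map_add,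
      map_mul, h2, h3, zero_mul, add_zero, map_pow, aeval_X, map_natCast] at h1
    exact h1
  have hw2 : ‖1 - (w ^ 2)⁻¹‖ = ‖w ^ 2 - 1‖ := by
    have : w ^ 2 - 1 = w ^ 2 * (1 - (w ^ 2)⁻¹) := by field_simp
    rw [this, norm_mul, norm_pow, hnorm, one_pow, one_mul]
  have h4 := congrArg norm hd2
  rw [hd1, norm_mul, norm_mul, norm_mul, norm_mul, norm_pow, norm_pow, hnorm, one_pow, one_pow,
    hw2, mul_one, mul_one, Complex.norm_natCast] at h4
  rw [h4, map_mul, norm_mul, ← mul_assoc]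
  simp

lemma cyclotomic_eq_prod (h : IsHalfCyclotomic P m) {w : ℂ → ℂ}
    (hw : ∀ x, w x ≠ 0 ∧ w x + (w x)⁻¹ = x) :
    cyclotomic m ℂ = (((P.map (Int.castRingHom ℂ)).roots.map w +
      (P.map (Int.castRingHom ℂ)).roots.map fun x ↦ (w x)⁻¹).map fun a ↦ X - C a).prod := by
  refine eq_of_infinite_eval_eq _ _ ((Set.finite_singleton (0 : ℂ)).infinite_compl.mono ?_)
  intro z hz
  replace hz : z ≠ 0 := hz
  have hs := IsAlgClosed.splits (P.map (Int.castRingHom ℂ))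
  have hP : aeval (z + z⁻¹) P =
      ((P.map (Int.castRingHom ℂ)).roots.map fun x ↦ z + z⁻¹ - x).prod := by
    have e : aeval (z + z⁻¹) P = (P.map (Int.castRingHom ℂ)).eval (z + z⁻¹) := by
      rw [aeval_def, eval₂_eq_eval_map]
      rfl
    rw [e, hs.eval_eq_prod_roots_of_monic (h.monic.map _)]
  have hcard : P.natDegree = Multiset.card (P.map (Int.castRingHom ℂ)).roots := by
    rw [← hs.natDegree_eq_card_roots, h.monic.natDegree_map]
  show (cyclotomic m ℂ).eval z = _
  rw [← h.eval_eq z hz, hP, hcard, eval_multiset_prod, Multiset.map_map, Multiset.map_add,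
    Multiset.prod_add, Multiset.map_map, Multiset.map_map, ← Multiset.prod_map_mul,
    ← Multiset.prod_replicate, ← Multiset.map_const', ← Multiset.prod_map_mul]
  congr 2
  ext x
  obtain ⟨h1, h2⟩ := hw x
  simp only [Function.comp_apply, eval_sub, eval_X, eval_C]
  conv_lhs => rw [← h2]
  field_simp
  ring

/-- Let D be the product and d = deg P. As D is a nonzero integer up to sign, D ≥ 1. The roots of
Φ_m are the pairs w, 1/w over the roots x of P, and multiplying `norm_derivative_mul` over all of
them gives D² R = m^(2d), where R = |Res(Φ_m, (X² - 1)G)| ≥ 1. -/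
lemma prod_norm_derivative_bounds (h : IsHalfCyclotomic P m) (hm : m ≠ 0) :
    1 ≤ ((P.map (Int.castRingHom ℂ)).roots.map fun x ↦ ‖aeval x (derivative P)‖).prod ∧
      ((P.map (Int.castRingHom ℂ)).roots.map fun x ↦ ‖aeval x (derivative P)‖).prod ≤
        (m : ℝ) ^ P.natDegree := by
  obtain ⟨G, hG⟩ := cyclotomic.dvd_X_pow_sub_one m ℤ
  choose w hw using exists_add_inv_eq
  set R := (P.map (Int.castRingHom ℂ)).roots with hR
  have hroot : ∀ x ∈ R, aeval x P = 0 := by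
    intro x hx
    have := isRoot_of_mem_roots hx
    rw [aeval_def, eval₂_eq_eval_map]
    exact this
  have hcard : Multiset.card R = P.natDegree := by
    rw [hR, ← (IsAlgClosed.splits _).natDegree_eq_card_roots, h.monic.natDegree_map]
  have hm' : (0 : ℝ) < m := by exact_mod_cast Nat.pos_of_ne_zero hm
  have h1 : ∀ x ∈ R, ‖aeval x (derivative P)‖ * ‖aeval (w x) ((X ^ 2 - 1) * G)‖ = m := by
    intro x hx
    have := h.norm_derivative_mul hm hG (hw x).1 (by rw [(hw x).2, hroot x hx])
    rwa [(hw x).2] at this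
  have h2 : ∀ x ∈ R, ‖aeval x (derivative P)‖ * ‖aeval (w x)⁻¹ ((X ^ 2 - 1) * G)‖ = m := by
    intro x hx
    have hx2 : (w x)⁻¹ + (w x)⁻¹⁻¹ = x := by rw [inv_inv, add_comm, (hw x).2]
    have := h.norm_derivative_mul hm hG (inv_ne_zero (hw x).1) (by rw [hx2, hroot x hx])
    rwa [hx2] at this
  have hD1 : 1 ≤ (R.map fun x ↦ ‖aeval x (derivative P)‖).prod :=
    one_le_prod_norm_aeval_roots h.monic fun x hx h0 ↦ by
      have := h1 x hx
      rw [h0, norm_zero, zero_mul] at this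
      exact hm'.ne this
  refine ⟨hD1, ?_⟩
  set D := (R.map fun x ↦ ‖aeval x (derivative P)‖).prod with hD
  have hconst : ∀ f : ℂ → ℝ, (∀ x ∈ R, ‖aeval x (derivative P)‖ * f x = m) →
      D * (R.map f).prod = (m : ℝ) ^ P.natDegree := by
    intro f hf
    rw [hD, ← Multiset.prod_map_mul, Multiset.map_congr rfl hf, Multiset.map_const',
      Multiset.prod_replicate, hcard]
  have e1 := hconst _ h1
  have e2 := hconst _ h2
  have hcyc : ((cyclotomic m ℤ).map (Int.castRingHom ℂ)).roots =
      R.map w + R.map fun x ↦ (w x)⁻¹ := by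
    rw [map_cyclotomic, h.cyclotomic_eq_prod hw, roots_multiset_prod_X_sub_C]
  have hH := one_le_prod_norm_aeval_roots (cyclotomic.monic m ℤ) (H := (X ^ 2 - 1) * G) (by
    intro v hv h0
    rw [hcyc, Multiset.mem_add, Multiset.mem_map, Multiset.mem_map] at hv
    obtain ⟨x, hx, rfl⟩ | ⟨x, hx, rfl⟩ := hv
    · have := h1 x hx
      rw [h0, norm_zero, mul_zero] at this
      exact hm'.ne this
    · have := h2 x hx
      rw [h0, norm_zero, mul_zero] at this
      exact hm'.ne this)
  rw [hcyc, Multiset.map_add, Multiset.prod_add, Multiset.map_map, Multiset.map_map] at hH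
  simp only [Function.comp_def] at hH
  generalize (R.map fun x ↦ ‖aeval (w x) ((X ^ 2 - 1) * G)‖).prod = p1 at *
  generalize (R.map fun x ↦ ‖aeval (w x)⁻¹ ((X ^ 2 - 1) * G)‖).prod = p2 at *
  refine le_of_sq_le_sq ?_ (by positivity)
  calc D ^ 2 = D ^ 2 * 1 := (mul_one _).symm
    _ ≤ D ^ 2 * (p1 * p2) := mul_le_mul_of_nonneg_left hH (sq_nonneg D)
    _ = (D * p1) * (D * p2) := by ring
    _ = ((m : ℝ) ^ P.natDegree) ^ 2 := by rw [e1, e2, sq]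

lemma abs_disc_bounds (h : IsHalfCyclotomic P m) (hm : m ≠ 0) (hd : 2 ≤ P.natDegree) :
    1 ≤ |disc (homog (P.map (Int.castRingHom ℝ)))| ∧
      |disc (homog (P.map (Int.castRingHom ℝ)))| ≤ (m : ℝ) ^ P.natDegree := by
  have hmon := h.monic.map (Int.castRingHom ℝ)
  have hdeg : (P.map (Int.castRingHom ℝ)).natDegree = P.natDegree := h.monic.natDegree_map _
  have key := abs_disc_mul_leadingCoeff (isHomogeneous_homog (P.map (Int.castRingHom ℝ)))
    (by rwa [hdeg]) (by rw [dehom_homog])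
  rw [dehom_homog, hmon.leadingCoeff, abs_one, mul_one, derivative_map, resultant_map_map, hdeg,
    eq_intCast, ← prod_norm_aeval_roots h.monic (natDegree_derivative_le P)] at key
  rw [key]
  exact h.prod_norm_derivative_bounds hm

end IsHalfCyclotomic

end BinaryForm

end

/-! ### Limits for the minimal polynomials -/

noncomputable section

namespace BinaryForm

open Polynomial Filter

namespace IsHalfCyclotomic

variable {P : ℤ[X]} {m : ℕ}

lemma le_mul_natDegree_pow (h : IsHalfCyclotomic P m) (hm : m ≠ 0) :
    m ≤ 384 * P.natDegree ^ 3 := by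
  refine (le_totient_pow_three hm).trans (le_of_eq ?_)
  rw [← h.two_mul_natDegree]
  ring

lemma card_bound (h : IsHalfCyclotomic P m) (hm : m ≠ 0) :
    2 / (P.natDegree : ℝ) * (moebiusDivisors m 1 ∪ moebiusDivisors m (-1)).card ≤
      (3072 / (m : ℝ)) ^ (1 / 3 : ℝ) := by
  have h1 : (m : ℝ) * 8 ^ m.primeFactors.card ≤ 384 * (P.natDegree : ℝ) ^ 3 := by
    have := mul_eight_pow_le hm
    rw [← h.two_mul_natDegree] at this
    have h2 : (m : ℝ) * 8 ^ m.primeFactors.card ≤ 48 * (2 * (P.natDegree : ℝ)) ^ 3 := by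
      exact_mod_cast this
    linarith
  have h2 : ((moebiusDivisors m 1 ∪ moebiusDivisors m (-1)).card : ℝ) ≤
      2 ^ m.primeFactors.card := by
    exact_mod_cast card_moebiusDivisors_le m
  have hm' : (0 : ℝ) < m := by exact_mod_cast Nat.pos_of_ne_zero hm
  have hd : (0 : ℝ) < P.natDegree := by
    have := h.two_mul_natDegree
    have := Nat.totient_pos.2 (Nat.pos_of_ne_zero hm)
    exact_mod_cast (by omega : 0 < P.natDegree)
  refine (mul_le_mul_of_nonneg_left h2 (by positivity)).trans ?_
  have hx : 0 ≤ 2 / (P.natDegree : ℝ) * 2 ^ m.primeFactors.card := by positivity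
  have e : (2 / (P.natDegree : ℝ) * 2 ^ m.primeFactors.card) ^ 3 =
      8 * 8 ^ m.primeFactors.card / (P.natDegree : ℝ) ^ 3 := by
    have : (8 : ℝ) ^ m.primeFactors.card = (2 ^ m.primeFactors.card) ^ 3 := by
      rw [← pow_mul, mul_comm, pow_mul]
      norm_num
    rw [this]
    field_simp
    norm_num
  calc _ = ((2 / (P.natDegree : ℝ) * 2 ^ m.primeFactors.card) ^ 3) ^ (1 / 3 : ℝ) := by
        rw [← Real.rpow_natCast _ 3, ← Real.rpow_mul hx]
        norm_num
    _ ≤ _ := by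
        refine Real.rpow_le_rpow (by positivity) ?_ (by norm_num)
        rw [e, div_le_div_iff₀ (by positivity) hm']
        linarith

lemma disc_rpow_bounds (h : IsHalfCyclotomic P m) (hm : m ≠ 0) (hd : 2 ≤ P.natDegree) :
    1 ≤ |disc (homog (P.map (Int.castRingHom ℝ)))| ^
      (1 / ((P.natDegree : ℝ) * ((P.natDegree : ℝ) - 1))) ∧
    |disc (homog (P.map (Int.castRingHom ℝ)))| ^
      (1 / ((P.natDegree : ℝ) * ((P.natDegree : ℝ) - 1))) ≤
      384 ^ (1 / ((P.natDegree : ℝ) - 1)) *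
        ((P.natDegree : ℝ) ^ (1 / ((P.natDegree : ℝ) - 1))) ^ 3 := by
  obtain ⟨h1, h2⟩ := h.abs_disc_bounds hm hd
  have h3 : (m : ℝ) ≤ 384 * (P.natDegree : ℝ) ^ 3 := by exact_mod_cast h.le_mul_natDegree_pow hm
  have hd' : (2 : ℝ) ≤ P.natDegree := by exact_mod_cast hd
  have hd1 : 0 < (P.natDegree : ℝ) - 1 := by linarith
  refine ⟨Real.one_le_rpow h1 (by positivity), ?_⟩
  calc _ ≤ ((384 * (P.natDegree : ℝ) ^ 3) ^ P.natDegree) ^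
        (1 / ((P.natDegree : ℝ) * ((P.natDegree : ℝ) - 1))) := by
        gcongr
        exact h2.trans (by gcongr)
    _ = (384 * (P.natDegree : ℝ) ^ 3) ^ (1 / ((P.natDegree : ℝ) - 1)) := by
        rw [← Real.rpow_natCast (384 * _), ← Real.rpow_mul (by positivity)]
        congr 1
        field_simp
    _ = _ := by
        rw [Real.mul_rpow (by norm_num) (by positivity), ← Real.rpow_natCast,
          ← Real.rpow_natCast, ← Real.rpow_mul (by positivity), ← Real.rpow_mul (by positivity),
          mul_comm ((3 : ℕ) : ℝ)]

end IsHalfCyclotomic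

lemma tendsto_rpow_one_div_sub_one {c : ℝ} (hc : 0 < c) :
    Tendsto (fun x : ℝ ↦ c ^ (1 / (x - 1)) * (x ^ (1 / (x - 1))) ^ 3) atTop (nhds 1) := by
  have h1 : Tendsto (fun x : ℝ ↦ c ^ (1 / (x - 1))) atTop (nhds 1) := by
    have h : Tendsto (fun x : ℝ ↦ 1 / (x - 1)) atTop (nhds 0) :=
      tendsto_const_nhds.div_atTop (tendsto_atTop_add_const_right _ (-1) tendsto_id)
    simpa using tendsto_const_nhds.rpow h (Or.inl hc.ne')
  have h2 : Tendsto (fun x : ℝ ↦ x ^ (1 / (x - 1))) atTop (nhds 1) := by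
    refine (tendsto_rpow_div_mul_add 1 1 (-1) zero_ne_one).congr fun x ↦ ?_
    simp [sub_eq_add_neg]
  simpa using h1.mul (h2.pow 3)

lemma tendsto_Q_of_isHalfCyclotomic {P : ℕ → ℤ[X]} {m : ℕ → ℕ}
    (h : ∀ᶠ n in atTop, IsHalfCyclotomic (P n) (m n)) (hm : Tendsto m atTop atTop) :
    Tendsto (fun n ↦ Q (homog ((P n).map (Int.castRingHom ℝ)))) atTop (nhds (16 / 3)) := by
  have hm0 : ∀ᶠ n in atTop, m n ≠ 0 := hm.eventually (eventually_ne_atTop 0)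
  have hd : Tendsto (fun n ↦ (P n).natDegree) atTop atTop := by
    rw [tendsto_atTop]
    intro N
    -- The degree tends to infinity with m because m ≤ 384 d³.
    filter_upwards [h, hm0, hm.eventually (eventually_gt_atTop (384 * N ^ 3))] with n hn hn0 hN
    by_contra! hlt
    have := hn.le_mul_natDegree_pow hn0
    have h3 := Nat.pow_le_pow_left hlt.le 3
    omega
  have harea := tendsto_areaInt (p := fun n ↦ (P n).map (Int.castRingHom ℝ))
    (d := fun n ↦ (P n).natDegree) (h.mono fun n hn ↦ hn.isCycloQuotient)
    (hm0.mono fun n hn ↦ moebiusDivisors_union_nonempty hn)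
    (hd.eventually (eventually_ne_atTop 0)) (by
      have hlim : Tendsto (fun n ↦ (3072 / (m n : ℝ)) ^ (1 / 3 : ℝ)) atTop (nhds 0) := by
        have h1 : Tendsto (fun n ↦ 3072 / (m n : ℝ)) atTop (nhds 0) :=
          (tendsto_const_div_atTop_nhds_zero_nat 3072).comp hm
        simpa using h1.rpow_const (Or.inr (by norm_num : (0 : ℝ) ≤ 1 / 3))
      refine tendsto_of_tendsto_of_tendsto_of_le_of_le' tendsto_const_nhds hlim
        (.of_forall fun n ↦ by positivity) ?_
      filter_upwards [h, hm0] with n hn hn0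
      exact hn.card_bound hn0)
  have hdR : Tendsto (fun n ↦ ((P n).natDegree : ℝ)) atTop atTop :=
    tendsto_natCast_atTop_atTop.comp hd
  have hdisc : Tendsto (fun n ↦ |disc (homog ((P n).map (Int.castRingHom ℝ)))| ^
      (1 / (((P n).natDegree : ℝ) * (((P n).natDegree : ℝ) - 1)))) atTop (nhds 1) := by
    refine tendsto_of_tendsto_of_tendsto_of_le_of_le' tendsto_const_nhds
      ((tendsto_rpow_one_div_sub_one (by norm_num : (0 : ℝ) < 384)).comp hdR) ?_ ?_ <;>
      filter_upwards [h, hm0, hd.eventually (eventually_ge_atTop 2)] with n hn hn0 hn2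
    · exact (hn.disc_rpow_bounds hn0 hn2).1
    · exact (hn.disc_rpow_bounds hn0 hn2).2
  refine (tendsto_ofReal_mul (by simp) hdisc harea).congr' ?_
  filter_upwards [h, hd.eventually (eventually_ne_atTop 0)] with n hn hn0
  have hmon := hn.monic.map (Int.castRingHom ℝ)
  have hdeg : ((P n).map (Int.castRingHom ℝ)).natDegree = (P n).natDegree :=
    hn.monic.natDegree_map _
  rw [Q, totalDegree_homog hmon.ne_zero, area_homog (by rwa [hdeg]), hdeg]

lemma tendsto_Q_minpoly {α : ℕ → ℝ} {ζ : ℕ → ℂ} {m : ℕ → ℕ}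
    (hζ : ∀ᶠ n in atTop, IsPrimitiveRoot (ζ n) (m n)) (hα : ∀ n, (α n : ℂ) = ζ n + (ζ n)⁻¹)
    (hm : Tendsto m atTop atTop) :
    Tendsto (fun n ↦ Q (homog ((minpoly ℚ (α n)).map (algebraMap ℚ ℝ)))) atTop
      (nhds (16 / 3)) := by
  have hex : ∀ n, ∃ P : ℤ[X], IsPrimitiveRoot (ζ n) (m n) → 3 ≤ m n →
      IsHalfCyclotomic P (m n) ∧
        (minpoly ℚ (α n)).map (algebraMap ℚ ℝ) = P.map (Int.castRingHom ℝ) := by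
    intro n
    by_cases h : IsPrimitiveRoot (ζ n) (m n) ∧ 3 ≤ m n
    · obtain ⟨P, hP⟩ := exists_isHalfCyclotomic h.2 h.1 (hα n)
      exact ⟨P, fun _ _ ↦ hP⟩
    -- A default polynomial for the indices where the hypotheses fail; it is irrelevant for the
    -- limit.
    · exact ⟨0, fun h1 h2 ↦ absurd ⟨h1, h2⟩ h⟩
  choose P hP using hex
  have h3 := hm.eventually (eventually_ge_atTop 3)
  refine (tendsto_Q_of_isHalfCyclotomic (P := P) (m := m) ?_ hm).congr' ?_ <;>
    filter_upwards [hζ, h3] with n h1 h2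
  · exact (hP n h1 h2).1
  · rw [(hP n h1 h2).2]

theorem tendsto_Q_Psi : Tendsto (fun n : ℕ ↦ Q (Psi n)) atTop (nhds (16 / 3)) := by
  refine tendsto_Q_minpoly (ζ := fun n ↦ Complex.exp (2 * Real.pi * Complex.I / n))
    (m := fun n ↦ n) ?_ (fun n ↦ ?_) tendsto_id
  · filter_upwards [eventually_ne_atTop 0] with n hn
    exact Complex.isPrimitiveRoot_exp n hn
  · push_cast
    rw [← Complex.exp_neg, Complex.two_cos]
    congr 2 <;> ring

/-- With η = exp(2πi/n) and ζ = -iη, 2 sin(2π/n) = ζ + 1/ζ. The exact order m of ζ depends on n mod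
8, but only its growth is needed: η^(4m) = 1 gives n ≤ 4m. -/
theorem tendsto_Q_Pi : Tendsto (fun n : ℕ ↦ Q (Pi n)) atTop (nhds (16 / 3)) := by
  set η : ℕ → ℂ := fun n ↦ Complex.exp (2 * Real.pi * Complex.I / n) with hη
  have hpow : ∀ n, n ≠ 0 → (-Complex.I * η n) ^ (4 * n) = 1 := by
    intro n hn
    rw [mul_pow, pow_mul (-Complex.I), pow_mul' (η n),
      (Complex.isPrimitiveRoot_exp n hn).pow_eq_one, one_pow, mul_one, Even.neg_pow (by decide),
      Complex.I_pow_four, one_pow]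
  have hle : ∀ n, n ≠ 0 → n ≤ 4 * orderOf (-Complex.I * η n) := by
    intro n hn
    have hpos : 0 < orderOf (-Complex.I * η n) :=
      orderOf_pos_iff.2 (isOfFinOrder_iff_pow_eq_one.2 ⟨4 * n, by omega, hpow n hn⟩)
    refine Nat.le_of_dvd (by omega) ?_
    refine (Complex.isPrimitiveRoot_exp n hn).dvd_of_pow_eq_one _ ?_
    have e : η n = Complex.I * (-Complex.I * η n) := by
      rw [← mul_assoc, mul_neg, Complex.I_mul_I, neg_neg, one_mul]
    have h1 := pow_orderOf_eq_one (-Complex.I * η n)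
    generalize orderOf (-Complex.I * η n) = k at h1 ⊢
    show η n ^ _ = 1
    rw [e, mul_pow, pow_mul Complex.I, Complex.I_pow_four, one_pow, one_mul, mul_comm 4, pow_mul,
      h1, one_pow]
  refine tendsto_Q_minpoly (ζ := fun n ↦ -Complex.I * η n)
    (m := fun n ↦ orderOf (-Complex.I * η n)) (.of_forall fun n ↦ IsPrimitiveRoot.orderOf _)
    (fun n ↦ ?_) ?_
  · push_cast
    rw [mul_inv, inv_neg, Complex.inv_I, neg_neg, hη]
    simp only
    rw [← Complex.exp_neg, Complex.two_sin]
    have e : 2 * (Real.pi : ℂ) * Complex.I / n = 2 * Real.pi / n * Complex.I := by ring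
    rw [e, neg_mul]
    ring
  · rw [tendsto_atTop]
    intro N
    filter_upwards [eventually_ge_atTop (4 * N), eventually_ne_atTop 0] with n hn hn0
    have := hle n hn0
    omega

end BinaryForm

end

theorem proposition2 :
    (∀ n : ℕ, 3 ≤ n →
      (BinaryForm.disc (BinaryForm.S n) ≠ 0 ∧ BinaryForm.disc (BinaryForm.T n) ≠ 0 ∧
        BinaryForm.disc (BinaryForm.U n) ≠ 0 ∧ BinaryForm.Q (BinaryForm.S n) ≠ ⊤) ∧
      BinaryForm.Q (BinaryForm.T n) ≤ BinaryForm.Q (BinaryForm.S n) ∧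
      BinaryForm.Q (BinaryForm.U n) ≤ BinaryForm.Q (BinaryForm.S n)) ∧
    Filter.Tendsto (fun n : ℕ => BinaryForm.Q (BinaryForm.Psi n)) Filter.atTop (nhds (16 / 3)) ∧
    Filter.Tendsto (fun n : ℕ => BinaryForm.Q (BinaryForm.Pi n)) Filter.atTop (nhds (16 / 3)) ∧
    Filter.Tendsto (fun n : ℕ => BinaryForm.Q (BinaryForm.T n)) Filter.atTop (nhds (16 / 3)) ∧
    Filter.Tendsto (fun n : ℕ => BinaryForm.Q (BinaryForm.U n)) Filter.atTop (nhds (16 / 3)) :=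
  ⟨fun _ hn ↦ ⟨⟨BinaryForm.disc_S_ne_zero (by omega), BinaryForm.disc_T_ne_zero (by omega),
    BinaryForm.disc_U_ne_zero (by omega), BinaryForm.Q_S_ne_top hn⟩, BinaryForm.Q_T_le hn,
    BinaryForm.Q_U_le hn⟩, BinaryForm.tendsto_Q_Psi, BinaryForm.tendsto_Q_Pi,
    BinaryForm.tendsto_Q_T, BinaryForm.tendsto_Q_U⟩
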